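/- **Setting.** Let $d\in\{1,2,3\}$ and let $\Omega\subset\mathbb R^d$ be a bounded Lipschitz domain (open, connected) whose boundary is $\partial\Omega=\overline{\Gamma_D\cup\Gamma_N\cup\Gamma_R}$ with pairwise disjoint, relatively open $\Gamma_D,\Gamma_N,\Gamma_R\subset\partial\Omega$, where $\Gamma_D$ and $\Gamma_N$ may be empty and $\Gamma_R$ has positive surface measure. Let $\kappa>0$, let $V=\{v\in W^{1,2}(\Omega;\mathbb C): v=0\text{ on }\Gamma_D\}$ with $\|v\|_V=(\kappa^2\|v\|_\Omega^2+\|\nabla v\|_\Omega^2)^{1/2}$, where $\|\cdot\|_\Omega$ is the norm of $L^2(\Omega)$ and $(u,v)_\Omega=\int_\Omega u\cdot\bar v\,dx$, and let $$a(u,v)=(\nabla u,\nabla v)_\Omega-\kappa^2(u,v)_\Omega-i\kappa\int_{\Gamma_R}u\bar v\,ds .$$ Let $\mathcal T_H$ be a finite face-to-face mesh of $\overline\Omega$ by closed nondegenerate $d$-simplices such that $\overline{\Gamma_D}$ is a union of $(d-1)$-dimensional faces of the mesh. Let $H_T=\operatorname{diam}T$; the symbol $H$ denotes both the function equal to $H_T$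 on each $T$ and its maximum. Let $V_H\subset V$ be the space of all $v\in V$ that are affine on every $T\in\mathcal T_H$, let $\mathcal N_H$ be the set of mesh vertices not in $\overline{\Gamma_D}$, and let $\phi_z$ be the continuous piecewise affine nodal basis function of $z\in\mathcal N_H$. Put $$\mathcal I_Hv=\sum_{z\in\mathcal N_H}\frac{(v,\phi_z)_\Omega}{(1,\phi_z)_\Omega}\,\phi_z ,\qquad W=\ker\big(\mathcal I_H:V\to V_H\big).$$ Let $\Omega_{T,1}$ be the union of all elements that meet $T$, let $C_{\mathrm{ol}}=\max_T\#\{K\in\mathcal T_H: K\subset\Omega_{T,1}\}$, and let $C_I\in[0,\infty]$ be the smallest constant such that, for all $v\in V$ and $T\in\mathcal T_H$, $$H_T^{-1}\|v-\mathcal I_Hv\|_{L^2(T)}+\|\nabla(v-\mathcal I_Hv)\|_{L^2(T)}\le C_I\|\nabla v\|_{L^2(\Omega_{T,1})}.$$ (Hence the theorem also holds with any larger constant in place of $C_I$.) **Theorem (error of the ideal method).** Assume the resolution condition $$H\kappa\le\frac{1}{\sqrt{2C_{\mathrm{ol}}}\;C_I},\qquad H=\max_T H_T .$$ Then for every $v\in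 V$ there are a unique $\mathcal C_\infty v\in W$ and a unique $\mathcal C_\infty^*v\in W$ such that $$a(\mathcal C_\infty v,w)=a(v,w)\quad\text{and}\quad a(w,\mathcal C_\infty^*v)=a(w,v)\qquad\text{for all }w\in W.$$ Put $V_{H,\infty}=(1-\mathcal C_\infty)V_H$ and $V_{H,\infty}^*=(1-\mathcal C_\infty^*)V_H$. Let $f\in L^2(\Omega)$ and let $u\in V$ satisfy $a(u,v)=(f,v)_\Omega$ for all $v\in V$. Then $u_{H,\infty}:=(1-\mathcal C_\infty)u$ belongs to $V_{H,\infty}$, and it is the unique element of $V_{H,\infty}$ with $$a(u_{H,\infty},v)=(f,v)_\Omega\qquad\text{for all }v\in V_{H,\infty}^* .$$ Moreover, $$\|u-u_{H,\infty}\|_V\le 3\sqrt{C_{\mathrm{ol}}}\;C_I\,\|Hf\|_\Omega ,$$ where $H$ on the right-hand side is the local mesh width function. -/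

import Mathlib

open MeasureTheory Filter Topology
open scoped ENNReal NNReal ContDiff ComplexConjugate

noncomputable section

namespace Helmholtz

/-! ### Domains and their boundaries -/

/-- Euclidean space `ℝᵈ`. -/
abbrev Pt (d : ℕ) : Type := EuclideanSpace ℝ (Fin d)

variable {d : ℕ}

/-- A bounded Lipschitz domain: a bounded, nonempty, connected open set that, near each of its
boundary points, consists of the points that lie, in some direction `e`, strictly above the graph
of a Lipschitz function `ψ` of the directions orthogonal to `e`. -/
structure IsLipschitzDomain (Ω : Set (Pt d)) : Prop where
  isOpen : IsOpen Ω
  isConnected : IsConnected Ω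
  isBounded : Bornology.IsBounded Ω
  locally_graph : ∀ x₀ ∈ frontier Ω, ∃ (e : Pt d) (ψ : Pt d → ℝ) (K : ℝ≥0) (r : ℝ),
    ‖e‖ = 1 ∧ 0 < r ∧ LipschitzWith K ψ ∧ (∀ (x : Pt d) (t : ℝ), ψ (x + t • e) = ψ x) ∧
      ∀ x ∈ Metric.ball x₀ r, x ∈ Ω ↔ ψ x < inner ℝ e x

/-- Lebesgue measure on `Ω`. -/
abbrev vol (Ω : Set (Pt d)) : Measure (Pt d) := volume.restrict Ω

/-- Surface measure on `∂Ω`: the `(d-1)`-dimensional Hausdorff measure in its Euclidean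
normalization (counting measure for `d = 1`). -/
abbrev surf (Ω : Set (Pt d)) : Measure (Pt d) :=
  (Measure.euclideanHausdorffMeasure (d - 1)).restrict (frontier Ω)

/-- `Γ` is a relatively open subset of `∂Ω`. -/
def IsRelOpen (Ω Γ : Set (Pt d)) : Prop := ∃ U : Set (Pt d), IsOpen U ∧ Γ = U ∩ frontier Ω

/-- The boundary `∂Ω` consists of a Dirichlet, a Neumann and a Robin part; the Dirichlet and the
Neumann part may be empty, the Robin part has positive surface measure. -/
structure IsBoundaryPartition (Ω ΓD ΓN ΓR : Set (Pt d)) : Prop where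
  relOpen_D : IsRelOpen Ω ΓD
  relOpen_N : IsRelOpen Ω ΓN
  relOpen_R : IsRelOpen Ω ΓR
  disjoint_DN : Disjoint ΓD ΓN
  disjoint_DR : Disjoint ΓD ΓR
  disjoint_NR : Disjoint ΓN ΓR
  frontier_eq : frontier Ω = closure (ΓD ∪ ΓN ∪ ΓR)
  robin_pos : 0 < surf Ω ΓR

/-! ### Sobolev functions and traces -/

/-- `L²(Ω)`, complex-valued. -/
abbrev L2 (Ω : Set (Pt d)) : Type := Lp ℂ 2 (vol Ω)

/-- `L²(Ω)ᵈ`, vector-valued. -/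
abbrev L2vec (Ω : Set (Pt d)) : Type := Lp (EuclideanSpace ℂ (Fin d)) 2 (vol Ω)

/-- `L²(∂Ω)`, complex-valued. -/
abbrev L2bdry (Ω : Set (Pt d)) : Type := Lp ℂ 2 (surf Ω)

/-- The classical partial derivative `∂ⱼ φ`. -/
def pderiv (φ : Pt d → ℂ) (j : Fin d) (x : Pt d) : ℂ :=
  fderiv ℝ φ x (EuclideanSpace.single j (1 : ℝ))

/-- The classical gradient. -/
def grad (φ : Pt d → ℂ) (x : Pt d) : EuclideanSpace ℂ (Fin d) :=
  WithLp.toLp 2 fun j => pderiv φ j x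

/-- `G` is the weak gradient of `u` on `Ω`. -/
def IsWeakGradient (Ω : Set (Pt d)) (u : L2 Ω) (G : L2vec Ω) : Prop :=
  ∀ φ : Pt d → ℂ, ContDiff ℝ ∞ φ → HasCompactSupport φ → tsupport φ ⊆ Ω → ∀ j : Fin d,
    ∫ x in Ω, u x * pderiv φ j x = -∫ x in Ω, G x j * φ x

/-- `g ∈ L²(∂Ω)` is the boundary trace of `u ∈ W^{1,2}(Ω)` with weak gradient `G`: the trace
operator is the continuous extension of `φ ↦ φ|∂Ω` from functions that are smooth up to the
boundary to `W^{1,2}(Ω)`. -/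
def IsTrace (Ω : Set (Pt d)) (u : L2 Ω) (G : L2vec Ω) (g : L2bdry Ω) : Prop :=
  ∃ φ : ℕ → Pt d → ℂ, (∀ n, ContDiff ℝ ∞ (φ n) ∧ HasCompactSupport (φ n)) ∧
    Tendsto (fun n => eLpNorm (fun x => φ n x - u x) 2 (vol Ω)) atTop (𝓝 0) ∧
    Tendsto (fun n => eLpNorm (fun x => grad (φ n) x - G x) 2 (vol Ω)) atTop (𝓝 0) ∧
    Tendsto (fun n => eLpNorm (fun x => φ n x - g x) 2 (surf Ω)) atTop (𝓝 0)

theorem contDiff_pderiv {φ : Pt d → ℂ} (hφ : ContDiff ℝ ∞ φ) (j : Fin d) :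
    Continuous (pderiv φ j) :=
  (hφ.continuous_fderiv (by simp)).clm_apply continuous_const

theorem hasCompactSupport_pderiv {φ : Pt d → ℂ} (hφ : HasCompactSupport φ) (j : Fin d) :
    HasCompactSupport (pderiv φ j) :=
  (hφ.fderiv (𝕜 := ℝ)).comp_left (g := fun L : Pt d →L[ℝ] ℂ =>
    L (EuclideanSpace.single j (1 : ℝ))) rfl

theorem integrable_mul_test {Ω : Set (Pt d)} (u : L2 Ω) {ψ : Pt d → ℂ} (h : Continuous ψ)
    (hc : HasCompactSupport ψ) : Integrable (fun x => u x * ψ x) (vol Ω) :=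
  (Lp.memLp u).integrable_mul (q := 2)
    ((h.memLp_of_hasCompactSupport hc (μ := volume)).restrict Ω)

theorem integrable_coord_mul_test {Ω : Set (Pt d)} (G : L2vec Ω) (j : Fin d) {ψ : Pt d → ℂ}
    (h : Continuous ψ) (hc : HasCompactSupport ψ) :
    Integrable (fun x => G x j * ψ x) (vol Ω) :=
  MemLp.integrable_mul (p := 2) (q := 2)
    ((EuclideanSpace.proj (𝕜 := ℂ) j : EuclideanSpace ℂ (Fin d) →L[ℂ] ℂ).comp_memLp' (Lp.memLp G))
    ((h.memLp_of_hasCompactSupport hc (μ := volume)).restrict Ω)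

theorem IsWeakGradient.add {Ω : Set (Pt d)} {u v : L2 Ω} {G K : L2vec Ω}
    (hu : IsWeakGradient Ω u G) (hv : IsWeakGradient Ω v K) :
    IsWeakGradient Ω (u + v) (G + K) := by
  intro φ h1 h2 h3 j
  have e1 : ∫ x in Ω, (u + v : L2 Ω) x * pderiv φ j x
      = ∫ x in Ω, (u x * pderiv φ j x + v x * pderiv φ j x) := by
    apply integral_congr_ae
    filter_upwards [Lp.coeFn_add u v] with x hx
    rw [hx, Pi.add_apply, add_mul]
  have e2 : ∫ x in Ω, (G + K : L2vec Ω) x j * φ x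
      = ∫ x in Ω, (G x j * φ x + K x j * φ x) := by
    apply integral_congr_ae
    filter_upwards [Lp.coeFn_add G K] with x hx
    rw [hx, Pi.add_apply, PiLp.add_apply, add_mul]
  rw [e1, e2, integral_add, integral_add, hu φ h1 h2 h3 j, hv φ h1 h2 h3 j, neg_add]
  · exact integrable_coord_mul_test G j h1.continuous h2
  · exact integrable_coord_mul_test K j h1.continuous h2
  · exact integrable_mul_test u (contDiff_pderiv h1 j) (hasCompactSupport_pderiv h2 j)
  · exact integrable_mul_test v (contDiff_pderiv h1 j) (hasCompactSupport_pderiv h2 j)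

theorem IsWeakGradient.smul {Ω : Set (Pt d)} {u : L2 Ω} {G : L2vec Ω} (c : ℂ)
    (hu : IsWeakGradient Ω u G) : IsWeakGradient Ω (c • u) (c • G) := by
  intro φ h1 h2 h3 j
  have e1 : ∫ x in Ω, (c • u : L2 Ω) x * pderiv φ j x = ∫ x in Ω, c * (u x * pderiv φ j x) := by
    apply integral_congr_ae
    filter_upwards [Lp.coeFn_smul c u] with x hx
    rw [hx, Pi.smul_apply, smul_eq_mul, mul_assoc]
  have e2 : ∫ x in Ω, (c • G : L2vec Ω) x j * φ x = ∫ x in Ω, c * (G x j * φ x) := by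
    apply integral_congr_ae
    filter_upwards [Lp.coeFn_smul c G] with x hx
    rw [hx, Pi.smul_apply, PiLp.smul_apply, smul_eq_mul, mul_assoc]
  rw [e1, e2, integral_const_mul, integral_const_mul, hu φ h1 h2 h3 j, mul_neg]

theorem grad_add {φ ψ : Pt d → ℂ} (hφ : ContDiff ℝ ∞ φ) (hψ : ContDiff ℝ ∞ ψ) (x : Pt d) :
    grad (φ + ψ) x = grad φ x + grad ψ x := by
  ext j
  simp [grad, pderiv, fderiv_add (hφ.differentiable (by simp) x) (hψ.differentiable (by simp) x)]

theorem grad_smul {φ : Pt d → ℂ} (hφ : ContDiff ℝ ∞ φ) (c : ℂ) (x : Pt d) :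
    grad (c • φ) x = c • grad φ x := by
  ext j
  simp [grad, pderiv, fderiv_const_smul (hφ.differentiable (by simp) x) c]

theorem continuous_grad {φ : Pt d → ℂ} (hφ : ContDiff ℝ ∞ φ) : Continuous (grad φ) :=
  (PiLp.continuous_toLp 2 _).comp (continuous_pi fun j => contDiff_pderiv hφ j)

theorem tendsto_eLpNorm_add {F : Type*} [NormedAddCommGroup F] {μ : Measure (Pt d)}
    {u v : Lp F 2 μ} {φ ψ : ℕ → Pt d → F} (hφ : ∀ n, AEStronglyMeasurable (φ n) μ)
    (hψ : ∀ n, AEStronglyMeasurable (ψ n) μ)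
    (h1 : Tendsto (fun n => eLpNorm (fun x => φ n x - u x) 2 μ) atTop (𝓝 0))
    (h2 : Tendsto (fun n => eLpNorm (fun x => ψ n x - v x) 2 μ) atTop (𝓝 0)) :
    Tendsto (fun n => eLpNorm (fun x => (φ n x + ψ n x) - (u + v : Lp F 2 μ) x) 2 μ)
      atTop (𝓝 0) := by
  refine tendsto_of_tendsto_of_tendsto_of_le_of_le tendsto_const_nhds
    (by simpa using h1.add h2) (fun _ => zero_le) fun n => ?_
  refine le_trans (le_of_eq (eLpNorm_congr_ae ?_))
    (eLpNorm_add_le ((hφ n).sub (Lp.aestronglyMeasurable u))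
      ((hψ n).sub (Lp.aestronglyMeasurable v)) (by norm_num))
  filter_upwards [Lp.coeFn_add u v] with x hx
  simp only [hx, Pi.add_apply]
  abel

theorem tendsto_eLpNorm_smul {F : Type*} [NormedAddCommGroup F] [NormedSpace ℂ F]
    {μ : Measure (Pt d)} {u : Lp F 2 μ} {φ : ℕ → Pt d → F} (c : ℂ)
    (h1 : Tendsto (fun n => eLpNorm (fun x => φ n x - u x) 2 μ) atTop (𝓝 0)) :
    Tendsto (fun n => eLpNorm (fun x => c • φ n x - (c • u : Lp F 2 μ) x) 2 μ)
      atTop (𝓝 0) := by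
  have h := ENNReal.Tendsto.const_mul (a := ‖c‖ₑ) h1 (Or.inr (by simp))
  rw [mul_zero] at h
  refine h.congr fun n => ?_
  rw [← eLpNorm_const_smul]
  apply eLpNorm_congr_ae
  filter_upwards [Lp.coeFn_smul c u] with x hx
  simp only [hx, Pi.smul_apply, smul_sub]

theorem IsTrace.add {Ω : Set (Pt d)} {u v : L2 Ω} {G K : L2vec Ω} {g k : L2bdry Ω}
    (hu : IsTrace Ω u G g) (hv : IsTrace Ω v K k) : IsTrace Ω (u + v) (G + K) (g + k) := by
  obtain ⟨φ, a0, a1, a2, a3⟩ := hu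
  obtain ⟨ψ, b0, b1, b2, b3⟩ := hv
  refine ⟨fun n => φ n + ψ n, fun n => ⟨(a0 n).1.add (b0 n).1, (a0 n).2.add (b0 n).2⟩, ?_, ?_, ?_⟩
  · exact tendsto_eLpNorm_add (fun n => (a0 n).1.continuous.aestronglyMeasurable)
      (fun n => (b0 n).1.continuous.aestronglyMeasurable) a1 b1
  · simp only [fun n x => grad_add (a0 n).1 (b0 n).1 x]
    exact tendsto_eLpNorm_add (fun n => (continuous_grad (a0 n).1).aestronglyMeasurable)
      (fun n => (continuous_grad (b0 n).1).aestronglyMeasurable) a2 b2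
  · exact tendsto_eLpNorm_add (fun n => (a0 n).1.continuous.aestronglyMeasurable)
      (fun n => (b0 n).1.continuous.aestronglyMeasurable) a3 b3

theorem IsTrace.smul {Ω : Set (Pt d)} {u : L2 Ω} {G : L2vec Ω} {g : L2bdry Ω} (c : ℂ)
    (hu : IsTrace Ω u G g) : IsTrace Ω (c • u) (c • G) (c • g) := by
  obtain ⟨φ, a0, a1, a2, a3⟩ := hu
  refine ⟨fun n => c • φ n, fun n => ⟨contDiff_const.smul (a0 n).1, (a0 n).2.smul_left
    (f := fun _ => c)⟩, ?_, ?_, ?_⟩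
  · exact tendsto_eLpNorm_smul c a1
  · simp only [fun n x => grad_smul (a0 n).1 c x]
    exact tendsto_eLpNorm_smul c a2
  · exact tendsto_eLpNorm_smul c a3

theorem IsWeakGradient.zero (Ω : Set (Pt d)) : IsWeakGradient Ω 0 0 := by
  intro φ h1 h2 h3 j
  have e1 : ∫ x in Ω, (0 : L2 Ω) x * pderiv φ j x = 0 := by
    rw [← integral_zero (Pt d) ℂ (μ := vol Ω)]
    apply integral_congr_ae
    filter_upwards [Lp.coeFn_zero ℂ 2 (vol Ω)] with x hx
    rw [hx, Pi.zero_apply, zero_mul]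
  have e2 : ∫ x in Ω, (0 : L2vec Ω) x j * φ x = 0 := by
    rw [← integral_zero (Pt d) ℂ (μ := vol Ω)]
    apply integral_congr_ae
    filter_upwards [Lp.coeFn_zero (EuclideanSpace ℂ (Fin d)) 2 (vol Ω)] with x hx
    rw [hx, Pi.zero_apply, PiLp.zero_apply, zero_mul]
  rw [e1, e2, neg_zero]

theorem IsTrace.zero (Ω : Set (Pt d)) : IsTrace Ω 0 0 0 := by
  have key : ∀ {F : Type} [NormedAddCommGroup F] (μ : Measure (Pt d)),
      eLpNorm (fun x => (0 : F) - (0 : Lp F 2 μ) x) 2 μ = 0 := by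
    intro F _ μ
    rw [← eLpNorm_zero (α := Pt d) (ε := F) (p := 2) (μ := μ)]
    apply eLpNorm_congr_ae
    filter_upwards [Lp.coeFn_zero F 2 μ] with x hx
    simpa using hx
  have hg : ∀ x : Pt d, grad (fun _ : Pt d => (0 : ℂ)) x = 0 := by
    intro x; ext j; simp [grad, pderiv]
  refine ⟨fun _ _ => 0, fun n => ⟨contDiff_const, HasCompactSupport.zero⟩, ?_, ?_, ?_⟩
  · simp only [key]; exact tendsto_const_nhds
  · simp only [hg, key]; exact tendsto_const_nhds
  · simp only [key]; exact tendsto_const_nhds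

/-- The Sobolev space `V = {v ∈ W^{1,2}(Ω) | v = 0 on ΓD}`. An element is carried along with its
weak gradient and its boundary trace, both of which it determines. -/
def V (Ω ΓD : Set (Pt d)) : Submodule ℂ (L2 Ω × L2vec Ω × L2bdry Ω) where
  carrier := {v | IsWeakGradient Ω v.1 v.2.1 ∧ IsTrace Ω v.1 v.2.1 v.2.2 ∧
    ∀ᵐ x ∂(surf Ω).restrict ΓD, v.2.2 x = 0}
  add_mem' := by
    rintro u v ⟨a, b, c⟩ ⟨a', b', c'⟩
    refine ⟨a.add a', b.add b', ?_⟩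
    filter_upwards [c, c', ae_restrict_of_ae (Lp.coeFn_add u.2.2 v.2.2)] with x h1 h2 h3
    rw [Prod.snd_add, Prod.snd_add, h3, Pi.add_apply, h1, h2, add_zero]
  zero_mem' := by
    refine ⟨IsWeakGradient.zero Ω, IsTrace.zero Ω, ?_⟩
    filter_upwards [ae_restrict_of_ae (Lp.coeFn_zero ℂ 2 (surf Ω))] with x h
    exact h
  smul_mem' := by
    rintro k u ⟨a, b, c⟩
    refine ⟨a.smul k, b.smul k, ?_⟩
    filter_upwards [c, ae_restrict_of_ae (Lp.coeFn_smul k u.2.2)] with x h1 h3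
    rw [Prod.smul_snd, Prod.smul_snd, h3, Pi.smul_apply, h1, smul_zero]

/-- The function `v ∈ L²(Ω)` itself. -/
def V.val {Ω ΓD : Set (Pt d)} (v : V Ω ΓD) : L2 Ω := v.1.1

/-- The weak gradient `∇v`. -/
def V.gradient {Ω ΓD : Set (Pt d)} (v : V Ω ΓD) : L2vec Ω := v.1.2.1

/-- The boundary trace of `v`. -/
def V.trace {Ω ΓD : Set (Pt d)} (v : V Ω ΓD) : L2bdry Ω := v.1.2.2

/-! ### The variational problem -/

/-- The wave number weighted norm `‖v‖_V = (κ² ‖v‖² + ‖∇v‖²)^{1/2}`. -/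
def normV {Ω ΓD : Set (Pt d)} (κ : ℝ) (v : V Ω ΓD) : ℝ :=
  √(κ ^ 2 * ‖V.val v‖ ^ 2 + ‖V.gradient v‖ ^ 2)

/-- `(u, v)_Ω = ∫_Ω u · v̄`, linear in the first and antilinear in the second argument. -/
def pairing {F : Type*} [NormedAddCommGroup F] [InnerProductSpace ℂ F] {Ω : Set (Pt d)}
    (u v : Lp F 2 (vol Ω)) : ℂ := inner ℂ v u

/-- The Helmholtz form
`a(u, v) = (∇u, ∇v)_Ω - κ² (u, v)_Ω - i κ (u, v)_{ΓR}`. -/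
def form {Ω ΓD : Set (Pt d)} (ΓR : Set (Pt d)) (κ : ℝ) (u v : V Ω ΓD) : ℂ :=
  pairing (V.gradient u) (V.gradient v) - (κ : ℂ) ^ 2 * pairing (V.val u) (V.val v)
    - Complex.I * (κ : ℂ) * ∫ x in ΓR, V.trace u x * conj (V.trace v x) ∂(surf Ω)

/-- `u ∈ V` is a weak solution: `a(u, v) = (f, v)_Ω` for all `v ∈ V`. -/
def IsWeakSolution {Ω ΓD : Set (Pt d)} (ΓR : Set (Pt d)) (κ : ℝ) (f : L2 Ω) (u : V Ω ΓD) : Prop :=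
  ∀ v : V Ω ΓD, form ΓR κ u v = pairing f (V.val v)

/-! ### Meshes -/

/-- A regular (face-to-face) finite simplicial mesh of `Ω`; each element is given by its set of
`d + 1` affinely independent vertices. -/
structure Mesh (Ω : Set (Pt d)) where
  elements : Finset (Finset (Pt d))
  card_eq : ∀ T ∈ elements, T.card = d + 1
  affineIndependent : ∀ T ∈ elements, AffineIndependent ℝ ((↑) : T → Pt d)
  inter_eq : ∀ T ∈ elements, ∀ T' ∈ elements,
    convexHull ℝ (T : Set (Pt d)) ∩ convexHull ℝ (T' : Set (Pt d)) =
      convexHull ℝ ((T : Set (Pt d)) ∩ (T' : Set (Pt d)))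
  iUnion_eq : ⋃ T ∈ elements, convexHull ℝ (T : Set (Pt d)) = closure Ω

/-- The closed simplex spanned by a set of vertices. -/
abbrev simplex (T : Finset (Pt d)) : Set (Pt d) := convexHull ℝ (T : Set (Pt d))

/-- The local mesh width `H_T`. -/
def width (T : Finset (Pt d)) : ℝ := Metric.diam (simplex T)

namespace Mesh

variable {Ω : Set (Pt d)} (M : Mesh Ω)

/-- The maximal mesh width. -/
def maxWidth : ℝ := ⨆ T : M.elements, width T.1

/-- The mesh width function, equal to `H_T` in the interior of each element `T` (hence defined
up to the null set formed by the faces). -/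
def widthFun (x : Pt d) : ℝ :=
  ∑ T ∈ M.elements, (interior (simplex T)).indicator (fun _ => width T) x

/-- The patch `Ω_{T,1}`: the union of all elements that touch `T`. -/
def patch (T : Finset (Pt d)) : Set (Pt d) :=
  ⋃ T' ∈ {T' ∈ (M.elements : Set (Finset (Pt d))) | (simplex T' ∩ simplex T).Nonempty}, simplex T'

open Classical in
/-- The overlap constant: the maximal number of elements in a patch `Ω_{T,1}`. -/
def overlap : ℕ :=
  M.elements.sup fun T => (M.elements.filter fun K => simplex K ⊆ M.patch T).card

open Classical in
/-- All vertices of the mesh. -/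
def vertices : Finset (Pt d) := M.elements.biUnion id

/-- The mesh resolves the Dirichlet boundary: its closure is a union of `(d-1)`-dimensional faces
of elements. -/
def Resolves (ΓD : Set (Pt d)) : Prop :=
  ∃ 𝓕 : Finset (Finset (Pt d)), (∀ F ∈ 𝓕, F.card = d ∧ ∃ T ∈ M.elements, F ⊆ T) ∧
    closure ΓD = ⋃ F ∈ 𝓕, simplex F

open Classical in
/-- The vertices `𝒩_H` that do not lie on the (closed) Dirichlet boundary. -/
def freeVertices (ΓD : Set (Pt d)) : Finset (Pt d) := M.vertices.filter fun z => z ∉ closure ΓD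

/-- The vertices of an element form an affine basis. -/
def basis (T : Finset (Pt d)) (hT : T ∈ M.elements) : AffineBasis T ℝ (Pt d) where
  toFun := (↑)
  ind' := M.affineIndependent T hT
  tot' := (M.affineIndependent T hT).affineSpan_eq_top_iff_card_eq_finrank_add_one.2 (by
    rw [Fintype.card_coe, M.card_eq T hT, finrank_euclideanSpace_fin])

open Classical in
/-- The nodal basis function `φ_z`: on an element with vertex `z` it is the barycentric coordinate
of `z` (on faces, this does not depend on the element), and it vanishes elsewhere. -/
def hat (z x : Pt d) : ℝ :=
  if h : ∃ T : Finset (Pt d), T ∈ M.elements ∧ z ∈ T ∧ x ∈ simplex T then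
    (M.basis h.choose h.choose_spec.1).coord ⟨z, h.choose_spec.2.1⟩ x
  else 0

/-! ### Finite element space and quasi-interpolation -/

variable {ΓD : Set (Pt d)}

/-- The finite element space `V_H` of all `v ∈ V` that are affine on each element. -/
def femSpace (ΓD : Set (Pt d)) : Set (V Ω ΓD) :=
  {v | ∀ T ∈ M.elements, ∃ A : Pt d →ᵃ[ℝ] ℂ, ∀ᵐ x ∂(vol Ω).restrict (simplex T), V.val v x = A x}

/-- The nodal functional `α_z(v) = (v, φ_z)_Ω / (1, φ_z)_Ω`. -/
def nodal (z : Pt d) (v : V Ω ΓD) : ℂ :=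
  (∫ x in Ω, V.val v x * (M.hat z x : ℂ)) / ((∫ x in Ω, M.hat z x : ℝ) : ℂ)

/-- The weighted Clément quasi-interpolant `I_H v = ∑_{z ∈ 𝒩_H} α_z(v) φ_z`, a continuous,
piecewise affine function. -/
def clement (v : V Ω ΓD) (x : Pt d) : ℂ :=
  ∑ z ∈ M.freeVertices ΓD, M.nodal z v * (M.hat z x : ℂ)

/-- The `L²` norm on `S ∩ Ω`. -/
def normOn {F : Type*} [NormedAddCommGroup F] (Ω S : Set (Pt d)) (v : Pt d → F) : ℝ :=
  (eLpNorm v 2 (volume.restrict (S ∩ Ω))).toReal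

/-- `C` bounds the interpolation error on each element:
`H_T⁻¹ ‖v - I_H v‖_{L²(T)} + ‖∇(v - I_H v)‖_{L²(T)} ≤ C ‖∇v‖_{L²(Ω_{T,1})}`
for all `v ∈ V` and all elements `T`. -/
def IsClementBound (ΓD : Set (Pt d)) (C : ℝ≥0) : Prop :=
  ∀ v : V Ω ΓD, ∀ T ∈ M.elements,
    (width T)⁻¹ * normOn Ω (simplex T) (fun x => V.val v x - M.clement v x)
      + normOn Ω (simplex T) (fun x => V.gradient v x - grad (M.clement v) x)
      ≤ C * normOn Ω (M.patch T) (V.gradient v)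

/-- The interpolation constant: the smallest `C` that bounds the interpolation error on each
element (`∞` if there is none). -/
def clementConst (ΓD : Set (Pt d)) : ℝ≥0∞ :=
  ⨅ (C : ℝ≥0) (_ : M.IsClementBound ΓD C), (C : ℝ≥0∞)

/-- The resolution condition `H κ ≤ 1 / (√(2 C_ol) C_I)`. -/
def ResolutionCondition (ΓD : Set (Pt d)) (κ : ℝ) : Prop :=
  ENNReal.ofReal (M.maxWidth * κ) ≤
    1 / (ENNReal.ofReal √(2 * M.overlap) * M.clementConst ΓD)

/-! ### The ideal method -/

/-- The remainder space `W = ker I_H`. -/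
def remainder (ΓD : Set (Pt d)) : Set (V Ω ΓD) := {v | M.clement v =ᵐ[vol Ω] 0}

/-- `c ∈ W` and `a(c, w) = a(v, w)` for all `w ∈ W`. -/
def IsCorrection (ΓR : Set (Pt d)) (κ : ℝ) (v c : V Ω ΓD) : Prop :=
  c ∈ M.remainder ΓD ∧ ∀ w ∈ M.remainder ΓD, form ΓR κ c w = form ΓR κ v w

/-- `c ∈ W` and `a(w, c) = a(w, v)` for all `w ∈ W`. -/
def IsDualCorrection (ΓR : Set (Pt d)) (κ : ℝ) (v c : V Ω ΓD) : Prop :=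
  c ∈ M.remainder ΓD ∧ ∀ w ∈ M.remainder ΓD, form ΓR κ w c = form ΓR κ w v

/-- The corrector `C_∞ v`: the solution of the corrector problem. -/
def corrector (ΓR : Set (Pt d)) (κ : ℝ) (v : V Ω ΓD) : V Ω ΓD :=
  Classical.epsilon (M.IsCorrection ΓR κ v)

/-- The adjoint corrector `C_∞^* v`: the solution of the adjoint corrector problem. -/
def dualCorrector (ΓR : Set (Pt d)) (κ : ℝ) (v : V Ω ΓD) : V Ω ΓD :=
  Classical.epsilon (M.IsDualCorrection ΓR κ v)

/-- The ideal trial space `V_{H,∞} = (1 - C_∞) V_H`. -/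
def trialSpace (ΓD ΓR : Set (Pt d)) (κ : ℝ) : Set (V Ω ΓD) :=
  (fun v => v - M.corrector ΓR κ v) '' M.femSpace ΓD

/-- The ideal test space `V*_{H,∞} = (1 - C_∞^*) V_H`. -/
def testSpace (ΓD ΓR : Set (Pt d)) (κ : ℝ) : Set (V Ω ΓD) :=
  (fun v => v - M.dualCorrector ΓR κ v) '' M.femSpace ΓD

/-- `U ∈ V_{H,∞}` solves the Petrov-Galerkin problem `a(U, v) = (f, v)_Ω` for all
`v ∈ V*_{H,∞}`. -/
def IsPetrovGalerkin (ΓR : Set (Pt d)) (κ : ℝ) (f : L2 Ω) (U : V Ω ΓD) : Prop :=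
  U ∈ M.trialSpace ΓD ΓR κ ∧
    ∀ v ∈ M.testSpace ΓD ΓR κ, form ΓR κ U v = pairing f (V.val v)

end Mesh

end Helmholtz

end

/-! The error u − u_{H,∞} is the corrector C_∞ u itself, and it lies in W = ker I_H. For w in W the
interpolation estimate loses its I_H w term and, summed over the elements, reads ‖H⁻¹ w‖ ≤ √C_ol C_I
‖∇w‖ (`Mesh.eLpNorm_inv_widthFun_mul_le`). With the resolution condition this gives κ²‖w‖² ≤ ½‖∇w‖²
(`Mesh.remainder_coercive`), so Re a(w,w) = ‖∇w‖² − κ²‖w‖² ≥ ⅓‖w‖_V² and Lax–Milgram on W yields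
both correctors (`exists_corrections`). For c = C_∞ u one finds ⅓‖c‖_V² ≤ |a(c,c)| = |a(u,c)| =
|(Hf, H⁻¹c)| ≤ ‖Hf‖ √C_ol C_I ‖∇c‖; dividing by ‖c‖_V gives the bound, 3 being the inverse of the
coercivity constant (`Mesh.normV_le`).

The Galerkin statement is algebra. Functions (1 − C_∞)v are a-orthogonal to W in the first slot,
functions (1 − C_∞^*)v in the second. Moreover V = V_H + W (`Mesh.exists_sub_mem_remainder`): the
nodal functionals are multiples of L² inner products with the hat functions, so what remains after
L² projection onto the hats is killed by I_H. As C_∞ fixes W, the ideal trial space is all of (1 −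
C_∞)V.

Uniqueness reduces to the Helmholtz problem on V: V is the sum of the test space and W, so the
difference E of two discrete solutions satisfies a(E,v) = 0 for every v in V. The imaginary part of
a(E,E) makes the trace of E vanish on Γ_R. Near a point of Γ_R the extension of E by zero is then a
distributional solution across the boundary, and it vanishes on the outer side; unique continuation
gives E = 0 (`eq_zero_of_form_eq_zero`). Unique continuation comes from analyticity: iterating
Caccioppoli's inequality bounds the k-th directional derivatives of mollified solutions by a
multiple of q^k (k+1)!, so their Taylor remainders tend to zero along rays of a length that does not
depend on the solution.

Two foundations support this. The trace inequality on Lipschitz domains makes V complete and its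
norm equivalent to a Hilbert norm. The hat functions belong to V because they are Lipschitz on the
whole closure of Ω, convex or not, by a compactness argument for pairs of polytopes
(`exists_abs_sub_le_of_eqOn_inter`). -/

namespace Helmholtz

/-! ### Lipschitz graphs -/

section Graph

variable {d : ℕ} {e : Pt d} {ψ : Pt d → ℝ} {K : ℝ≥0}

/-- The graph of `ψ` over the hyperplane orthogonal to `e`. -/
def graphSet (e : Pt d) (ψ : Pt d → ℝ) : Set (Pt d) := {x | ψ x = inner ℝ e x}

/-- The region strictly above the graph. -/
def epiSet (e : Pt d) (ψ : Pt d → ℝ) : Set (Pt d) := {x | ψ x < inner ℝ e x}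

/-- The parametrization of the graph over the hyperplane orthogonal to `e`. -/
def graphMap (e : Pt d) (ψ : Pt d → ℝ) (y : (ℝ ∙ e)ᗮ) : Pt d := (y : Pt d) + ψ y • e

theorem inner_orth {e : Pt d} (y : (ℝ ∙ e)ᗮ) : inner ℝ e (y : Pt d) = 0 :=
  Submodule.mem_orthogonal_singleton_iff_inner_right.1 y.2

theorem inner_unit_add_smul (he : ‖e‖ = 1) (x : Pt d) (t : ℝ) :
    inner ℝ e (x + t • e) = inner ℝ e x + t := by
  rw [inner_add_right, inner_smul_right, real_inner_self_eq_norm_sq, he]; ring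

theorem isClosed_graphSet (hψ : LipschitzWith K ψ) : IsClosed (graphSet e ψ) :=
  isClosed_eq hψ.continuous (by fun_prop)

theorem isOpen_epiSet (hψ : LipschitzWith K ψ) : IsOpen (epiSet e ψ) :=
  isOpen_lt hψ.continuous (by fun_prop)

theorem lipschitzWith_graphMap (he : ‖e‖ = 1) (hψ : LipschitzWith K ψ) :
    LipschitzWith (1 + K) (graphMap e ψ) := by
  refine LipschitzWith.add (LipschitzWith.subtype_val _) ?_
  have h2 : LipschitzWith K (fun y : (ℝ ∙ e)ᗮ => ψ y) := by
    have := hψ.comp (LipschitzWith.subtype_val ((ℝ ∙ e)ᗮ : Set (Pt d)))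
    rwa [mul_one] at this
  refine LipschitzWith.of_dist_le_mul fun x y => ?_
  rw [dist_eq_norm, ← sub_smul, norm_smul, he, mul_one, ← dist_eq_norm]
  exact h2.dist_le_mul x y

theorem graphMap_mem (he : ‖e‖ = 1) (hinv : ∀ (x : Pt d) (t : ℝ), ψ (x + t • e) = ψ x) (y : (ℝ ∙ e)ᗮ) :
    graphMap e ψ y ∈ graphSet e ψ := by
  simp only [graphSet, graphMap, Set.mem_ofPred_eq, hinv, inner_unit_add_smul he, inner_orth,
    zero_add]

theorem range_graphMap (he : ‖e‖ = 1) (hinv : ∀ (x : Pt d) (t : ℝ), ψ (x + t • e) = ψ x) :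
    Set.range (graphMap e ψ) = graphSet e ψ := by
  apply subset_antisymm
  · rintro _ ⟨y, rfl⟩
    exact graphMap_mem he hinv y
  · intro x hx
    have hx' : ψ x = inner ℝ e x := hx
    have hy : x + (-(inner ℝ e x : ℝ)) • e ∈ (ℝ ∙ e)ᗮ := by
      rw [Submodule.mem_orthogonal_singleton_iff_inner_right, inner_unit_add_smul he]; ring
    refine ⟨⟨_, hy⟩, ?_⟩
    simp only [graphMap, hinv, hx']
    rw [add_assoc, ← add_smul, neg_add_cancel, zero_smul, add_zero]

theorem finrank_orth (hd : 1 ≤ d) (he : ‖e‖ = 1) : Module.finrank ℝ (ℝ ∙ e)ᗮ = d - 1 := by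
  have h1 := (ℝ ∙ e).finrank_add_finrank_orthogonal
  rw [finrank_span_singleton (by rintro rfl; simp at he), finrank_euclideanSpace_fin] at h1
  omega

theorem volume_orth_eq (hd : 1 ≤ d) (he : ‖e‖ = 1) :
    (volume : Measure (ℝ ∙ e)ᗮ) = Measure.euclideanHausdorffMeasure (d - 1) := by
  rw [← finrank_orth hd he, InnerProductSpace.euclideanHausdorffMeasure_eq_volume]

theorem euclideanHausdorffMeasure_image_le {X Y : Type*} [EMetricSpace X] [MeasurableSpace X]
    [BorelSpace X] [EMetricSpace Y] [MeasurableSpace Y] [BorelSpace Y] {f : X → Y} {K : ℝ≥0}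
    (hf : LipschitzWith K f) (n : ℕ) (s : Set X) :
    Measure.euclideanHausdorffMeasure n (f '' s)
      ≤ (K : ℝ≥0∞) ^ n * Measure.euclideanHausdorffMeasure n s := by
  simp only [Measure.euclideanHausdorffMeasure_def, Measure.smul_apply, ENNReal.smul_def,
    smul_eq_mul]
  have := hf.hausdorffMeasure_image_le (d := (n : ℝ)) (by positivity) s
  rw [ENNReal.rpow_natCast] at this
  calc _ ≤ _ * ((K : ℝ≥0∞) ^ n * _) := mul_le_mul_right this _
    _ = _ := by ring

/-- The graph is the image of the hyperplane under a (1 + K)-Lipschitz map, which enlarges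
(d−1)-dimensional Hausdorff measure by at most (1 + K)^(d−1). Together with the reverse bound below
this two-sided comparison takes the place of an area formula. -/
theorem surface_le_map_graphMap (hd : 1 ≤ d) (he : ‖e‖ = 1) (hψ : LipschitzWith K ψ)
    (hinv : ∀ (x : Pt d) (t : ℝ), ψ (x + t • e) = ψ x) :
    (Measure.euclideanHausdorffMeasure (d - 1)).restrict (graphSet e ψ)
      ≤ ((1 + K : ℝ≥0) : ℝ≥0∞) ^ (d - 1) • Measure.map (graphMap e ψ) volume := by
  have hL := lipschitzWith_graphMap he hψ
  refine Measure.le_iff.2 fun s hs => ?_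
  rw [Measure.restrict_apply hs, Measure.smul_apply,
    Measure.map_apply hL.continuous.measurable hs, smul_eq_mul, volume_orth_eq hd he,
    ← range_graphMap he hinv, ← Set.image_preimage_eq_inter_range]
  exact euclideanHausdorffMeasure_image_le hL _ _

/-- Orthogonal projection onto the hyperplane is 1-Lipschitz and inverts `graphMap`, so measure
cannot shrink when it is lifted to the graph. -/
theorem map_graphMap_le_surface (hd : 1 ≤ d) (he : ‖e‖ = 1) (hψ : LipschitzWith K ψ)
    (hinv : ∀ (x : Pt d) (t : ℝ), ψ (x + t • e) = ψ x) :
    Measure.map (graphMap e ψ) volume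
      ≤ (Measure.euclideanHausdorffMeasure (d - 1)).restrict (graphSet e ψ) := by
  have hL := lipschitzWith_graphMap he hψ
  refine Measure.le_iff.2 fun s hs => ?_
  rw [Measure.restrict_apply hs, Measure.map_apply hL.continuous.measurable hs,
    volume_orth_eq hd he, ← range_graphMap he hinv, ← Set.image_preimage_eq_inter_range]
  set P : Pt d → (ℝ ∙ e)ᗮ := (ℝ ∙ e)ᗮ.orthogonalProjectionOnto
  have hP : LipschitzWith 1 P := by
    refine LipschitzWith.of_dist_le_mul fun x y => ?_
    rw [dist_eq_norm, dist_eq_norm, ← map_sub, NNReal.coe_one, one_mul]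
    exact Submodule.norm_orthogonalProjectionOnto_apply_le _ _
  have hPg : ∀ y, P (graphMap e ψ y) = y := by
    intro y
    have h1 : (ℝ ∙ e)ᗮ.orthogonalProjectionOnto e = 0 :=
      Submodule.orthogonalProjectionOnto_orthogonalComplement_singleton_eq_zero e
    simp only [P, graphMap, map_add, map_smul, h1, smul_zero, add_zero]
    exact Submodule.orthogonalProjectionOnto_mem_subspace_eq_self y
  have := euclideanHausdorffMeasure_image_le hP (d - 1) (graphMap e ψ '' (graphMap e ψ ⁻¹' s))
  rw [Set.image_image] at this
  simpa [hPg] using this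

theorem measurePreserving_orth (he : ‖e‖ = 1) :
    MeasurePreserving (fun p : ℝ × (ℝ ∙ e)ᗮ => (p.2 : Pt d) + p.1 • e) := by
  have h1 := ((ℝ ∙ e).measurePreserving_measurableEquivProd (0 : Pt d)).symm
  rw [InnerProductSpace.euclideanHausdorffMeasure_eq_volume] at h1
  have h2 : MeasurePreserving (LinearIsometryEquiv.toSpanUnitSingleton (𝕜 := ℝ) e he) :=
    LinearIsometryEquiv.measurePreserving _
  have h3 := h1.comp (h2.prod (MeasurePreserving.id (volume : Measure (ℝ ∙ e)ᗮ)))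
  convert! h3 using 1
  ext1 p
  simp [add_comm]

/-- Fubini's theorem along the lines in direction `e`, above a graph. -/
theorem lintegral_epiSet (he : ‖e‖ = 1) (hψ : LipschitzWith K ψ)
    (hinv : ∀ (x : Pt d) (t : ℝ), ψ (x + t • e) = ψ x) {F : Pt d → ℝ≥0∞} (hF : Measurable F) :
    ∫⁻ x in epiSet e ψ, F x = ∫⁻ y, ∫⁻ t in Set.Ioi (0 : ℝ), F (graphMap e ψ y + t • e) := by
  have hS : MeasurableSet (epiSet e ψ) := (isOpen_epiSet hψ).measurableSet
  rw [← lintegral_indicator hS, ← (measurePreserving_orth he).lintegral_comp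
    (hF.indicator hS), Measure.volume_eq_prod, lintegral_prod_symm]
  · refine lintegral_congr fun y => ?_
    -- On the line over y the graph has height `ψ y`; translation invariance moves this height to 0.
    rw [← lintegral_indicator measurableSet_Ioi,
      ← lintegral_sub_right_eq_self
        ((Set.Ioi (0 : ℝ)).indicator fun t => F (graphMap e ψ y + t • e)) (ψ y)]
    refine lintegral_congr fun t => ?_
    have h1 : graphMap e ψ y + (t - ψ y) • e = (y : Pt d) + t • e := by
      rw [graphMap, add_assoc, ← add_smul, add_sub_cancel]
    by_cases h : ψ y < t
    · rw [Set.indicator_of_mem, Set.indicator_of_mem, h1]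
      · simpa using h
      · simpa [epiSet, hinv, inner_unit_add_smul he, inner_orth] using h
    · rw [Set.indicator_of_notMem, Set.indicator_of_notMem]
      · simpa using h
      · simpa [epiSet, hinv, inner_unit_add_smul he, inner_orth] using h
  · exact ((hF.indicator hS).comp (measurePreserving_orth he).measurable).aemeasurable

theorem measurable_ray_lintegral {F : Pt d → ℝ≥0∞} (hF : Measurable F) (s : Set ℝ) :
    Measurable fun x : Pt d => ∫⁻ t in s, F (x + t • e) :=
  Measurable.lintegral_prod_right' (f := fun p : Pt d × ℝ => F (p.1 + p.2 • e))
    (hF.comp (by fun_prop))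

theorem lintegral_graphSet_le (hd : 1 ≤ d) (he : ‖e‖ = 1) (hψ : LipschitzWith K ψ)
    (hinv : ∀ (x : Pt d) (t : ℝ), ψ (x + t • e) = ψ x) {F : Pt d → ℝ≥0∞} (hF : Measurable F) :
    ∫⁻ x in graphSet e ψ, (∫⁻ t in Set.Ioi (0 : ℝ), F (x + t • e))
        ∂(Measure.euclideanHausdorffMeasure (d - 1))
      ≤ ((1 + K : ℝ≥0) : ℝ≥0∞) ^ (d - 1) * ∫⁻ x in epiSet e ψ, F x := by
  refine (lintegral_mono' (surface_le_map_graphMap hd he hψ hinv) le_rfl).trans ?_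
  rw [lintegral_smul_measure, lintegral_map (measurable_ray_lintegral hF _)
    (lipschitzWith_graphMap he hψ).continuous.measurable, lintegral_epiSet he hψ hinv hF,
    smul_eq_mul]

theorem lintegral_epiSet_le (hd : 1 ≤ d) (he : ‖e‖ = 1) (hψ : LipschitzWith K ψ)
    (hinv : ∀ (x : Pt d) (t : ℝ), ψ (x + t • e) = ψ x) {F : Pt d → ℝ≥0∞} (hF : Measurable F) :
    ∫⁻ x in epiSet e ψ, F x ≤ ∫⁻ x in graphSet e ψ, (∫⁻ t in Set.Ioi (0 : ℝ), F (x + t • e))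
        ∂(Measure.euclideanHausdorffMeasure (d - 1)) := by
  rw [lintegral_epiSet he hψ hinv hF, ← lintegral_map (measurable_ray_lintegral hF _)
    (lipschitzWith_graphMap he hψ).continuous.measurable]
  exact lintegral_mono' (map_graphMap_le_surface hd he hψ hinv) le_rfl

end Graph

/-! ### The trace inequality -/

section TraceInequality

variable {d : ℕ}

theorem sq_lintegral_le {α : Type*} [MeasurableSpace α] {μ : Measure α} {f : α → ℝ≥0∞}
    (hf : AEMeasurable f μ) : (∫⁻ x, f x ∂μ) ^ 2 ≤ μ Set.univ * ∫⁻ x, f x ^ 2 ∂μ := by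
  have h := ENNReal.lintegral_mul_le_Lp_mul_Lq μ Real.HolderConjugate.two_two hf
    (aemeasurable_const (b := (1 : ℝ≥0∞)))
  simp only [Pi.mul_apply, mul_one, ENNReal.one_rpow, lintegral_const, one_mul] at h
  calc (∫⁻ x, f x ∂μ) ^ 2 ≤ ((∫⁻ x, f x ^ (2 : ℝ) ∂μ) ^ ((1 : ℝ) / 2)
        * μ Set.univ ^ ((1 : ℝ) / 2)) ^ 2 := by gcongr
    _ = _ := by
      rw [mul_pow, ← ENNReal.rpow_natCast, ← ENNReal.rpow_natCast, ← ENNReal.rpow_mul,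
        ← ENNReal.rpow_mul]
      norm_num [mul_comm]

theorem enorm_add_sq_le {F : Type*} [SeminormedAddCommGroup F] (a b : F) :
    ‖a + b‖ₑ ^ 2 ≤ 2 * ‖a‖ₑ ^ 2 + 2 * ‖b‖ₑ ^ 2 := by
  have h1 : ‖a + b‖₊ ^ 2 ≤ 2 * ‖a‖₊ ^ 2 + 2 * ‖b‖₊ ^ 2 := by
    rw [← NNReal.coe_le_coe]
    push_cast
    nlinarith [norm_add_le a b, norm_nonneg (a + b), sq_nonneg (‖a‖ - ‖b‖), norm_nonneg a,
      norm_nonneg b]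
  simp only [enorm_eq_nnnorm]
  exact_mod_cast h1

/-- Fundamental theorem of calculus followed by Cauchy–Schwarz on an interval of length δ. -/
theorem enorm_sub_sq_le_lintegral_deriv {g g' : ℝ → ℂ} (hg : ∀ t, HasDerivAt g (g' t) t)
    (hg' : Continuous g') {δ t : ℝ} (ht : t ∈ Set.Icc 0 δ) :
    ‖g t - g 0‖ₑ ^ 2 ≤ ENNReal.ofReal δ * ∫⁻ s in Set.Ioo 0 δ, ‖g' s‖ₑ ^ 2 := by
  have h1 : g t - g 0 = ∫ s in Set.Ioc 0 t, g' s := by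
    rw [← intervalIntegral.integral_of_le ht.1]
    exact (intervalIntegral.integral_eq_sub_of_hasDerivAt (fun s _ => hg s)
      (hg'.intervalIntegrable _ _)).symm
  rw [h1]
  calc ‖∫ s in Set.Ioc 0 t, g' s‖ₑ ^ 2 ≤ (∫⁻ s in Set.Ioc 0 t, ‖g' s‖ₑ) ^ 2 := by
        gcongr; exact enorm_integral_le_lintegral_enorm _
    _ ≤ (∫⁻ s in Set.Ioc 0 δ, ‖g' s‖ₑ) ^ 2 := by
        gcongr; exact ht.2
    _ = (∫⁻ s in Set.Ioo 0 δ, ‖g' s‖ₑ) ^ 2 := by rw [restrict_Ioo_eq_restrict_Ioc]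
    _ ≤ _ := by
        refine (sq_lintegral_le hg'.enorm.aemeasurable).trans_eq ?_
        simp

/-- This is the trace inequality in one dimension: average |g(0)|² ≤ 2|g(t)|² + 2|g(t) − g(0)|² over
t in (0, δ) and bound the last term by the derivative. -/
theorem enorm_sq_zero_le {g g' : ℝ → ℂ} (hg : ∀ t, HasDerivAt g (g' t) t)
    (hg' : Continuous g') {δ : ℝ} (hδ : 0 < δ) :
    ‖g 0‖ₑ ^ 2 ≤ ENNReal.ofReal (2 / δ) * (∫⁻ s in Set.Ioo 0 δ, ‖g s‖ₑ ^ 2)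
      + ENNReal.ofReal (2 * δ) * ∫⁻ s in Set.Ioo 0 δ, ‖g' s‖ₑ ^ 2 := by
  have hc : Continuous g := continuous_iff_continuousAt.2 fun t => (hg t).continuousAt
  set I := ∫⁻ s in Set.Ioo 0 δ, ‖g' s‖ₑ ^ 2
  have h1 : ∀ t ∈ Set.Ioo 0 δ, ‖g 0‖ₑ ^ 2 ≤ 2 * ‖g t‖ₑ ^ 2 + 2 * (ENNReal.ofReal δ * I) := by
    intro t ht
    have h2 := enorm_add_sq_le (g t) (-(g t - g 0))
    rw [enorm_neg, show g t + -(g t - g 0) = g 0 by ring] at h2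
    refine h2.trans ?_
    gcongr
    exact enorm_sub_sq_le_lintegral_deriv hg hg' ⟨ht.1.le, ht.2.le⟩
  have h3 : ENNReal.ofReal δ * ‖g 0‖ₑ ^ 2
      ≤ 2 * (∫⁻ s in Set.Ioo 0 δ, ‖g s‖ₑ ^ 2) + 2 * (ENNReal.ofReal δ * I) * ENNReal.ofReal δ := by
    calc ENNReal.ofReal δ * ‖g 0‖ₑ ^ 2 = ∫⁻ t in Set.Ioo 0 δ, ‖g 0‖ₑ ^ 2 := by
          simp [mul_comm]
      _ ≤ ∫⁻ t in Set.Ioo 0 δ, (2 * ‖g t‖ₑ ^ 2 + 2 * (ENNReal.ofReal δ * I)) :=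
          setLIntegral_mono' measurableSet_Ioo h1
      _ = _ := by
          rw [lintegral_add_right _ measurable_const, lintegral_const_mul _
            (hc.enorm.measurable.pow_const 2)]
          simp
  have hδ' : ENNReal.ofReal δ ≠ 0 := by simpa using hδ
  have h4 : ENNReal.ofReal (1 / δ) * ENNReal.ofReal δ = 1 := by
    rw [← ENNReal.ofReal_mul (by positivity), one_div_mul_cancel hδ.ne', ENNReal.ofReal_one]
  calc ‖g 0‖ₑ ^ 2 = ENNReal.ofReal (1 / δ) * (ENNReal.ofReal δ * ‖g 0‖ₑ ^ 2) := by
        rw [← mul_assoc, h4, one_mul]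
    _ ≤ ENNReal.ofReal (1 / δ) * (2 * (∫⁻ s in Set.Ioo 0 δ, ‖g s‖ₑ ^ 2)
          + 2 * (ENNReal.ofReal δ * I) * ENNReal.ofReal δ) := by gcongr
    _ = 2 * ENNReal.ofReal (1 / δ) * (∫⁻ s in Set.Ioo 0 δ, ‖g s‖ₑ ^ 2)
          + 2 * (ENNReal.ofReal (1 / δ) * ENNReal.ofReal δ) * ENNReal.ofReal δ * I := by ring
    _ = _ := by
        rw [h4, mul_one]
        have h2 : (2 : ℝ≥0∞) = ENNReal.ofReal 2 := by simp
        rw [h2, ← ENNReal.ofReal_mul zero_le_two, ← ENNReal.ofReal_mul zero_le_two, mul_one_div]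

theorem fderiv_apply_eq_sum (φ : Pt d → ℂ) (x e : Pt d) :
    fderiv ℝ φ x e = ∑ j, (e j : ℂ) * pderiv φ j x := by
  conv_lhs => rw [← (EuclideanSpace.basisFun (Fin d) ℝ).sum_repr e]
  simp [pderiv, map_sum]

theorem norm_fderiv_apply_le (φ : Pt d → ℂ) (x e : Pt d) :
    ‖fderiv ℝ φ x e‖ ≤ ‖e‖ * ‖grad φ x‖ := by
  rw [fderiv_apply_eq_sum]
  have h1 : ‖∑ j, (e j : ℂ) * pderiv φ j x‖ ≤ ∑ j, ‖e j‖ * ‖pderiv φ j x‖ := by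
    refine (norm_sum_le _ _).trans (Finset.sum_le_sum fun j _ => ?_)
    rw [norm_mul, Complex.norm_real]
  refine h1.trans ((Real.sum_mul_le_sqrt_mul_sqrt _ _ _).trans_eq ?_)
  rw [EuclideanSpace.norm_eq, EuclideanSpace.norm_eq]
  rfl

theorem hasDerivAt_ray {φ : Pt d → ℂ} (hφ : ContDiff ℝ ∞ φ) (x e : Pt d) (t : ℝ) :
    HasDerivAt (fun t : ℝ => φ (x + t • e)) (fderiv ℝ φ (x + t • e) e) t := by
  have h1 : HasDerivAt (fun t : ℝ => x + t • e) e t := by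
    simpa using ((hasDerivAt_id t).smul_const e).const_add x
  exact (hφ.differentiable (by simp) _).hasFDerivAt.comp_hasDerivAt t h1

theorem continuous_fderiv_ray {φ : Pt d → ℂ} (hφ : ContDiff ℝ ∞ φ) (x e : Pt d) :
    Continuous fun t : ℝ => fderiv ℝ φ (x + t • e) e :=
  ((hφ.continuous_fderiv (by simp)).comp (by fun_prop)).clm_apply continuous_const

theorem enorm_fderiv_apply_le {e : Pt d} (he : ‖e‖ = 1) (φ : Pt d → ℂ) (x : Pt d) :
    ‖fderiv ℝ φ x e‖ₑ ≤ ‖grad φ x‖ₑ := by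
  have := norm_fderiv_apply_le φ x e
  rw [he, one_mul] at this
  exact enorm_le_iff_norm_le.2 this

/-- A boundary point cannot lie above the graph, since it would belong to the open set Ω, and it
cannot lie below, since a whole neighbourhood would then miss Ω. -/
theorem frontier_inter_ball_subset_graphSet {Ω : Set (Pt d)} (hΩ : IsOpen Ω) {e x₀ : Pt d}
    {ψ : Pt d → ℝ} {K : ℝ≥0} {r : ℝ} (hψ : LipschitzWith K ψ)
    (h : ∀ x ∈ Metric.ball x₀ r, x ∈ Ω ↔ ψ x < inner ℝ e x) :
    frontier Ω ∩ Metric.ball x₀ r ⊆ graphSet e ψ := by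
  rintro x ⟨hx, hxb⟩
  rw [hΩ.frontier_eq] at hx
  have h1 : ¬ ψ x < inner ℝ e x := fun h' => hx.2 ((h x hxb).2 h')
  by_contra h2
  have h3 : inner ℝ e x < ψ x := lt_of_le_of_ne (not_lt.1 h1) (Ne.symm h2)
  have h4 : IsOpen {y | inner ℝ e y < ψ y} := isOpen_lt (by fun_prop) hψ.continuous
  obtain ⟨y, hy, hyΩ⟩ := mem_closure_iff.1 hx.1 _ (h4.inter Metric.isOpen_ball) ⟨h3, hxb⟩
  exact absurd ((h y hy.2).1 hyΩ) (not_lt.2 (le_of_lt hy.1))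

/-- The local trace inequality in a neighbourhood where the boundary is a Lipschitz graph. -/
theorem trace_inequality_local (hd : 1 ≤ d) {Ω : Set (Pt d)} (hΩ : IsOpen Ω) {e x₀ : Pt d}
    {ψ : Pt d → ℝ} {K : ℝ≥0} {r : ℝ} (he : ‖e‖ = 1) (hr : 0 < r) (hψ : LipschitzWith K ψ)
    (hinv : ∀ (x : Pt d) (t : ℝ), ψ (x + t • e) = ψ x)
    (h : ∀ x ∈ Metric.ball x₀ r, x ∈ Ω ↔ ψ x < inner ℝ e x) :
    ∃ C : ℝ≥0∞, C ≠ ⊤ ∧ ∀ φ : Pt d → ℂ, ContDiff ℝ ∞ φ →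
      ∫⁻ x in Metric.ball x₀ (r / 2), ‖φ x‖ₑ ^ 2 ∂(surf Ω)
        ≤ C * (∫⁻ x in Ω, ‖φ x‖ₑ ^ 2 + ‖grad φ x‖ₑ ^ 2) := by
  -- A point of the half-size ball moved by less than δ along e stays in the ball of radius r, where
  -- Ω is the region above the graph.
  set δ := r / 2
  have hδ : 0 < δ := by positivity
  set a := ENNReal.ofReal (2 / δ)
  set b := ENNReal.ofReal (2 * δ)
  set c := ((1 + K : ℝ≥0) : ℝ≥0∞) ^ (d - 1)
  refine ⟨c * (a + b), ENNReal.mul_ne_top (by finiteness) (by finiteness), fun φ hφ => ?_⟩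
  set F : Pt d → ℝ≥0∞ := fun x => a * ‖φ x‖ₑ ^ 2 + b * ‖grad φ x‖ₑ ^ 2
  have hFm : Measurable F := by
    have := hφ.continuous.enorm.measurable
    have := (continuous_grad hφ).enorm.measurable
    fun_prop
  have key : ∀ x ∈ frontier Ω ∩ Metric.ball x₀ δ,
      ‖φ x‖ₑ ^ 2 ≤ ∫⁻ t in Set.Ioi (0 : ℝ), Ω.indicator F (x + t • e) := by
    rintro x ⟨hx, hxb⟩
    have hxg : ψ x = inner ℝ e x := frontier_inter_ball_subset_graphSet hΩ hψ h
      ⟨hx, Metric.ball_subset_ball (by simp only [δ]; linarith) hxb⟩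
    have hm1 : Measurable fun t : ℝ => ‖φ (x + t • e)‖ₑ ^ 2 :=
      ((hφ.continuous.comp (by fun_prop)).enorm.measurable).pow_const 2
    have h0 := enorm_sq_zero_le (hasDerivAt_ray hφ x e) (continuous_fderiv_ray hφ x e) hδ
    simp only [zero_smul, add_zero] at h0
    calc ‖φ x‖ₑ ^ 2 ≤ _ := h0
      _ ≤ a * (∫⁻ t in Set.Ioo 0 δ, ‖φ (x + t • e)‖ₑ ^ 2)
          + b * ∫⁻ t in Set.Ioo 0 δ, ‖grad φ (x + t • e)‖ₑ ^ 2 := by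
          gcongr with t
          exact enorm_fderiv_apply_le he _ _
      _ = ∫⁻ t in Set.Ioo 0 δ, F (x + t • e) := by
          rw [← lintegral_const_mul' _ _ (by finiteness), ← lintegral_const_mul' _ _ (by finiteness),
            ← lintegral_add_left (hm1.const_mul a)]
      _ = ∫⁻ t in Set.Ioo 0 δ, Ω.indicator F (x + t • e) := by
          refine setLIntegral_congr_fun measurableSet_Ioo fun t ht => ?_
          rw [Set.indicator_of_mem]
          refine (h _ ?_).2 ?_
          · rw [Metric.mem_ball] at hxb ⊢
            calc dist (x + t • e) x₀ ≤ dist (x + t • e) x + dist x x₀ := dist_triangle _ _ _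
              _ < δ + δ := by
                refine add_lt_add ?_ hxb
                simp only [dist_self_add_left, norm_smul, he, mul_one, Real.norm_eq_abs,
                  abs_of_pos ht.1, ht.2]
              _ = r := by simp only [δ]; ring
          · rw [hinv, inner_unit_add_smul he, hxg]
            linarith [ht.1]
      _ ≤ _ := lintegral_mono_set Set.Ioo_subset_Ioi_self
  have hmΩ := hFm.indicator hΩ.measurableSet
  calc ∫⁻ x in Metric.ball x₀ δ, ‖φ x‖ₑ ^ 2 ∂(surf Ω)
      = ∫⁻ x in frontier Ω ∩ Metric.ball x₀ δ, ‖φ x‖ₑ ^ 2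
          ∂(Measure.euclideanHausdorffMeasure (d - 1)) := by
        rw [Measure.restrict_restrict Metric.isOpen_ball.measurableSet, Set.inter_comm]
    _ ≤ ∫⁻ x in frontier Ω ∩ Metric.ball x₀ δ,
          (∫⁻ t in Set.Ioi (0 : ℝ), Ω.indicator F (x + t • e))
          ∂(Measure.euclideanHausdorffMeasure (d - 1)) :=
        setLIntegral_mono' (isClosed_frontier.measurableSet.inter
          Metric.isOpen_ball.measurableSet) key
    _ ≤ ∫⁻ x in graphSet e ψ, (∫⁻ t in Set.Ioi (0 : ℝ), Ω.indicator F (x + t • e))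
          ∂(Measure.euclideanHausdorffMeasure (d - 1)) := by
        refine lintegral_mono_set (Set.Subset.trans ?_
          (frontier_inter_ball_subset_graphSet hΩ hψ h))
        exact Set.inter_subset_inter_right _ (Metric.ball_subset_ball (by simp only [δ]; linarith))
    _ ≤ c * ∫⁻ x in epiSet e ψ, Ω.indicator F x := lintegral_graphSet_le hd he hψ hinv hmΩ
    _ ≤ c * ∫⁻ x, Ω.indicator F x := by gcongr; exact Measure.restrict_le_self
    _ = c * ∫⁻ x in Ω, F x := by rw [lintegral_indicator hΩ.measurableSet]
    _ ≤ c * ∫⁻ x in Ω, (a + b) * (‖φ x‖ₑ ^ 2 + ‖grad φ x‖ₑ ^ 2) := by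
        gcongr with x
        simp only [F, mul_add, add_mul]
        exact add_le_add (le_self_add) (le_add_self)
    _ = _ := by rw [lintegral_const_mul' _ _ (by finiteness), mul_assoc]

/-- The trace inequality on a bounded Lipschitz domain. -/
theorem trace_inequality (hd : 1 ≤ d) {Ω : Set (Pt d)} (hΩ : IsLipschitzDomain Ω) :
    ∃ C : ℝ≥0∞, C ≠ ⊤ ∧ ∀ φ : Pt d → ℂ, ContDiff ℝ ∞ φ →
      ∫⁻ x, ‖φ x‖ₑ ^ 2 ∂(surf Ω) ≤ C * (∫⁻ x in Ω, ‖φ x‖ₑ ^ 2 + ‖grad φ x‖ₑ ^ 2) := by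
  have hK : IsCompact (frontier Ω) := Metric.isCompact_of_isClosed_isBounded isClosed_frontier
    (hΩ.isBounded.closure.subset frontier_subset_closure)
  -- Having a trace inequality on s passes to subsets and finite unions, so by compactness the local
  -- inequalities suffice.
  have h := hK.induction_on (p := fun s => ∃ C : ℝ≥0∞, C ≠ ⊤ ∧ ∀ φ : Pt d → ℂ, ContDiff ℝ ∞ φ →
      ∫⁻ x in s, ‖φ x‖ₑ ^ 2 ∂(surf Ω) ≤ C * (∫⁻ x in Ω, ‖φ x‖ₑ ^ 2 + ‖grad φ x‖ₑ ^ 2))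
    ⟨0, by simp, by simp⟩
    (fun s t hst ⟨C, hC, h⟩ => ⟨C, hC, fun φ hφ => (lintegral_mono_set hst).trans (h φ hφ)⟩)
    (fun s t ⟨C, hC, h⟩ ⟨C', hC', h'⟩ => ⟨C + C', by finiteness, fun φ hφ =>
      (lintegral_union_le _ _ _).trans (by rw [add_mul]; exact add_le_add (h φ hφ) (h' φ hφ))⟩)
    (fun x hx => by
      obtain ⟨e, ψ, K, r, he, hr, hψ, hinv, hloc⟩ := hΩ.locally_graph x hx
      exact ⟨_, mem_nhdsWithin_of_mem_nhds (Metric.ball_mem_nhds x (half_pos hr)),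
        trace_inequality_local hd hΩ.isOpen he hr hψ hinv hloc⟩)
  obtain ⟨C, hC, h⟩ := h
  refine ⟨C, hC, fun φ hφ => ?_⟩
  have := h φ hφ
  rwa [Measure.restrict_restrict isClosed_frontier.measurableSet, Set.inter_self] at this

end TraceInequality

/-! ### The Lax-Milgram theorem for sesquilinear forms -/

section LaxMilgram

/-- The Lax-Milgram theorem for a sesquilinear form on a complex Hilbert space. -/
theorem exists_forall_eq_of_coercive_hilbert {X : Type*} [NormedAddCommGroup X]
    [InnerProductSpace ℂ X] [CompleteSpace X] (a : X →ₗ[ℂ] X →ₗ⋆[ℂ] ℂ) {m c m' : ℝ}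
    (hb : ∀ u v, ‖a u v‖ ≤ m * ‖u‖ * ‖v‖) (hc : 0 < c)
    (hco : ∀ u, c * ‖u‖ ^ 2 ≤ (a u u).re) (l : X →ₗ⋆[ℂ] ℂ) (hl : ∀ v, ‖l v‖ ≤ m' * ‖v‖) :
    ∃ u, ∀ v, a u v = l v := by
  -- Over the real numbers, Re a is a coercive bilinear form on X, and the real Lax–Milgram theorem
  -- solves Re a(x, v) = Re l(v).
  let : InnerProductSpace ℝ X := InnerProductSpace.complexToReal
  let B₀ : X →ₗ[ℝ] X →ₗ[ℝ] ℝ := LinearMap.mk₂ ℝ (fun x y => (a x y).re)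
    (fun x y z => by simp) (fun r x y => by rw [← Complex.coe_smul, map_smul]; simp)
    (fun x y z => by simp) (fun r x y => by rw [← Complex.coe_smul, map_smulₛₗ]; simp)
  let B : X →L[ℝ] X →L[ℝ] ℝ := B₀.mkContinuous₂ m fun x y =>
    (Complex.abs_re_le_norm _).trans (hb x y)
  have hB : ∀ x y, B x y = (a x y).re := fun x y => rfl
  have hcoer : IsCoercive B := ⟨c, hc, fun x => by rw [hB]; linarith [hco x]⟩
  let l₀ : X →ₗ[ℝ] ℝ :=
    { toFun := fun x => (l x).re
      map_add' := fun x y => by simp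
      map_smul' := fun r x => by rw [← Complex.coe_smul, map_smulₛₗ]; simp }
  let l₁ : X →L[ℝ] ℝ := l₀.mkContinuous m' fun x => (Complex.abs_re_le_norm _).trans (hl x)
  let x : X := hcoer.continuousLinearEquivOfBilin.symm ((InnerProductSpace.toDual ℝ X).symm l₁)
  have hx : ∀ v : X, (a x v).re = (l v).re := by
    intro v
    have h1 := hcoer.continuousLinearEquivOfBilin_apply x v
    rw [ContinuousLinearEquiv.apply_symm_apply, InnerProductSpace.toDual_symm_apply, hB] at h1
    exact h1.symm
  refine ⟨x, fun v => Complex.ext (hx v) ?_⟩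
  -- Both sides are antilinear in v, so replacing v by i v turns real parts into imaginary parts.
  have h2 := hx (Complex.I • v)
  simpa [map_smulₛₗ] using h2

theorem isClosed_range_of_bounds {W X : Type*} [NormedAddCommGroup W] [NormedSpace ℂ W]
    [CompleteSpace W] [NormedAddCommGroup X] [NormedSpace ℂ X] (T : W →ₗ[ℂ] X) {a C : ℝ}
    (ha : ∀ w, ‖T w‖ ≤ a * ‖w‖) (hC : 0 ≤ C) (h : ∀ w, ‖w‖ ≤ C * ‖T w‖) :
    IsClosed (LinearMap.range T : Set X) := by
  have hT : AntilipschitzWith ⟨C, hC⟩ (T.mkContinuous a ha) :=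
    AddMonoidHomClass.antilipschitz_of_bound _ h
  exact hT.isClosed_range (T.mkContinuous a ha).uniformContinuous

/-- The Lax-Milgram theorem for a sesquilinear form on a Banach space with a norm that is
equivalent to the norm pulled back from a Hilbert space. -/
theorem exists_forall_eq_of_coercive {W X : Type*} [NormedAddCommGroup W] [NormedSpace ℂ W]
    [CompleteSpace W] [NormedAddCommGroup X] [InnerProductSpace ℂ X] [CompleteSpace X]
    (J : W →ₗ[ℂ] X) {k C : ℝ} (hk : ∀ w, ‖J w‖ ≤ k * ‖w‖) (hC : 0 ≤ C)
    (hJ : ∀ w, ‖w‖ ≤ C * ‖J w‖) (a : W →ₗ[ℂ] W →ₗ⋆[ℂ] ℂ) {m c m' : ℝ}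
    (hb : ∀ u v, ‖a u v‖ ≤ m * ‖J u‖ * ‖J v‖) (hc : 0 < c)
    (hco : ∀ u, c * ‖J u‖ ^ 2 ≤ (a u u).re) (l : W →ₗ⋆[ℂ] ℂ) (hl : ∀ v, ‖l v‖ ≤ m' * ‖J v‖) :
    ∃ u, ∀ v, a u v = l v := by
  -- J is bounded below, so its range is closed and hence a Hilbert space; the problem is
  -- transported there along W ≃ range J.
  have hcl := isClosed_range_of_bounds J hk hC hJ
  have hinj : Function.Injective J := by
    refine (injective_iff_map_eq_zero _).2 fun w hw => ?_
    have := hJ w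
    rw [hw, norm_zero, mul_zero] at this
    exact norm_le_zero_iff.1 this
  have : CompleteSpace (LinearMap.range J) := hcl.completeSpace_coe
  let E : W ≃ₗ[ℂ] LinearMap.range J := LinearEquiv.ofInjective J hinj
  have hE : ∀ x, ‖J (E.symm x)‖ = ‖x‖ := by
    intro x
    have h1 : ((E (E.symm x) : LinearMap.range J) : X) = J (E.symm x) :=
      LinearEquiv.ofInjective_apply J _
    rw [← h1, E.apply_symm_apply, Submodule.coe_norm]
  obtain ⟨x, hx⟩ := exists_forall_eq_of_coercive_hilbert (m := m) (m' := m')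
    ((a.comp (E.symm : LinearMap.range J →ₗ[ℂ] W)).compl₂ (E.symm : LinearMap.range J →ₗ[ℂ] W))
    (fun u v => by simpa [hE] using hb (E.symm u) (E.symm v)) hc
    (fun u => by simpa [hE] using hco (E.symm u))
    (l.comp (E.symm : LinearMap.range J →ₗ[ℂ] W))
    (fun v => by simpa [hE] using hl (E.symm v))
  exact ⟨E.symm x, fun v => by simpa using hx (E v)⟩

end LaxMilgram

/-! ### The space `V` -/

section SpaceV

variable {d : ℕ} {Ω ΓD : Set (Pt d)}

theorem lintegral_enorm_mul_le {α : Type*} [MeasurableSpace α] {μ : Measure α} {f g : α → ℂ}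
    (hf : AEStronglyMeasurable f μ) (hg : AEStronglyMeasurable g μ) :
    ∫⁻ x, ‖f x * g x‖ₑ ∂μ ≤ eLpNorm f 2 μ * eLpNorm g 2 μ := by
  rw [← eLpNorm_one_eq_lintegral_enorm]
  exact eLpNorm_smul_le_mul_eLpNorm (p := 2) (q := 2) (r := 1) (E := ℂ) (𝕜 := ℂ) hg hf

theorem enorm_integral_mul_le {α : Type*} [MeasurableSpace α] {μ : Measure α} {f g : α → ℂ}
    (hf : AEStronglyMeasurable f μ) (hg : AEStronglyMeasurable g μ) :
    ‖∫ x, f x * g x ∂μ‖ₑ ≤ eLpNorm f 2 μ * eLpNorm g 2 μ :=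
  (enorm_integral_le_lintegral_enorm _).trans (lintegral_enorm_mul_le hf hg)

theorem tendsto_integral_mul {α : Type*} [MeasurableSpace α] {μ : Measure α} {f : α → ℂ}
    {φ : ℕ → α → ℂ} {g : α → ℂ} (hf : MemLp f 2 μ) (hφ : ∀ n, MemLp (φ n) 2 μ)
    (hg : MemLp g 2 μ)
    (h : Tendsto (fun n => eLpNorm (fun x => φ n x - f x) 2 μ) atTop (𝓝 0)) :
    Tendsto (fun n => ∫ x, φ n x * g x ∂μ) atTop (𝓝 (∫ x, f x * g x ∂μ)) := by
  rw [tendsto_iff_edist_tendsto_0]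
  have h0 : Tendsto (fun n => eLpNorm (fun x => φ n x - f x) 2 μ * eLpNorm g 2 μ) atTop (𝓝 0) := by
    have := ENNReal.Tendsto.mul_const (b := eLpNorm g 2 μ) h (Or.inr hg.eLpNorm_ne_top)
    rwa [zero_mul] at this
  refine tendsto_of_tendsto_of_tendsto_of_le_of_le tendsto_const_nhds h0 (fun _ => zero_le)
    fun n => ?_
  simp only
  have i1 : Integrable (fun x => φ n x * g x) μ := (hφ n).integrable_mul hg
  have i2 : Integrable (fun x => f x * g x) μ := hf.integrable_mul hg
  rw [edist_eq_enorm_sub, ← integral_sub i1 i2]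
  simp only [← sub_mul]
  exact enorm_integral_mul_le ((hφ n).aestronglyMeasurable.sub hf.aestronglyMeasurable)
    hg.aestronglyMeasurable

theorem eLpNorm_coord_le {G : Pt d → EuclideanSpace ℂ (Fin d)} (j : Fin d) (μ : Measure (Pt d)) :
    eLpNorm (fun x => G x j) 2 μ ≤ eLpNorm G 2 μ :=
  eLpNorm_mono fun x => PiLp.norm_apply_le (G x) j

theorem memLp_coord {G : Pt d → EuclideanSpace ℂ (Fin d)} {μ : Measure (Pt d)}
    (hG : MemLp G 2 μ) (j : Fin d) : MemLp (fun x => G x j) 2 μ :=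
  (EuclideanSpace.proj (𝕜 := ℂ) j : EuclideanSpace ℂ (Fin d) →L[ℂ] ℂ).comp_memLp' hG

/-- Integration by parts for smooth functions. -/
theorem integral_mul_pderiv {φ ψ : Pt d → ℂ} (hφ : ContDiff ℝ ∞ φ) (hψ : ContDiff ℝ ∞ ψ)
    (hc : HasCompactSupport ψ) (j : Fin d) :
    ∫ x, φ x * pderiv ψ j x = -∫ x, pderiv φ j x * ψ x := by
  have h1 : ∀ {f g : Pt d → ℂ}, Continuous f → Continuous g → HasCompactSupport g →
      Integrable (fun x => f x * g x) := fun hf hg h =>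
    (hf.mul hg).integrable_of_hasCompactSupport h.mul_left
  exact integral_mul_fderiv_eq_neg_fderiv_mul_of_integrable
    (h1 (contDiff_pderiv hφ j) hψ.continuous hc)
    (h1 hφ.continuous (contDiff_pderiv hψ j) (hasCompactSupport_pderiv hc j))
    (h1 hφ.continuous hψ.continuous hc)
    (fun x _ => hφ.differentiable (by simp) x) (fun x _ => hψ.differentiable (by simp) x)

theorem tsupport_pderiv_subset (φ : Pt d → ℂ) (j : Fin d) :
    tsupport (pderiv φ j) ⊆ tsupport φ := by
  refine closure_minimal (fun x hx => ?_) isClosed_closure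
  refine tsupport_fderiv_subset ℝ (subset_tsupport _ ?_)
  intro h
  exact hx (by simp [pderiv, h])

theorem setIntegral_eq_of_tsupport_subset {f g : Pt d → ℂ} (hg : tsupport g ⊆ Ω) :
    ∫ x in Ω, f x * g x = ∫ x, f x * g x :=
  setIntegral_eq_integral_of_forall_compl_eq_zero fun x hx => by
    rw [image_eq_zero_of_notMem_tsupport (fun h => hx (hg h)), mul_zero]

theorem memLp_of_contDiff {F : Type*} [NormedAddCommGroup F] {φ : Pt d → F} (hφ : Continuous φ)
    (hc : HasCompactSupport φ) : MemLp φ 2 (vol Ω) :=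
  (hφ.memLp_of_hasCompactSupport hc (μ := volume)).restrict Ω

theorem hasCompactSupport_grad {φ : Pt d → ℂ} (hφ : HasCompactSupport φ) :
    HasCompactSupport (grad φ) :=
  (hφ.fderiv (𝕜 := ℝ)).comp_left (g := fun L : Pt d →L[ℝ] ℂ =>
    (WithLp.toLp 2 fun j => L (EuclideanSpace.single j (1 : ℝ)) : EuclideanSpace ℂ (Fin d)))
    (by ext; simp)

/-- Integration by parts holds for the smooth approximants and passes to the L² limit. Hence
closedness of V needs to be checked for the trace relation only. -/
theorem IsTrace.isWeakGradient {u : L2 Ω} {G : L2vec Ω} {g : L2bdry Ω} (h : IsTrace Ω u G g) :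
    IsWeakGradient Ω u G := by
  obtain ⟨φ, h0, h1, h2, -⟩ := h
  intro ψ hψ hc hs j
  have a1 : Tendsto (fun n => ∫ x in Ω, φ n x * pderiv ψ j x) atTop
      (𝓝 (∫ x in Ω, u x * pderiv ψ j x)) :=
    tendsto_integral_mul (Lp.memLp u) (fun n => memLp_of_contDiff (h0 n).1.continuous (h0 n).2)
      (memLp_of_contDiff (contDiff_pderiv hψ j) (hasCompactSupport_pderiv hc j)) h1
  have a2 : Tendsto (fun n => ∫ x in Ω, pderiv (φ n) j x * ψ x) atTop
      (𝓝 (∫ x in Ω, G x j * ψ x)) := by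
    refine tendsto_integral_mul (memLp_coord (Lp.memLp G) j)
      (fun n => memLp_of_contDiff (contDiff_pderiv (h0 n).1 j)
        (hasCompactSupport_pderiv (h0 n).2 j))
      (memLp_of_contDiff hψ.continuous hc) ?_
    exact tendsto_of_tendsto_of_tendsto_of_le_of_le tendsto_const_nhds h2 (fun _ => zero_le)
      fun n => eLpNorm_coord_le (G := fun x => grad (φ n) x - G x) j _
  refine tendsto_nhds_unique a1 (a2.neg.congr fun n => ?_)
  rw [setIntegral_eq_of_tsupport_subset hs, setIntegral_eq_of_tsupport_subset
    ((tsupport_pderiv_subset ψ j).trans hs), integral_mul_pderiv (h0 n).1 hψ hc j]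

theorem eLpNorm_two_sq {α F : Type*} [MeasurableSpace α] [NormedAddCommGroup F] (μ : Measure α)
    (f : α → F) : eLpNorm f 2 μ ^ 2 = ∫⁻ x, ‖f x‖ₑ ^ 2 ∂μ := by
  rw [eLpNorm_eq_lintegral_rpow_enorm_toReal (by simp) (by simp), ← ENNReal.rpow_natCast,
    ← ENNReal.rpow_mul]
  norm_num

/-- The trace of a Sobolev function is bounded by the function and its gradient. -/
theorem exists_trace_bound (hd : 1 ≤ d) (hΩ : IsLipschitzDomain Ω) :
    ∃ C : ℝ≥0∞, C ≠ ⊤ ∧ ∀ (u : L2 Ω) (G : L2vec Ω) (g : L2bdry Ω), IsTrace Ω u G g →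
      eLpNorm g 2 (surf Ω) ≤ C * (eLpNorm u 2 (vol Ω) + eLpNorm G 2 (vol Ω)) := by
  obtain ⟨C, hC, h⟩ := trace_inequality hd hΩ
  refine ⟨C ^ ((1 : ℝ) / 2), by finiteness, fun u G g ⟨φ, h0, h1, h2, h3⟩ => ?_⟩
  set D := C ^ ((1 : ℝ) / 2)
  have hD : D ≠ ⊤ := by finiteness
  have hDC : D ^ 2 = C := by
    rw [← ENNReal.rpow_natCast, ← ENNReal.rpow_mul]; norm_num
  have hsm : ∀ n, eLpNorm (φ n) 2 (surf Ω)
      ≤ D * (eLpNorm (φ n) 2 (vol Ω) + eLpNorm (grad (φ n)) 2 (vol Ω)) := by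
    intro n
    have hm := (h0 n).1.continuous.enorm.measurable
    rw [← ENNReal.pow_le_pow_left_iff (n := 2) two_ne_zero, mul_pow, hDC, eLpNorm_two_sq]
    refine (h _ (h0 n).1).trans ?_
    gcongr
    rw [lintegral_add_left (hm.pow_const 2), ← eLpNorm_two_sq, ← eLpNorm_two_sq, add_sq]
    gcongr
    exact le_self_add
  have hle : ∀ n, eLpNorm g 2 (surf Ω) ≤ eLpNorm (fun x => φ n x - g x) 2 (surf Ω)
      + D * ((eLpNorm (fun x => φ n x - u x) 2 (vol Ω) + eLpNorm u 2 (vol Ω))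
        + (eLpNorm (fun x => grad (φ n) x - G x) 2 (vol Ω) + eLpNorm G 2 (vol Ω))) := by
    intro n
    have m0 := (h0 n).1.continuous
    have m1 := continuous_grad (h0 n).1
    have e1 : eLpNorm g 2 (surf Ω)
        ≤ eLpNorm (fun x => φ n x - g x) 2 (surf Ω) + eLpNorm (φ n) 2 (surf Ω) := by
      have := eLpNorm_sub_le (p := 2) (μ := surf Ω) m0.aestronglyMeasurable
        (m0.aestronglyMeasurable.sub (Lp.aestronglyMeasurable g)) (by norm_num)
      rw [sub_sub_cancel, add_comm] at this
      exact this
    have e2 : eLpNorm (φ n) 2 (vol Ω)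
        ≤ eLpNorm (fun x => φ n x - u x) 2 (vol Ω) + eLpNorm u 2 (vol Ω) := by
      have := eLpNorm_add_le (p := 2) (μ := vol Ω)
        (m0.aestronglyMeasurable.sub (Lp.aestronglyMeasurable u))
        (Lp.aestronglyMeasurable u) (by norm_num)
      rwa [sub_add_cancel] at this
    have e3 : eLpNorm (grad (φ n)) 2 (vol Ω)
        ≤ eLpNorm (fun x => grad (φ n) x - G x) 2 (vol Ω) + eLpNorm G 2 (vol Ω) := by
      have := eLpNorm_add_le (p := 2) (μ := vol Ω)
        (m1.aestronglyMeasurable.sub (Lp.aestronglyMeasurable G))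
        (Lp.aestronglyMeasurable G) (by norm_num)
      rwa [sub_add_cancel] at this
    refine e1.trans ?_
    gcongr
    refine (hsm n).trans ?_
    gcongr
  refine ge_of_tendsto' (f := fun n => eLpNorm (fun x => φ n x - g x) 2 (surf Ω)
      + D * ((eLpNorm (fun x => φ n x - u x) 2 (vol Ω) + eLpNorm u 2 (vol Ω))
        + (eLpNorm (fun x => grad (φ n) x - G x) 2 (vol Ω) + eLpNorm G 2 (vol Ω))))
    (x := atTop) ?_ hle
  have := h3.add (ENNReal.Tendsto.const_mul (a := D)
    ((h1.add_const (eLpNorm u 2 (vol Ω))).add (h2.add_const (eLpNorm G 2 (vol Ω)))) (Or.inr hD))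
  simpa using this

theorem eLpNorm_sub_le_add_edist {F : Type*} [NormedAddCommGroup F] {μ : Measure (Pt d)}
    {φ : Pt d → F} (hφ : AEStronglyMeasurable φ μ) (f g : Lp F 2 μ) :
    eLpNorm (fun x => φ x - g x) 2 μ ≤ eLpNorm (fun x => φ x - f x) 2 μ + edist f g := by
  have := eLpNorm_add_le (p := 2) (μ := μ) (hφ.sub (Lp.aestronglyMeasurable f))
    ((Lp.aestronglyMeasurable f).sub (Lp.aestronglyMeasurable g)) (by norm_num)
  rw [sub_add_sub_cancel] at this
  rw [Lp.edist_def]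
  exact this

/-- Diagonal choice: take one smooth function within 1/(n+1) of the n-th triple in all three norms.
-/
theorem isTrace_of_tendsto {v : ℕ → L2 Ω × L2vec Ω × L2bdry Ω} {w : L2 Ω × L2vec Ω × L2bdry Ω}
    (hv : ∀ n, IsTrace Ω (v n).1 (v n).2.1 (v n).2.2) (h : Tendsto v atTop (𝓝 w)) :
    IsTrace Ω w.1 w.2.1 w.2.2 := by
  have hε : ∀ n : ℕ, (0 : ℝ≥0∞) < ((n : ℝ≥0∞) + 1)⁻¹ := fun n => by
    rw [ENNReal.inv_pos]; finiteness
  have hε0 : Tendsto (fun n : ℕ => ((n : ℝ≥0∞) + 1)⁻¹) atTop (𝓝 0) := by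
    have := (tendsto_add_atTop_iff_nat 1).2 ENNReal.tendsto_inv_nat_nhds_zero
    simpa using this
  have key : ∀ n, ∃ φ : Pt d → ℂ, (ContDiff ℝ ∞ φ ∧ HasCompactSupport φ) ∧
      eLpNorm (fun x => φ x - (v n).1 x) 2 (vol Ω) ≤ ((n : ℝ≥0∞) + 1)⁻¹ ∧
      eLpNorm (fun x => grad φ x - (v n).2.1 x) 2 (vol Ω) ≤ ((n : ℝ≥0∞) + 1)⁻¹ ∧
      eLpNorm (fun x => φ x - (v n).2.2 x) 2 (surf Ω) ≤ ((n : ℝ≥0∞) + 1)⁻¹ := by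
    intro n
    obtain ⟨φ, h0, h1, h2, h3⟩ := hv n
    obtain ⟨k, a1, a2, a3⟩ := ((h1.eventually (gt_mem_nhds (hε n))).and
      ((h2.eventually (gt_mem_nhds (hε n))).and (h3.eventually (gt_mem_nhds (hε n))))).exists
    exact ⟨φ k, h0 k, a1.le, a2.le, a3.le⟩
  choose φ k0 k1 k2 k3 using key
  have t1 : Tendsto (fun n => edist (v n).1 w.1) atTop (𝓝 0) :=
    tendsto_iff_edist_tendsto_0.1 (((continuous_fst.tendsto w).comp h))
  have t2 : Tendsto (fun n => edist (v n).2.1 w.2.1) atTop (𝓝 0) :=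
    tendsto_iff_edist_tendsto_0.1 (((continuous_fst.comp continuous_snd).tendsto w).comp h)
  have t3 : Tendsto (fun n => edist (v n).2.2 w.2.2) atTop (𝓝 0) :=
    tendsto_iff_edist_tendsto_0.1 (((continuous_snd.comp continuous_snd).tendsto w).comp h)
  refine ⟨φ, k0, ?_, ?_, ?_⟩
  · refine tendsto_of_tendsto_of_tendsto_of_le_of_le tendsto_const_nhds
      (by simpa using hε0.add t1) (fun _ => zero_le) fun n => ?_
    exact (eLpNorm_sub_le_add_edist (k0 n).1.continuous.aestronglyMeasurable (v n).1 _).trans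
      (add_le_add_left (k1 n) _)
  · refine tendsto_of_tendsto_of_tendsto_of_le_of_le tendsto_const_nhds
      (by simpa using hε0.add t2) (fun _ => zero_le) fun n => ?_
    exact (eLpNorm_sub_le_add_edist (continuous_grad (k0 n).1).aestronglyMeasurable
      (v n).2.1 _).trans (add_le_add_left (k2 n) _)
  · refine tendsto_of_tendsto_of_tendsto_of_le_of_le tendsto_const_nhds
      (by simpa using hε0.add t3) (fun _ => zero_le) fun n => ?_
    exact (eLpNorm_sub_le_add_edist (k0 n).1.continuous.aestronglyMeasurable
      (v n).2.2 _).trans (add_le_add_left (k3 n) _)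

/-- The trace relation is closed, and the L² norm of the limit trace on `ΓD` is at most its distance
to traces that vanish there. -/
theorem isClosed_V (Ω ΓD : Set (Pt d)) : IsClosed (V Ω ΓD : Set (L2 Ω × L2vec Ω × L2bdry Ω)) := by
  refine IsSeqClosed.isClosed fun v w hv h => ?_
  have ht := isTrace_of_tendsto (fun n => (hv n).2.1) h
  refine ⟨ht.isWeakGradient, ht, ?_⟩
  have t3 : Tendsto (fun n => edist (v n).2.2 w.2.2) atTop (𝓝 0) :=
    tendsto_iff_edist_tendsto_0.1 (((continuous_snd.comp continuous_snd).tendsto w).comp h)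
  have hle : ∀ n, eLpNorm w.2.2 2 ((surf Ω).restrict ΓD) ≤ edist (v n).2.2 w.2.2 := by
    intro n
    rw [Lp.edist_def]
    refine le_trans (le_of_eq ?_)
      (eLpNorm_mono_measure _ (Measure.restrict_le_self (μ := surf Ω) (s := ΓD)))
    rw [← eLpNorm_neg]
    apply eLpNorm_congr_ae
    filter_upwards [(hv n).2.2] with x hx
    simp [hx]
  have h0 : eLpNorm w.2.2 2 ((surf Ω).restrict ΓD) = 0 :=
    le_antisymm (ge_of_tendsto' t3 hle) zero_le
  exact (eLpNorm_eq_zero_iff (Lp.aestronglyMeasurable w.2.2).restrict (by norm_num)).1 h0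

instance : CompleteSpace (V Ω ΓD) := (isClosed_V Ω ΓD).completeSpace_coe

/-- The pair of a function and its weak gradient, in the Hilbert space `L²(Ω) × L²(Ω)ᵈ`. -/
noncomputable def graphEmbedding (Ω ΓD : Set (Pt d)) :
    V Ω ΓD →ₗ[ℂ] WithLp 2 (L2 Ω × L2vec Ω) where
  toFun v := WithLp.toLp 2 (V.val v, V.gradient v)
  map_add' _ _ := rfl
  map_smul' _ _ := rfl

theorem norm_graphEmbedding_sq (v : V Ω ΓD) :
    ‖graphEmbedding Ω ΓD v‖ ^ 2 = ‖V.val v‖ ^ 2 + ‖V.gradient v‖ ^ 2 := by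
  rw [WithLp.prod_norm_sq_eq_of_L2]
  rfl

theorem norm_val_le (v : V Ω ΓD) : ‖V.val v‖ ≤ ‖graphEmbedding Ω ΓD v‖ :=
  le_of_sq_le_sq (by rw [norm_graphEmbedding_sq]; nlinarith [sq_nonneg ‖V.gradient v‖])
    (norm_nonneg _)

theorem norm_gradient_le (v : V Ω ΓD) : ‖V.gradient v‖ ≤ ‖graphEmbedding Ω ΓD v‖ :=
  le_of_sq_le_sq (by rw [norm_graphEmbedding_sq]; nlinarith [sq_nonneg ‖V.val v‖])
    (norm_nonneg _)

theorem exists_norm_trace_le (hd : 1 ≤ d) (hΩ : IsLipschitzDomain Ω) (ΓD : Set (Pt d)) :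
    ∃ C : ℝ, 0 ≤ C ∧ ∀ v : V Ω ΓD, ‖V.trace v‖ ≤ C * ‖graphEmbedding Ω ΓD v‖ := by
  obtain ⟨C, hC, h⟩ := exists_trace_bound hd hΩ
  refine ⟨C.toReal * 2, by positivity, fun v => ?_⟩
  have h1 := h _ _ _ v.2.2.1
  have h2 : ‖V.trace v‖ ≤ C.toReal * (‖V.val v‖ + ‖V.gradient v‖) := by
    have h3 := ENNReal.toReal_mono (by finiteness) h1
    rw [ENNReal.toReal_mul, ENNReal.toReal_add (by finiteness) (by finiteness)] at h3
    exact h3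
  have h0 : 0 ≤ C.toReal := ENNReal.toReal_nonneg
  nlinarith [norm_val_le v, norm_gradient_le v]

theorem V.norm_def (v : V Ω ΓD) : ‖v‖ = max ‖V.val v‖ (max ‖V.gradient v‖ ‖V.trace v‖) := rfl

/-- The norm of V is the maximum over function, gradient and trace, which is not a Hilbert norm. The
trace component is controlled by the other two, so this norm is equivalent to the one pulled back
from L² × L²; this equivalence is what Lax–Milgram needs. -/
theorem exists_antilipschitz_graphEmbedding (hd : 1 ≤ d) (hΩ : IsLipschitzDomain Ω)
    (ΓD : Set (Pt d)) : ∃ C : ℝ, 0 ≤ C ∧ ∀ v : V Ω ΓD, ‖v‖ ≤ C * ‖graphEmbedding Ω ΓD v‖ := by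
  obtain ⟨C, hC, h⟩ := exists_norm_trace_le hd hΩ ΓD
  refine ⟨1 + C, by positivity, fun v => ?_⟩
  have h0 := norm_nonneg (graphEmbedding Ω ΓD v)
  have h4 := mul_nonneg hC h0
  rw [V.norm_def, max_le_iff, max_le_iff, add_mul, one_mul]
  exact ⟨by linarith [norm_val_le v], by linarith [norm_gradient_le v], by linarith [h v]⟩

theorem norm_graphEmbedding_le (v : V Ω ΓD) : ‖graphEmbedding Ω ΓD v‖ ≤ 2 * ‖v‖ := by
  have h1 : ‖V.val v‖ ≤ ‖v‖ := le_max_left _ _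
  have h2 : ‖V.gradient v‖ ≤ ‖v‖ := (le_max_left _ _).trans (le_max_right _ _)
  refine le_of_sq_le_sq ?_ (by positivity)
  rw [norm_graphEmbedding_sq]
  nlinarith [norm_nonneg (V.val v), norm_nonneg (V.gradient v), norm_nonneg v]

theorem graphEmbedding_injective (hd : 1 ≤ d) (hΩ : IsLipschitzDomain Ω) (ΓD : Set (Pt d)) :
    Function.Injective (graphEmbedding Ω ΓD) := by
  obtain ⟨C, hC, h⟩ := exists_antilipschitz_graphEmbedding hd hΩ ΓD
  refine (injective_iff_map_eq_zero _).2 fun v hv => ?_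
  have := h v
  rw [hv, norm_zero, mul_zero] at this
  exact norm_le_zero_iff.1 this

/-- A function in `V` is determined by its values in `Ω`. -/
theorem V.eq_zero_of_norm (hd : 1 ≤ d) (hΩ : IsLipschitzDomain Ω) {v : V Ω ΓD}
    (h1 : ‖V.val v‖ = 0) (h2 : ‖V.gradient v‖ = 0) : v = 0 := by
  refine (injective_iff_map_eq_zero _).1 (graphEmbedding_injective hd hΩ ΓD) v ?_
  have := norm_graphEmbedding_sq v
  rw [h1, h2] at this
  simpa using this

end SpaceV

/-! ### The Helmholtz form -/

section Form

variable {d : ℕ} {Ω ΓD ΓR : Set (Pt d)} {κ : ℝ}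

theorem integrable_trace_mul (u v : L2bdry Ω) :
    Integrable (fun x => u x * conj (v x)) ((surf Ω).restrict ΓR) :=
  ((Lp.memLp u).integrable_mul (q := 2) (Lp.memLp v).star).restrict

theorem norm_integral_trace_le (u v : L2bdry Ω) :
    ‖∫ x in ΓR, u x * conj (v x) ∂(surf Ω)‖ ≤ ‖u‖ * ‖v‖ := by
  have h1 := enorm_integral_mul_le (μ := (surf Ω).restrict ΓR)
    (Lp.aestronglyMeasurable u).restrict (Lp.memLp v).star.aestronglyMeasurable.restrict
  have h2 : eLpNorm (star ⇑v) 2 ((surf Ω).restrict ΓR) = eLpNorm v 2 ((surf Ω).restrict ΓR) :=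
    eLpNorm_congr_norm_ae (by simp)
  rw [h2] at h1
  have h3 := h1.trans (mul_le_mul' (eLpNorm_mono_measure u Measure.restrict_le_self)
    (eLpNorm_mono_measure v Measure.restrict_le_self))
  rw [Lp.norm_def, Lp.norm_def, ← ENNReal.toReal_mul, ← toReal_enorm]
  exact ENNReal.toReal_mono (by finiteness) h3

/-- The Robin boundary form `(u, v)_{ΓR}`. -/
noncomputable def robinForm (Ω ΓR : Set (Pt d)) : L2bdry Ω →ₗ[ℂ] L2bdry Ω →ₗ⋆[ℂ] ℂ :=
  LinearMap.mk₂'ₛₗ (RingHom.id ℂ) (starRingEnd ℂ)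
    (fun u v => ∫ x in ΓR, u x * conj (v x) ∂(surf Ω))
    (fun u u' v => by
      rw [← integral_add (integrable_trace_mul u v) (integrable_trace_mul u' v)]
      apply integral_congr_ae
      filter_upwards [ae_restrict_of_ae (Lp.coeFn_add u u')] with x hx
      rw [hx, Pi.add_apply, add_mul])
    (fun c u v => by
      rw [RingHom.id_apply, smul_eq_mul, ← integral_const_mul]
      apply integral_congr_ae
      filter_upwards [ae_restrict_of_ae (Lp.coeFn_smul c u)] with x hx
      rw [hx, Pi.smul_apply, smul_eq_mul, mul_assoc])
    (fun u v v' => by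
      rw [← integral_add (integrable_trace_mul u v) (integrable_trace_mul u v')]
      apply integral_congr_ae
      filter_upwards [ae_restrict_of_ae (Lp.coeFn_add v v')] with x hx
      rw [hx, Pi.add_apply, map_add, mul_add])
    (fun c u v => by
      rw [smul_eq_mul, ← integral_const_mul]
      apply integral_congr_ae
      filter_upwards [ae_restrict_of_ae (Lp.coeFn_smul c v)] with x hx
      rw [hx, Pi.smul_apply, smul_eq_mul, map_mul]
      ring)

theorem robinForm_apply (u v : L2bdry Ω) :
    robinForm Ω ΓR u v = ∫ x in ΓR, u x * conj (v x) ∂(surf Ω) := rfl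

theorem form_eq (u v : V Ω ΓD) : form ΓR κ u v =
    inner ℂ (V.gradient v) (V.gradient u) - (κ : ℂ) ^ 2 * inner ℂ (V.val v) (V.val u)
      - Complex.I * (κ : ℂ) * robinForm Ω ΓR (V.trace u) (V.trace v) := rfl

@[simp] theorem V.val_add (u v : V Ω ΓD) : V.val (u + v) = V.val u + V.val v := rfl
@[simp] theorem V.gradient_add (u v : V Ω ΓD) :
    V.gradient (u + v) = V.gradient u + V.gradient v := rfl
@[simp] theorem V.trace_add (u v : V Ω ΓD) : V.trace (u + v) = V.trace u + V.trace v := rfl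
@[simp] theorem V.val_smul (c : ℂ) (v : V Ω ΓD) : V.val (c • v) = c • V.val v := rfl
@[simp] theorem V.gradient_smul (c : ℂ) (v : V Ω ΓD) :
    V.gradient (c • v) = c • V.gradient v := rfl
@[simp] theorem V.trace_smul (c : ℂ) (v : V Ω ΓD) : V.trace (c • v) = c • V.trace v := rfl

/-- The Helmholtz form as a sesquilinear map. -/
noncomputable def formL (ΓR : Set (Pt d)) (κ : ℝ) : V Ω ΓD →ₗ[ℂ] V Ω ΓD →ₗ⋆[ℂ] ℂ :=
  LinearMap.mk₂'ₛₗ (RingHom.id ℂ) (starRingEnd ℂ) (form ΓR κ)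
    (fun u u' v => by
      simp only [form_eq, V.val_add, V.gradient_add, V.trace_add, inner_add_right, map_add,
        LinearMap.add_apply]
      ring)
    (fun c u v => by
      simp only [form_eq, V.val_smul, V.gradient_smul, V.trace_smul, inner_smul_right, map_smul,
        LinearMap.smul_apply, RingHom.id_apply, smul_eq_mul]
      ring)
    (fun u v v' => by
      simp only [form_eq, V.val_add, V.gradient_add, V.trace_add, inner_add_left, map_add]
      ring)
    (fun c u v => by
      simp only [form_eq, V.val_smul, V.gradient_smul, V.trace_smul, inner_smul_left,
        map_smulₛₗ, smul_eq_mul]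
      ring)

@[simp] theorem formL_apply (u v : V Ω ΓD) : formL ΓR κ u v = form ΓR κ u v := rfl

/-- The adjoint of the Helmholtz form. -/
noncomputable def adjointFormL (ΓR : Set (Pt d)) (κ : ℝ) : V Ω ΓD →ₗ[ℂ] V Ω ΓD →ₗ⋆[ℂ] ℂ :=
  LinearMap.mk₂'ₛₗ (RingHom.id ℂ) (starRingEnd ℂ) (fun u v => conj (formL ΓR κ v u))
    (fun u u' v => by rw [map_add, map_add])
    (fun c u v => by rw [map_smulₛₗ, smul_eq_mul, map_mul, Complex.conj_conj]; rfl)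
    (fun u v v' => by rw [map_add, LinearMap.add_apply, map_add])
    (fun c u v => by rw [map_smul, LinearMap.smul_apply, smul_eq_mul, map_mul]; rfl)

theorem robinForm_self (u : L2bdry Ω) :
    robinForm Ω ΓR u u = ((∫ x in ΓR, ‖u x‖ ^ 2 ∂(surf Ω) : ℝ) : ℂ) := by
  rw [robinForm_apply]
  refine Eq.trans (integral_congr_ae (Eventually.of_forall fun x => ?_)) (integral_ofReal (𝕜 := ℂ))
  simp only [Complex.mul_conj, Complex.normSq_eq_norm_sq]
  rfl

theorem form_self (u : V Ω ΓD) : form ΓR κ u u =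
    ((‖V.gradient u‖ ^ 2 - κ ^ 2 * ‖V.val u‖ ^ 2 : ℝ) : ℂ)
      - Complex.I * ((κ * ∫ x in ΓR, ‖V.trace u x‖ ^ 2 ∂(surf Ω) : ℝ) : ℂ) := by
  rw [form_eq, robinForm_self, inner_self_eq_norm_sq_to_K, inner_self_eq_norm_sq_to_K]
  simp only [Complex.coe_algebraMap, Complex.ofReal_sub, Complex.ofReal_mul, Complex.ofReal_pow]
  ring

theorem form_self_re (u : V Ω ΓD) :
    (form ΓR κ u u).re = ‖V.gradient u‖ ^ 2 - κ ^ 2 * ‖V.val u‖ ^ 2 := by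
  rw [form_self, Complex.sub_re, Complex.ofReal_re, Complex.re_mul_ofReal, Complex.I_re, zero_mul,
    sub_zero]

theorem form_self_im (u : V Ω ΓD) :
    (form ΓR κ u u).im = -(κ * ∫ x in ΓR, ‖V.trace u x‖ ^ 2 ∂(surf Ω)) := by
  rw [form_self, Complex.sub_im, Complex.ofReal_im, Complex.im_mul_ofReal, Complex.I_im, one_mul,
    zero_sub]

theorem exists_norm_form_le (hd : 1 ≤ d) (hΩ : IsLipschitzDomain Ω) (ΓD ΓR : Set (Pt d)) (κ : ℝ) :
    ∃ m : ℝ, 0 ≤ m ∧ ∀ u v : V Ω ΓD,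
      ‖form ΓR κ u v‖ ≤ m * ‖graphEmbedding Ω ΓD u‖ * ‖graphEmbedding Ω ΓD v‖ := by
  obtain ⟨C, hC, h⟩ := exists_norm_trace_le hd hΩ ΓD
  refine ⟨1 + κ ^ 2 + |κ| * C ^ 2, by positivity, fun u v => ?_⟩
  set A := ‖graphEmbedding Ω ΓD u‖
  set B := ‖graphEmbedding Ω ΓD v‖
  have h1 : ‖(inner ℂ (V.gradient v) (V.gradient u) : ℂ)‖ ≤ A * B := by
    rw [mul_comm]
    exact (norm_inner_le_norm _ _).trans (mul_le_mul (norm_gradient_le v) (norm_gradient_le u)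
      (norm_nonneg _) (norm_nonneg _))
  have h2 : ‖(inner ℂ (V.val v) (V.val u) : ℂ)‖ ≤ A * B := by
    rw [mul_comm]
    exact (norm_inner_le_norm _ _).trans (mul_le_mul (norm_val_le v) (norm_val_le u)
      (norm_nonneg _) (norm_nonneg _))
  have h3 : ‖robinForm Ω ΓR (V.trace u) (V.trace v)‖ ≤ (C * A) * (C * B) :=
    (norm_integral_trace_le _ _).trans (mul_le_mul (h u) (h v) (norm_nonneg _)
      (mul_nonneg hC (norm_nonneg _)))
  rw [form_eq]
  refine (norm_sub_le _ _).trans ((add_le_add (norm_sub_le _ _) le_rfl).trans ?_)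
  rw [norm_mul, norm_mul, norm_mul, norm_pow, Complex.norm_I, Complex.norm_real, one_mul,
    Real.norm_eq_abs, sq_abs]
  have h4 := mul_le_mul_of_nonneg_left h2 (sq_nonneg κ)
  have h5 := mul_le_mul_of_nonneg_left h3 (abs_nonneg κ)
  linarith

/-- The form is coercive on functions whose `L²` norm is dominated by that of the gradient. -/
theorem form_coercive {w : V Ω ΓD} (hw : κ ^ 2 * ‖V.val w‖ ^ 2 ≤ 1 / 2 * ‖V.gradient w‖ ^ 2) :
    1 / 3 * (κ ^ 2 * ‖V.val w‖ ^ 2 + ‖V.gradient w‖ ^ 2) ≤ (form ΓR κ w w).re := by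
  -- With x = ‖∇w‖² and y = κ²‖w‖², the inequality x − y ≥ (x + y)/3 is equivalent to 2y ≤ x, which
  -- is the hypothesis.
  rw [form_self_re]
  linarith

theorem eq_zero_of_form_self (hd : 1 ≤ d) (hΩ : IsLipschitzDomain Ω) (hκ : 0 < κ) {w : V Ω ΓD}
    (hw : κ ^ 2 * ‖V.val w‖ ^ 2 ≤ 1 / 2 * ‖V.gradient w‖ ^ 2) (h0 : form ΓR κ w w = 0) :
    w = 0 := by
  have h1 := form_coercive (ΓR := ΓR) hw
  rw [h0, Complex.zero_re] at h1
  have h3 : 0 ≤ κ ^ 2 * ‖V.val w‖ ^ 2 := by positivity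
  have h4 : 0 ≤ ‖V.gradient w‖ ^ 2 := by positivity
  have h5 : ‖V.gradient w‖ ^ 2 = 0 := by linarith
  have h6 : κ ^ 2 * ‖V.val w‖ ^ 2 = 0 := by linarith
  refine V.eq_zero_of_norm hd hΩ ?_ (by simpa using h5)
  simpa [hκ.ne'] using h6

/-- On W the indefinite form dominates half of the squared gradient norm, which itself dominates the
squared norm of `graphEmbedding`; so Lax–Milgram applies to the form and to its adjoint. -/
theorem exists_corrections (hd : 1 ≤ d) (hΩ : IsLipschitzDomain Ω) (hκ : 0 < κ)
    (W : Submodule ℂ (V Ω ΓD)) (hW : IsClosed (W : Set (V Ω ΓD)))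
    (hco : ∀ w ∈ W, κ ^ 2 * ‖V.val w‖ ^ 2 ≤ 1 / 2 * ‖V.gradient w‖ ^ 2) (v : V Ω ΓD) :
    (∃ c ∈ W, ∀ w ∈ W, form ΓR κ c w = form ΓR κ v w) ∧
      ∃ c ∈ W, ∀ w ∈ W, form ΓR κ w c = form ΓR κ w v := by
  have : CompleteSpace W := hW.completeSpace_coe
  obtain ⟨C, hC, hJ⟩ := exists_antilipschitz_graphEmbedding hd hΩ ΓD
  obtain ⟨m, hm, hb⟩ := exists_norm_form_le hd hΩ ΓD ΓR κ
  -- Chosen from ‖w‖² + ‖∇w‖² ≤ (1/(2κ²) + 1)‖∇w‖² and Re a(w,w) ≥ ½‖∇w‖².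
  set c : ℝ := (2 * (1 / (2 * κ ^ 2) + 1))⁻¹
  have hc : 0 < c := by positivity
  have hcoer : ∀ w ∈ W, c * ‖graphEmbedding Ω ΓD w‖ ^ 2 ≤ (form ΓR κ w w).re := by
    intro w hw
    have h1 := hco w hw
    rw [form_self_re, norm_graphEmbedding_sq]
    have h2 : ‖V.val w‖ ^ 2 ≤ 1 / (2 * κ ^ 2) * ‖V.gradient w‖ ^ 2 := by
      rw [← mul_le_mul_iff_right₀ (a := κ ^ 2) (by positivity)]
      refine h1.trans_eq ?_
      field_simp
    calc c * (‖V.val w‖ ^ 2 + ‖V.gradient w‖ ^ 2)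
        ≤ c * ((1 / (2 * κ ^ 2) + 1) * ‖V.gradient w‖ ^ 2) := by gcongr; linarith
      _ = 1 / 2 * ‖V.gradient w‖ ^ 2 := by simp only [c]; field_simp
      _ ≤ _ := by linarith
  set J := (graphEmbedding Ω ΓD).comp W.subtype
  have hJ1 : ∀ w : W, ‖J w‖ ≤ 2 * ‖w‖ := fun w => norm_graphEmbedding_le (W.subtype w)
  have hJ2 : ∀ w : W, ‖w‖ ≤ C * ‖J w‖ := fun w => hJ (W.subtype w)
  constructor
  · obtain ⟨u, hu⟩ := exists_forall_eq_of_coercive (W := W) J hJ1 hC hJ2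
      (((formL ΓR κ).comp W.subtype).compl₂ W.subtype) (m := m)
      (m' := m * ‖graphEmbedding Ω ΓD v‖) (fun u w => hb _ _) hc (fun w => hcoer w w.2)
      ((formL ΓR κ v).comp W.subtype) (fun w => hb _ _)
    exact ⟨u, u.2, fun w hw => hu ⟨w, hw⟩⟩
  -- Here the unknown sits in the antilinear slot. Conjugating the equation makes it a problem for
  -- `adjointFormL`, which has the same bound and the same real part on the diagonal.
  · obtain ⟨u, hu⟩ := exists_forall_eq_of_coercive (W := W) J hJ1 hC hJ2
      (((adjointFormL ΓR κ).comp W.subtype).compl₂ W.subtype) (m := m)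
      (m' := m * ‖graphEmbedding Ω ΓD v‖)
      (fun u w => by
        have := hb w u
        rw [mul_right_comm] at this
        rw [← RCLike.norm_conj] at this
        exact this) hc
      (fun w => by
        have := hcoer w w.2
        rwa [← Complex.conj_re] at this)
      ((adjointFormL ΓR κ v).comp W.subtype)
      (fun w => by
        have := hb w v
        rw [mul_right_comm] at this
        rw [← RCLike.norm_conj] at this
        exact this)
    exact ⟨u, u.2, fun w hw => (starRingEnd ℂ).injective (hu ⟨w, hw⟩)⟩

end Form

/-! ### Linear regularity of polytopes -/

section Polytope

/-- If a linear functional vanishes wherever a linear map vanishes on a finitely generated cone,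
then it is bounded by the norm of that map on the cone. -/
theorem exists_abs_sum_le_of_nonneg {ι E : Type*} [Fintype ι] [NormedAddCommGroup E]
    [NormedSpace ℝ E] (a : ι → E) (s : ι → ℝ)
    (h : ∀ c : ι → ℝ, (∀ i, 0 ≤ c i) → ∑ i, c i • a i = 0 → ∑ i, c i * s i = 0) :
    ∃ L : ℝ, 0 ≤ L ∧ ∀ c : ι → ℝ, (∀ i, 0 ≤ c i) → |∑ i, c i * s i| ≤ L * ‖∑ i, c i • a i‖ := by
  classical
  -- Strong induction on the set I of indices whose coefficients may be nonzero.
  have key : ∀ I : Finset ι, ∃ L : ℝ, 0 ≤ L ∧ ∀ c : ι → ℝ, (∀ i, 0 ≤ c i) →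
      (∀ i, i ∉ I → c i = 0) → |∑ i, c i * s i| ≤ L * ‖∑ i, c i • a i‖ := by
    intro I
    induction I using Finset.strongInduction with
    | H I ih =>
      set K : Set (ι → ℝ) := stdSimplex ℝ ι ∩ {c | ∀ i, i ∉ I → c i = 0}
      have hK : IsCompact K := by
        refine (isCompact_stdSimplex ℝ ι).inter_right ?_
        simp only [Set.ofPred_forall]
        exact isClosed_iInter fun i => isClosed_iInter fun _ =>
          isClosed_eq (continuous_apply i) continuous_const
      have hcont : Continuous fun c : ι → ℝ => ‖∑ i, c i • a i‖ := by fun_prop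
      by_cases hZ : ∃ z ∈ K, ∑ i, z i • a i = 0
      -- A nontrivial nonnegative combination z annihilates the vectors, hence by `h` also the
      -- functional, so subtracting a multiple of z from c changes neither sum. The smallest ratio c
      -- i / z i as multiple keeps the coefficients nonnegative and removes one index from I.
      · obtain ⟨z, ⟨⟨hz0, hz1⟩, hzI⟩, hz⟩ := hZ
        have hzs := h z hz0 hz
        choose! L hL0 hL using ih
        refine ⟨∑ i ∈ I, L (I.erase i), ?_, fun c hc hcI => ?_⟩
        · exact Finset.sum_nonneg fun i hi => hL0 _ (Finset.erase_ssubset hi)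
        have hne : (Finset.univ.filter fun i => 0 < z i).Nonempty := by
          by_contra hne
          rw [Finset.not_nonempty_iff_eq_empty, Finset.filter_eq_empty_iff] at hne
          have : ∑ i, z i = 0 := Finset.sum_eq_zero fun i _ =>
            le_antisymm (not_lt.1 (hne (Finset.mem_univ i))) (hz0 i)
          linarith
        obtain ⟨k, hk, hmin⟩ := Finset.exists_min_image _ (fun i => c i / z i) hne
        have hzk : 0 < z k := (Finset.mem_filter.1 hk).2
        have hkI : k ∈ I := by
          by_contra hkI
          exact hzk.ne' (hzI k hkI)
        set t := c k / z k
        have ht : 0 ≤ t := div_nonneg (hc k) hzk.le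
        have hc' : ∀ i, 0 ≤ c i - t * z i := by
          intro i
          rcases (hz0 i).lt_or_eq with hi | hi
          · have := hmin i (Finset.mem_filter.2 ⟨Finset.mem_univ _, hi⟩)
            rw [le_div_iff₀ hi] at this
            linarith
          · rw [← hi, mul_zero, sub_zero]; exact hc i
        have hc'' : ∀ i, i ∉ I.erase k → c i - t * z i = 0 := by
          intro i hi
          by_cases hik : i = k
          · subst hik
            simp only [t]
            field_simp
            ring
          · have hiI : i ∉ I := fun hiI => hi (Finset.mem_erase.2 ⟨hik, hiI⟩)
            rw [hcI i hiI, hzI i hiI, mul_zero, sub_zero]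
        have := hL _ (Finset.erase_ssubset hkI) (fun i => c i - t * z i) hc' hc''
        simp only [sub_mul, sub_smul, Finset.sum_sub_distrib, mul_assoc, mul_smul,
          ← Finset.mul_sum, ← Finset.smul_sum, hzs, hz, mul_zero, smul_zero, sub_zero] at this
        refine this.trans (mul_le_mul_of_nonneg_right ?_ (norm_nonneg _))
        exact Finset.single_le_sum (f := fun i => L (I.erase i))
          (fun i hi => hL0 _ (Finset.erase_ssubset hi)) hkI
      -- The vector sum has no zero on the compact slice K, so its norm has a positive lower bound
      -- there while the functional is bounded; homogeneity extends the estimate to the cone.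
      · push Not at hZ
        have hcS : Continuous fun c : ι → ℝ => |∑ i, c i * s i| := by fun_prop
        obtain ⟨m, hm, hmK⟩ : ∃ m : ℝ, 0 < m ∧ ∀ c ∈ K, m ≤ ‖∑ i, c i • a i‖ := by
          rcases K.eq_empty_or_nonempty with hE | hne
          · exact ⟨1, one_pos, by simp [hE]⟩
          · obtain ⟨x, hx, hmin⟩ := hK.exists_isMinOn hne hcont.continuousOn
            exact ⟨_, norm_pos_iff.2 (hZ x hx), fun c hc => hmin hc⟩
        obtain ⟨M, hM⟩ := (hK.bddAbove_image hcS.continuousOn)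
        have hM' : ∀ c ∈ K, |∑ i, c i * s i| ≤ max M 0 := fun c hc =>
          (hM (Set.mem_image_of_mem _ hc)).trans (le_max_left _ _)
        refine ⟨max M 0 / m, by positivity, fun c hc hcI => ?_⟩
        set t := ∑ i, c i
        have ht : 0 ≤ t := Finset.sum_nonneg fun i _ => hc i
        rcases ht.lt_or_eq with ht | ht
        · have hcK : (fun i => t⁻¹ * c i) ∈ K := by
            refine ⟨⟨fun i => mul_nonneg (by positivity) (hc i), ?_⟩, fun i hi => ?_⟩
            · rw [← Finset.mul_sum]; exact inv_mul_cancel₀ ht.ne'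
            · simp only [hcI i hi, mul_zero]
          have h1 := hM' _ hcK
          have h2 := hmK _ hcK
          simp only [mul_assoc, mul_smul, ← Finset.mul_sum, ← Finset.smul_sum, abs_mul, norm_smul,
            abs_of_pos (inv_pos.2 ht), Real.norm_eq_abs] at h1 h2
          rw [inv_mul_le_iff₀ ht] at h1
          rw [le_inv_mul_iff₀ ht] at h2
          calc |∑ i, c i * s i| ≤ t * max M 0 := h1
            _ = max M 0 / m * (t * m) := by field_simp
            _ ≤ _ := by gcongr
        · have h0 : ∀ i, c i = 0 := fun i =>
            (Finset.sum_eq_zero_iff_of_nonneg fun i _ => hc i).1 ht.symm i (Finset.mem_univ i)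
          simp [h0]
  obtain ⟨L, hL, h'⟩ := key Finset.univ
  exact ⟨L, hL, fun c hc => h' c hc fun i hi => absurd (Finset.mem_univ i) hi⟩

theorem affineMap_sum {E : Type*} [NormedAddCommGroup E] [NormedSpace ℝ E] (A : E →ᵃ[ℝ] ℝ)
    {ι : Type*} (S : Finset ι) (w : ι → ℝ) (p : ι → E) :
    ∑ i ∈ S, w i * A (p i) = A.linear (∑ i ∈ S, w i • p i) + (∑ i ∈ S, w i) * A 0 := by
  have hA : ∀ x, A x = A.linear x + A 0 := fun x => congrFun A.decomp x
  simp only [fun i => hA (p i), mul_add, Finset.sum_add_distrib, ← Finset.sum_mul, map_sum,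
    map_smul, smul_eq_mul]

/-- Two affine functions on two polytopes, which agree on the intersection, form a Lipschitz
function. -/
theorem exists_abs_sub_le_of_eqOn_inter {E : Type*} [NormedAddCommGroup E] [NormedSpace ℝ E]
    (S T : Finset E) (A B : E →ᵃ[ℝ] ℝ)
    (h : ∀ x ∈ convexHull ℝ (S : Set E) ∩ convexHull ℝ (T : Set E), A x = B x) :
    ∃ L : ℝ, 0 ≤ L ∧ ∀ x ∈ convexHull ℝ (S : Set E), ∀ y ∈ convexHull ℝ (T : Set E),
      |A x - B y| ≤ L * ‖x - y‖ := by
  have hA : ∀ x, A x = A.linear x + A 0 := fun x => congrFun A.decomp x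
  have hB : ∀ x, B x = B.linear x + B 0 := fun x => congrFun B.decomp x
  have hsum : ∀ c : S × T → ℝ, ∑ i, c i * (A i.1 - B i.2)
      = (A.linear (∑ i, c i • (i.1 : E)) + (∑ i, c i) * A 0)
        - (B.linear (∑ i, c i • (i.2 : E)) + (∑ i, c i) * B 0) := by
    intro c
    rw [← affineMap_sum A, ← affineMap_sum B, ← Finset.sum_sub_distrib]
    simp only [mul_sub]
  have hvec : ∀ c : S × T → ℝ, ∑ i, c i • ((i.1 : E) - i.2)
      = ∑ i, c i • (i.1 : E) - ∑ i, c i • (i.2 : E) := by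
    intro c
    simp only [smul_sub, Finset.sum_sub_distrib]
  -- The cone is generated by the differences of a vertex s of S and a vertex t of T, and the
  -- functional takes the value A s − B t on them. If a combination of the differences vanishes, its
  -- two halves agree; after normalization they are a common point of both hulls, where A = B.
  obtain ⟨L, hL0, hL⟩ := exists_abs_sum_le_of_nonneg (ι := S × T)
    (fun i => (i.1 : E) - i.2) (fun i => A i.1 - B i.2) (by
      intro c hc h0
      rw [hvec, sub_eq_zero] at h0
      rw [hsum, ← h0]
      set t := ∑ i, c i
      have ht : 0 ≤ t := Finset.sum_nonneg fun i _ => hc i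
      rcases ht.lt_or_eq with ht | ht
      · obtain ⟨x, hx⟩ : ∃ x, x = t⁻¹ • ∑ i, c i • (i.1 : E) := ⟨_, rfl⟩
        have hw : ∑ i, t⁻¹ * c i = 1 := by rw [← Finset.mul_sum]; exact inv_mul_cancel₀ ht.ne'
        have hx1 : x ∈ convexHull ℝ (S : Set E) := by
          have : x = ∑ i, (t⁻¹ * c i) • (i.1 : E) := by
            simp only [hx, Finset.smul_sum, mul_smul]
          rw [this]
          exact (convex_convexHull ℝ _).sum_mem (fun i _ => mul_nonneg (by positivity) (hc i)) hw
            fun i _ => subset_convexHull ℝ _ i.1.2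
        have hx2 : x ∈ convexHull ℝ (T : Set E) := by
          have : x = ∑ i, (t⁻¹ * c i) • (i.2 : E) := by
            simp only [hx, h0, Finset.smul_sum, mul_smul]
          rw [this]
          exact (convex_convexHull ℝ _).sum_mem (fun i _ => mul_nonneg (by positivity) (hc i)) hw
            fun i _ => subset_convexHull ℝ _ i.2.2
        have h1 := h x ⟨hx1, hx2⟩
        have h2 : ∑ i, c i • (i.1 : E) = t • x := by
          rw [hx, smul_inv_smul₀ ht.ne']
        rw [h2, map_smul, map_smul, smul_eq_mul, smul_eq_mul, ← mul_add, ← mul_add, ← hA, ← hB, h1,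
          sub_self]
      · have h2 : ∀ i, c i = 0 := fun i =>
          (Finset.sum_eq_zero_iff_of_nonneg fun i _ => hc i).1 ht.symm i (Finset.mem_univ i)
        rw [← ht]
        simp [h2])
  refine ⟨L, hL0, fun x hx y hy => ?_⟩
  obtain ⟨α, hα0, hα1, hαx⟩ := Finset.mem_convexHull'.1 hx
  obtain ⟨β, hβ0, hβ1, hβy⟩ := Finset.mem_convexHull'.1 hy
  rw [← Finset.sum_coe_sort] at hα1 hαx hβ1 hβy
  -- Products of convex weights represent x and y by one family of coefficients on S × T.
  have e1 : ∑ i : S × T, (α i.1 * β i.2) • (i.1 : E) = x := by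
    rw [Fintype.sum_prod_type, ← hαx]
    refine Finset.sum_congr rfl fun i _ => ?_
    simp only [← Finset.sum_smul, ← Finset.mul_sum, hβ1, mul_one]
  have e2 : ∑ i : S × T, (α i.1 * β i.2) • (i.2 : E) = y := by
    rw [Fintype.sum_prod_type_right, ← hβy]
    refine Finset.sum_congr rfl fun i _ => ?_
    simp only [← Finset.sum_smul, ← Finset.sum_mul, hα1, one_mul]
  have e3 : ∑ i : S × T, α i.1 * β i.2 = 1 := by
    rw [Fintype.sum_prod_type]
    simp only [← Finset.mul_sum, hβ1, mul_one, hα1]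
  have := hL (fun i => α i.1 * β i.2) fun i => mul_nonneg (hα0 _ i.1.2) (hβ0 _ i.2.2)
  rw [hsum, hvec, e1, e2, e3, one_mul, one_mul, ← hA, ← hB] at this
  exact this

end Polytope

/-! ### Nodal basis functions -/

section Hat

variable {d : ℕ} {Ω : Set (Pt d)} (M : Mesh Ω)

theorem affineMap_eqOn_convexHull {E F : Type*} [AddCommGroup E] [Module ℝ E] [AddCommGroup F]
    [Module ℝ F] {A B : E →ᵃ[ℝ] F} {S : Set E} (h : Set.EqOn A B S) :
    Set.EqOn A B (convexHull ℝ S) := by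
  have h1 : S ⊆ (A - B) ⁻¹' {0} := fun x hx => by simp [h hx]
  have h2 := convexHull_min h1 ((convex_singleton (0 : F)).affine_preimage (A - B))
  intro x hx
  have := h2 hx
  simpa [sub_eq_zero] using this

/-- The affine function that coincides with the nodal basis function of `z` on the element `T`. -/
noncomputable def Mesh.hatAffine (z : Pt d) (T : Finset (Pt d)) (hT : T ∈ M.elements) :
    Pt d →ᵃ[ℝ] ℝ :=
  open Classical in if h : z ∈ T then (M.basis T hT).coord ⟨z, h⟩ else 0

open Classical in
theorem Mesh.hatAffine_vertex (z : Pt d) {T : Finset (Pt d)} (hT : T ∈ M.elements) {y : Pt d}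
    (hy : y ∈ T) : M.hatAffine z T hT y = if y = z then 1 else 0 := by
  unfold Mesh.hatAffine
  split_ifs with h1 h2 h2
  · subst h2
    exact (M.basis T hT).coord_apply_eq ⟨y, h1⟩
  · exact (M.basis T hT).coord_apply_ne (i := ⟨z, h1⟩) (j := ⟨y, hy⟩)
      (fun h => h2 (congrArg Subtype.val h).symm)
  · subst h2; exact absurd hy h1
  · rfl

/-- In a face-to-face mesh the intersection of two elements is spanned by their common vertices,
where both affine functions have the same values 0 or 1. -/
theorem Mesh.hatAffine_eq {z : Pt d} {T T' : Finset (Pt d)} (hT : T ∈ M.elements)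
    (hT' : T' ∈ M.elements) {x : Pt d} (hx : x ∈ simplex T) (hx' : x ∈ simplex T') :
    M.hatAffine z T hT x = M.hatAffine z T' hT' x := by
  have h : x ∈ convexHull ℝ ((T : Set (Pt d)) ∩ (T' : Set (Pt d))) := by
    rw [← M.inter_eq T hT T' hT']; exact ⟨hx, hx'⟩
  refine affineMap_eqOn_convexHull (fun y hy => ?_) h
  rw [M.hatAffine_vertex z hT hy.1, M.hatAffine_vertex z hT' hy.2]

/-- Frees the nodal function from the element selected in its definition. -/
theorem Mesh.hat_eq {z : Pt d} {T : Finset (Pt d)} (hT : T ∈ M.elements) {x : Pt d}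
    (hx : x ∈ simplex T) : M.hat z x = M.hatAffine z T hT x := by
  unfold Mesh.hat
  split_ifs with h
  · rw [← M.hatAffine_eq h.choose_spec.1 hT h.choose_spec.2.2 hx, Mesh.hatAffine,
      dif_pos h.choose_spec.2.1]
  · rw [Mesh.hatAffine, dif_neg fun hz => h ⟨T, hT, hz, hx⟩]
    rfl

theorem Mesh.exists_mem_simplex {x : Pt d} (hx : x ∈ closure Ω) :
    ∃ T ∈ M.elements, x ∈ simplex T := by
  rw [← M.iUnion_eq] at hx
  simpa using hx

/-- Elementwise Lipschitz bounds are not enough, since the segment between two points of a nonconvex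
Ω may leave the mesh. Instead each pair of elements, touching or not, has its own Lipschitz constant
by `exists_abs_sub_le_of_eqOn_inter`, and the finitely many constants are summed. -/
theorem Mesh.lipschitzOnWith_hat (z : Pt d) :
    ∃ K : ℝ≥0, LipschitzOnWith K (M.hat z) (closure Ω) := by
  have key : ∀ T : M.elements, ∀ T' : M.elements, ∃ L : ℝ, 0 ≤ L ∧
      ∀ x ∈ simplex T.1, ∀ y ∈ simplex T'.1,
        |M.hatAffine z T T.2 x - M.hatAffine z T' T'.2 y| ≤ L * ‖x - y‖ := fun T T' =>
    exists_abs_sub_le_of_eqOn_inter _ _ _ _ fun x hx => M.hatAffine_eq T.2 T'.2 hx.1 hx.2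
  choose L hL0 hL using key
  set K := ∑ T, ∑ T', L T T'
  have hK : 0 ≤ K := Finset.sum_nonneg fun T _ => Finset.sum_nonneg fun T' _ => hL0 T T'
  refine ⟨⟨K, hK⟩, LipschitzOnWith.of_dist_le_mul fun x hx y hy => ?_⟩
  obtain ⟨T, hT, hxT⟩ := M.exists_mem_simplex hx
  obtain ⟨T', hT', hyT'⟩ := M.exists_mem_simplex hy
  rw [M.hat_eq hT hxT, M.hat_eq hT' hyT', Real.dist_eq, dist_eq_norm]
  refine (hL ⟨T, hT⟩ ⟨T', hT'⟩ x hxT y hyT').trans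
    (mul_le_mul_of_nonneg_right ?_ (norm_nonneg _))
  have h1 : L ⟨T, hT⟩ ⟨T', hT'⟩ ≤ ∑ T', L ⟨T, hT⟩ T' :=
    Finset.single_le_sum (f := fun T' => L ⟨T, hT⟩ T') (fun i _ => hL0 _ _) (Finset.mem_univ _)
  exact h1.trans (Finset.single_le_sum (f := fun T => ∑ T', L T T')
    (fun i _ => Finset.sum_nonneg fun j _ => hL0 _ _) (Finset.mem_univ (⟨T, hT⟩ : M.elements)))

/-- The point x lies in a mesh face contained in the closure of `ΓD`. All vertices of that face
differ from the free vertex z, so the affine function vanishes at each of them. -/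
theorem Mesh.hat_eq_zero_of_mem_closure {ΓD : Set (Pt d)} (hM : M.Resolves ΓD) {z : Pt d}
    (hz : z ∈ M.freeVertices ΓD) {x : Pt d} (hx : x ∈ closure ΓD) : M.hat z x = 0 := by
  obtain ⟨𝓕, h𝓕, hcl⟩ := hM
  have hz' : z ∉ closure ΓD := by
    simp only [Mesh.freeVertices, Finset.mem_filter] at hz
    exact hz.2
  rw [hcl] at hx hz'
  simp only [Set.mem_iUnion, exists_prop, not_exists, not_and] at hx hz'
  obtain ⟨F, hF, hxF⟩ := hx
  obtain ⟨-, T, hT, hFT⟩ := h𝓕 F hF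
  have hxT : x ∈ simplex T := convexHull_mono (by exact_mod_cast hFT) hxF
  rw [M.hat_eq hT hxT]
  refine affineMap_eqOn_convexHull (B := 0) (fun y hy => ?_) hxF
  rw [M.hatAffine_vertex z hT (hFT hy), if_neg]
  · rfl
  · rintro rfl
    exact hz' F hF (subset_convexHull ℝ _ hy)

/-- The frontier of a convex set is a null set, and there are finitely many elements. -/
theorem Mesh.ae_exists_mem_interior :
    ∀ᵐ x ∂(vol Ω), ∃ T ∈ M.elements, x ∈ interior (simplex T) := by
  have h0 : ∀ᵐ x ∂(vol Ω), ∀ T ∈ M.elements, x ∉ frontier (simplex T) := by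
    rw [Finset.eventually_all]
    intro T _
    exact ae_restrict_of_ae (measure_eq_zero_iff_ae_notMem.1
      ((convex_convexHull ℝ (T : Set (Pt d))).addHaar_frontier volume))
  have h1 : ∀ᵐ x ∂(vol Ω), x ∈ closure Ω :=
    ae_restrict_of_ae_restrict_of_subset subset_closure
      (ae_restrict_mem isClosed_closure.measurableSet)
  filter_upwards [h0, h1] with x hx hxc
  obtain ⟨T, hT, hxT⟩ := M.exists_mem_simplex hxc
  refine ⟨T, hT, ?_⟩
  by_contra h
  exact hx T hT ⟨subset_closure hxT, h⟩

end Hat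

/-! ### Smooth approximation of Lipschitz functions -/

section Mollify

variable {d : ℕ}

theorem tendsto_eLpNorm_two_zero {α F : Type*} [MeasurableSpace α] [NormedAddCommGroup F]
    {μ : Measure α} [IsFiniteMeasure μ] {f : ℕ → α → F} {C : ℝ≥0}
    (hm : ∀ n, AEStronglyMeasurable (f n) μ) (hb : ∀ n, ∀ᵐ x ∂μ, ‖f n x‖ₑ ≤ C)
    (h : ∀ᵐ x ∂μ, Tendsto (fun n => f n x) atTop (𝓝 0)) :
    Tendsto (fun n => eLpNorm (f n) 2 μ) atTop (𝓝 0) := by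
  have h1 : Tendsto (fun n => ∫⁻ x, ‖f n x‖ₑ ^ 2 ∂μ) atTop (𝓝 (∫⁻ _, 0 ∂μ)) := by
    refine tendsto_lintegral_of_dominated_convergence' (fun _ => (C : ℝ≥0∞) ^ 2)
      (fun n => (hm n).enorm.pow_const 2) (fun n => ?_) ?_ ?_
    · filter_upwards [hb n] with x hx
      gcongr
    · rw [lintegral_const]; finiteness
    · filter_upwards [h] with x hx
      simpa using ENNReal.Tendsto.pow (n := 2) hx.enorm
  rw [lintegral_zero] at h1
  have h2 := (ENNReal.continuous_rpow_const (y := (1 : ℝ) / 2)).tendsto 0 |>.comp h1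
  have h3 : ∀ n, (∫⁻ x, ‖f n x‖ₑ ^ 2 ∂μ) ^ ((1 : ℝ) / 2) = eLpNorm (f n) 2 μ := by
    intro n
    rw [← eLpNorm_two_sq, ← ENNReal.rpow_natCast, ← ENNReal.rpow_mul]
    norm_num
  rw [ENNReal.zero_rpow_of_pos (by norm_num)] at h2
  exact h2.congr h3

/-- A sequence of bump functions that shrinks to the origin. -/
noncomputable def shrinkingBump (d : ℕ) (n : ℕ) : ContDiffBump (0 : Pt d) where
  rIn := 1 / (2 * ((n : ℝ) + 1))
  rOut := 1 / ((n : ℝ) + 1)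
  rIn_pos := by positivity
  rIn_lt_rOut := by
    apply one_div_lt_one_div_of_lt (by positivity)
    linarith [(Nat.cast_nonneg n : (0 : ℝ) ≤ n)]

theorem shrinkingBump_rOut (n : ℕ) : (shrinkingBump d n).rOut = 1 / ((n : ℝ) + 1) := rfl

theorem tendsto_shrinkingBump : Tendsto (fun n => (shrinkingBump d n).rOut) atTop (𝓝 0) :=
  tendsto_one_div_add_atTop_nhds_zero_nat

/-- The mollification of a function. -/
noncomputable def mollify (n : ℕ) (g : Pt d → ℝ) (x : Pt d) : ℝ :=
  ∫ t, (shrinkingBump d n).normed volume t * g (x - t)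

theorem mollify_eq_convolution (n : ℕ) (g : Pt d → ℝ) : mollify n g =
    MeasureTheory.convolution ((shrinkingBump d n).normed volume) g
      (ContinuousLinearMap.lsmul ℝ ℝ) volume := rfl

theorem contDiff_mollify (n : ℕ) {g : Pt d → ℝ} (hg : LocallyIntegrable g) :
    ContDiff ℝ ∞ (mollify n g) := by
  rw [mollify_eq_convolution]
  exact (shrinkingBump d n).hasCompactSupport_normed.contDiff_convolution_left _
    (shrinkingBump d n).contDiff_normed hg

theorem integrable_bump_mul (n : ℕ) {g : Pt d → ℝ} (hg : Continuous g) (x : Pt d) :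
    Integrable fun t => (shrinkingBump d n).normed volume t * g (x - t) :=
  ((shrinkingBump d n).continuous_normed.mul (by fun_prop)).integrable_of_hasCompactSupport
    (shrinkingBump d n).hasCompactSupport_normed.mul_right

theorem mollify_sub_eq (n : ℕ) {g : Pt d → ℝ} (hg : Continuous g) (x y : Pt d) :
    mollify n g x - mollify n g y =
      ∫ t, (shrinkingBump d n).normed volume t * (g (x - t) - g (y - t)) := by
  unfold mollify
  rw [← integral_sub (integrable_bump_mul n hg x) (integrable_bump_mul n hg y)]
  simp only [mul_sub]

theorem integral_bump_mul_const (n : ℕ) (c : ℝ) :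
    ∫ t, (shrinkingBump d n).normed volume t * c = c := by
  rw [integral_mul_const, ContDiffBump.integral_normed, one_mul]

theorem lipschitzWith_mollify (n : ℕ) {g : Pt d → ℝ} {K : ℝ≥0} (hg : LipschitzWith K g) :
    LipschitzWith K (mollify n g) := by
  refine LipschitzWith.of_dist_le_mul fun x y => ?_
  rw [Real.dist_eq, mollify_sub_eq n hg.continuous, ← Real.norm_eq_abs]
  refine (norm_integral_le_of_norm_le (g := fun t =>
    (shrinkingBump d n).normed volume t * (K * dist x y))
    (((shrinkingBump d n).integrable_normed).mul_const _) (Eventually.of_forall fun t => ?_)).trans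
      (integral_bump_mul_const n _).le
  rw [norm_mul, Real.norm_of_nonneg ((shrinkingBump d n).nonneg_normed t)]
  refine mul_le_mul_of_nonneg_left ?_ ((shrinkingBump d n).nonneg_normed t)
  have := hg.dist_le_mul (x - t) (y - t)
  rwa [dist_sub_right, Real.dist_eq] at this

theorem abs_mollify_sub_le (n : ℕ) {g : Pt d → ℝ} {K : ℝ≥0} (hg : LipschitzWith K g) (x : Pt d) :
    |mollify n g x - g x| ≤ K * (1 / ((n : ℝ) + 1)) := by
  rw [← Real.dist_eq, mollify_eq_convolution]
  refine ContDiffBump.dist_normed_convolution_le hg.continuous.aestronglyMeasurable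
    fun y hy => ?_
  refine (hg.dist_le_mul y x).trans ?_
  gcongr
  exact (Metric.mem_ball.1 hy).le

/-- Mollification reproduces the derivative where the function is affine. -/
theorem hasFDerivAt_mollify_of_affine (n : ℕ) {g : Pt d → ℝ} (hg : Continuous g)
    {A : Pt d →ᵃ[ℝ] ℝ} {x : Pt d} {r : ℝ} (h : Set.EqOn g A (Metric.ball x r))
    (hn : 1 / ((n : ℝ) + 1) < r) :
    HasFDerivAt (mollify n g) (LinearMap.toContinuousLinearMap A.linear) x := by
  set s := r - 1 / ((n : ℝ) + 1)
  have hs : 0 < s := by simp only [s]; linarith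
  -- The kernel has radius 1/(n+1), so for y within s of x both averaging windows lie where g is
  -- affine; there the two integrands differ by a constant multiple of the kernel.
  have key : ∀ y ∈ Metric.ball x s, mollify n g y = A.linear (y - x) + mollify n g x := by
    intro y hy
    rw [← sub_eq_iff_eq_add, mollify_sub_eq n hg,
      ← integral_bump_mul_const (d := d) n (A.linear (y - x))]
    refine integral_congr_ae (Eventually.of_forall fun t => ?_)
    by_cases ht : t ∈ Metric.ball (0 : Pt d) (shrinkingBump d n).rOut
    · have ht' : ‖t‖ < 1 / ((n : ℝ) + 1) := by simpa [shrinkingBump_rOut] using ht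
      have h1 : y - t ∈ Metric.ball x r := by
        rw [Metric.mem_ball, dist_eq_norm] at hy ⊢
        calc ‖y - t - x‖ = ‖(y - x) - t‖ := by congr 1; abel
          _ ≤ ‖y - x‖ + ‖t‖ := norm_sub_le _ _
          _ < s + 1 / ((n : ℝ) + 1) := add_lt_add hy ht'
          _ = r := by simp [s]
      have h2 : x - t ∈ Metric.ball x r := by
        rw [Metric.mem_ball, dist_eq_norm, sub_sub_cancel_left, norm_neg]
        linarith
      simp only
      rw [h h1, h h2]
      congr 1
      have := A.linearMap_vsub (y - t) (x - t)
      simp only [vsub_eq_sub, sub_sub_sub_cancel_right] at this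
      exact this.symm
    · have : (shrinkingBump d n).normed volume t = 0 := by
        by_contra h0
        have h4 : t ∈ Function.support ((shrinkingBump d n).normed volume) := h0
        rw [ContDiffBump.support_normed_eq] at h4
        exact ht h4
      simp [this]
  have h2 : HasFDerivAt (fun y => A.linear (y - x) + mollify n g x)
      (LinearMap.toContinuousLinearMap A.linear) x := by
    have h3 := ((LinearMap.toContinuousLinearMap A.linear).hasFDerivAt (x := x)).sub_const
      (A.linear x)
    simpa using h3.add_const (mollify n g x)
  refine h2.congr_of_eventuallyEq ?_
  filter_upwards [Metric.ball_mem_nhds x hs] with y hy using key y hy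

end Mollify

/-! ### Lipschitz functions are Sobolev functions -/

section LipschitzSobolev

variable {d : ℕ} {Ω ΓD : Set (Pt d)}

theorem IsLipschitzDomain.isFiniteMeasure_vol (hΩ : IsLipschitzDomain Ω) :
    IsFiniteMeasure (vol Ω) :=
  ⟨by rw [Measure.restrict_apply_univ]; exact hΩ.isBounded.measure_lt_top⟩

/-- The trace inequality for the constant function 1 bounds the surface measure of the boundary by
the volume of Ω. -/
theorem IsLipschitzDomain.isFiniteMeasure_surf (hd : 1 ≤ d) (hΩ : IsLipschitzDomain Ω) :
    IsFiniteMeasure (surf Ω) := by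
  have := hΩ.isFiniteMeasure_vol
  obtain ⟨C, hC, h⟩ := trace_inequality hd hΩ
  have h1 := h (fun _ => 1) contDiff_const
  have h2 : ∀ x : Pt d, grad (fun _ : Pt d => (1 : ℂ)) x = 0 := by
    intro x; ext j; simp [grad, pderiv]
  simp only [h2, enorm_one, one_pow, enorm_zero, ne_eq, OfNat.ofNat_ne_zero, not_false_eq_true,
    zero_pow, add_zero, lintegral_const, one_mul] at h1
  exact ⟨h1.trans_lt (by finiteness)⟩

theorem norm_grad_le (φ : Pt d → ℂ) (x : Pt d) : ‖grad φ x‖ ≤ d * ‖fderiv ℝ φ x‖ := by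
  have h1 : ∀ j, ‖pderiv φ j x‖ ≤ ‖fderiv ℝ φ x‖ := fun j => by
    unfold pderiv
    simpa using (fderiv ℝ φ x).le_opNorm (EuclideanSpace.single j (1 : ℝ))
  calc ‖grad φ x‖ ≤ ∑ j, ‖pderiv φ j x‖ := by
        rw [EuclideanSpace.norm_eq]
        refine Real.sqrt_le_iff.2 ⟨Finset.sum_nonneg fun j _ => norm_nonneg _, ?_⟩
        exact Finset.sum_sq_le_sq_sum_of_nonneg fun j _ => norm_nonneg _
    _ ≤ ∑ _j : Fin d, ‖fderiv ℝ φ x‖ := Finset.sum_le_sum fun j _ => h1 j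
    _ = _ := by simp

theorem LipschitzWith.ofReal_comp {g : Pt d → ℝ} {K : ℝ≥0} (hg : LipschitzWith K g) :
    LipschitzWith K fun x => (g x : ℂ) := by
  refine LipschitzWith.of_dist_le_mul fun x y => ?_
  rw [dist_eq_norm, ← Complex.ofReal_sub, Complex.norm_real, ← dist_eq_norm]
  exact hg.dist_le_mul x y

theorem norm_grad_le_of_lipschitz {g : Pt d → ℝ} {K : ℝ≥0} (hg : LipschitzWith K g) (x : Pt d) :
    ‖grad (fun x => (g x : ℂ)) x‖ ≤ d * K :=
  (norm_grad_le _ _).trans (mul_le_mul_of_nonneg_left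
    (norm_fderiv_le_of_lipschitz ℝ (LipschitzWith.ofReal_comp hg)) (Nat.cast_nonneg d))

theorem measurable_grad (φ : Pt d → ℂ) : Measurable (grad φ) :=
  (WithLp.measurable_toLp 2 (Fin d → ℂ)).comp
    (measurable_pi_lambda _ fun _ => measurable_fderiv_apply_const ℝ φ _)

theorem grad_ofReal_of_hasFDerivAt {f : Pt d → ℝ} {L : Pt d →L[ℝ] ℝ} {x : Pt d}
    (h : HasFDerivAt f L x) : grad (fun x => (f x : ℂ)) x =
      WithLp.toLp 2 fun j => ((L (EuclideanSpace.single j (1 : ℝ)) : ℝ) : ℂ) := by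
  have h1 : HasFDerivAt (fun x => (f x : ℂ)) (Complex.ofRealCLM.comp L) x :=
    Complex.ofRealCLM.hasFDerivAt.comp x h
  ext j
  simp [grad, pderiv, h1.fderiv]

theorem grad_congr {φ ψ : Pt d → ℂ} {x : Pt d} (h : φ =ᶠ[𝓝 x] ψ) : grad φ x = grad ψ x := by
  ext j
  simp [grad, pderiv, h.fderiv_eq]

theorem hasFDerivAt_affineMap (A : Pt d →ᵃ[ℝ] ℝ) (x : Pt d) :
    HasFDerivAt A (LinearMap.toContinuousLinearMap A.linear) x := by
  have h := ((LinearMap.toContinuousLinearMap A.linear).hasFDerivAt (x := x)).add_const (A 0)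
  refine h.congr_of_eventuallyEq (Eventually.of_forall fun y => ?_)
  exact congrFun A.decomp y

theorem memLp_of_lipschitz (hΩ : Bornology.IsBounded Ω) {μ : Measure (Pt d)} [IsFiniteMeasure μ]
    (hμ : ∀ᵐ x ∂μ, x ∈ closure Ω) {g : Pt d → ℝ} (hg : Continuous g) :
    MemLp (fun x => (g x : ℂ)) 2 μ := by
  obtain ⟨B, hB⟩ := hΩ.isCompact_closure.exists_bound_of_continuousOn hg.continuousOn
  refine MemLp.of_bound (Complex.continuous_ofReal.comp hg).aestronglyMeasurable B ?_
  filter_upwards [hμ] with x hx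
  rw [Complex.norm_real]
  exact hB x hx

/-- The approximants are mollifications of g. Their values converge uniformly on the closure of Ω.
Their gradients are uniformly bounded and, at almost every point, eventually equal to that of g
because g is affine nearby; dominated convergence then gives L² convergence. -/
theorem isTrace_of_lipschitz (hd : 1 ≤ d) (hΩ : IsLipschitzDomain Ω) {g : Pt d → ℝ} {K : ℝ≥0}
    (hg : LipschitzWith K g)
    (hA : ∀ᵐ x ∂(vol Ω), ∃ r > 0, ∃ A : Pt d →ᵃ[ℝ] ℝ, Set.EqOn g A (Metric.ball x r))
    {u : L2 Ω} {G : L2vec Ω} {t : L2bdry Ω} (hu : u =ᵐ[vol Ω] fun x => (g x : ℂ))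
    (hG : G =ᵐ[vol Ω] grad fun x => (g x : ℂ)) (ht : t =ᵐ[surf Ω] fun x => (g x : ℂ)) :
    IsTrace Ω u G t := by
  have := hΩ.isFiniteMeasure_vol
  have := hΩ.isFiniteMeasure_surf hd
  obtain ⟨R, hR0, hR⟩ := hΩ.isBounded.closure.subset_ball_lt 0 0
  -- A cut-off equal to 1 on the closure of Ω: it gives the approximants compact support and changes
  -- nothing on Ω or its boundary.
  let χ : ContDiffBump (0 : Pt d) := ⟨R, R + 1, hR0, by linarith⟩
  have hχ : ∀ x ∈ closure Ω, χ x = 1 := fun x hx =>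
    χ.one_of_mem_closedBall (Metric.ball_subset_closedBall (hR hx))
  have hvc : ∀ᵐ x ∂(vol Ω), x ∈ closure Ω := ae_restrict_of_ae_restrict_of_subset subset_closure
      (ae_restrict_mem isClosed_closure.measurableSet)
  have hsc : ∀ᵐ x ∂(surf Ω), x ∈ closure Ω := ae_restrict_of_ae_restrict_of_subset
    frontier_subset_closure (ae_restrict_mem isClosed_closure.measurableSet)
  let φ : ℕ → Pt d → ℂ := fun n x => ((χ x * mollify n g x : ℝ) : ℂ)
  have hφ : ∀ n, ContDiff ℝ ∞ (φ n) := fun n => Complex.ofRealCLM.contDiff.comp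
    (χ.contDiff.mul (contDiff_mollify n hg.continuous.locallyIntegrable))
  have hφc : ∀ n, HasCompactSupport (φ n) := fun n =>
    (χ.hasCompactSupport.mul_right (f' := mollify n g)).comp_left (g := fun x : ℝ => (x : ℂ)) rfl
  have hval : ∀ n, ∀ x ∈ closure Ω, ‖φ n x - g x‖ ≤ K * (1 / ((n : ℝ) + 1)) := by
    intro n x hx
    simp only [φ, hχ x hx, one_mul]
    rw [← Complex.ofReal_sub, Complex.norm_real]
    exact abs_mollify_sub_le n hg x
  have hlim : Tendsto (fun n : ℕ => K * (1 / ((n : ℝ) + 1))) atTop (𝓝 0) := by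
    simpa using tendsto_one_div_add_atTop_nhds_zero_nat.const_mul (K : ℝ)
  have hone : ∀ n : ℕ, 1 / ((n : ℝ) + 1) ≤ 1 := fun n => by
    rw [div_le_one (by positivity)]
    linarith [(Nat.cast_nonneg n : (0 : ℝ) ≤ n)]
  have conv : ∀ (μ : Measure (Pt d)) [IsFiniteMeasure μ], (∀ᵐ x ∂μ, x ∈ closure Ω) →
      ∀ f : Pt d → ℂ, f =ᵐ[μ] (fun x => (g x : ℂ)) →
      Tendsto (fun n => eLpNorm (fun x => φ n x - f x) 2 μ) atTop (𝓝 0) := by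
    intro μ _ hμ f hf
    have h1 : ∀ n, eLpNorm (fun x => φ n x - f x) 2 μ = eLpNorm (fun x => φ n x - g x) 2 μ := by
      intro n
      apply eLpNorm_congr_ae
      filter_upwards [hf] with x hx
      rw [hx]
    simp only [h1]
    refine tendsto_eLpNorm_two_zero (C := K) (fun n => ?_) (fun n => ?_) ?_
    · exact ((hφ n).continuous.sub
        (Complex.continuous_ofReal.comp hg.continuous)).aestronglyMeasurable
    · filter_upwards [hμ] with x hx
      rw [enorm_eq_nnnorm, ENNReal.coe_le_coe, ← NNReal.coe_le_coe, coe_nnnorm]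
      exact (hval n x hx).trans (mul_le_of_le_one_right K.2 (hone n))
    · filter_upwards [hμ] with x hx
      exact squeeze_zero_norm (fun n => hval n x hx) hlim
  refine ⟨φ, fun n => ⟨hφ n, hφc n⟩, conv _ hvc _ hu, ?_, conv _ hsc _ ht⟩
  have hΩm : ∀ᵐ x ∂(vol Ω), x ∈ Ω := ae_restrict_mem hΩ.isOpen.measurableSet
  have hgr : ∀ n, ∀ x ∈ Ω, grad (φ n) x = grad (fun x => (mollify n g x : ℂ)) x := by
    intro n x hx
    refine grad_congr ?_
    filter_upwards [hΩ.isOpen.mem_nhds hx] with y hy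
    simp only [φ, hχ y (subset_closure hy), one_mul]
  have h1 : ∀ n, eLpNorm (fun x => grad (φ n) x - G x) 2 (vol Ω)
      = eLpNorm (fun x => grad (φ n) x - grad (fun x => (g x : ℂ)) x) 2 (vol Ω) := by
    intro n
    apply eLpNorm_congr_ae
    filter_upwards [hG] with x hx
    rw [hx]
  simp only [h1]
  refine tendsto_eLpNorm_two_zero (C := 2 * (d * K)) (fun n => ?_) (fun n => ?_) ?_
  · exact ((measurable_grad _).sub (measurable_grad _)).aestronglyMeasurable
  · filter_upwards [hΩm] with x hx
    rw [enorm_eq_nnnorm, ENNReal.coe_le_coe, ← NNReal.coe_le_coe, coe_nnnorm, hgr n x hx]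
    refine (norm_sub_le _ _).trans ?_
    push_cast
    linarith [norm_grad_le_of_lipschitz (lipschitzWith_mollify n hg) x,
      norm_grad_le_of_lipschitz hg x]
  · filter_upwards [hΩm, hA] with x hx hxA
    obtain ⟨r, hr, A, hgA⟩ := hxA
    refine tendsto_const_nhds.congr' ?_
    filter_upwards [tendsto_one_div_add_atTop_nhds_zero_nat.eventually (gt_mem_nhds hr)] with n hn
    have h2 : HasFDerivAt g (LinearMap.toContinuousLinearMap A.linear) x :=
      (hasFDerivAt_affineMap A x).congr_of_eventuallyEq
        (by filter_upwards [Metric.ball_mem_nhds x hr] with y hy using hgA hy)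
    rw [hgr n x hx, grad_ofReal_of_hasFDerivAt
      (hasFDerivAt_mollify_of_affine n hg.continuous hgA hn), grad_ofReal_of_hasFDerivAt h2,
      sub_self]

/-- The nodal basis functions at free vertices belong to `V`. -/
theorem Mesh.exists_hat_mem (M : Mesh Ω) (hd : 1 ≤ d) (hΩ : IsLipschitzDomain Ω)
    (hD : IsRelOpen Ω ΓD) (hM : M.Resolves ΓD) {z : Pt d} (hz : z ∈ M.freeVertices ΓD) :
    ∃ v : V Ω ΓD, V.val v =ᵐ[vol Ω] fun x => (M.hat z x : ℂ) := by
  have := hΩ.isFiniteMeasure_vol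
  have := hΩ.isFiniteMeasure_surf hd
  obtain ⟨K, hK⟩ := M.lipschitzOnWith_hat z
  -- Mollification needs a function on the whole space, so the hat function is extended from the
  -- closure of Ω with its Lipschitz constant.
  obtain ⟨g, hg, hgh⟩ := hK.extend_real
  have hvc : ∀ᵐ x ∂(vol Ω), x ∈ closure Ω := ae_restrict_of_ae_restrict_of_subset subset_closure
      (ae_restrict_mem isClosed_closure.measurableSet)
  have hsc : ∀ᵐ x ∂(surf Ω), x ∈ closure Ω := ae_restrict_of_ae_restrict_of_subset
    frontier_subset_closure (ae_restrict_mem isClosed_closure.measurableSet)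
  have m1 := memLp_of_lipschitz hΩ.isBounded hvc hg.continuous
  have m2 := memLp_of_lipschitz hΩ.isBounded hsc hg.continuous
  have m3 : MemLp (grad fun x => (g x : ℂ)) 2 (vol Ω) :=
    MemLp.of_bound (measurable_grad _).aestronglyMeasurable (d * K)
      (Eventually.of_forall fun x => norm_grad_le_of_lipschitz hg x)
  have hA : ∀ᵐ x ∂(vol Ω), ∃ r > 0, ∃ A : Pt d →ᵃ[ℝ] ℝ, Set.EqOn g A (Metric.ball x r) := by
    filter_upwards [M.ae_exists_mem_interior] with x ⟨T, hT, hx⟩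
    obtain ⟨r, hr, hb⟩ := Metric.isOpen_iff.1 isOpen_interior x hx
    refine ⟨r, hr, M.hatAffine z T hT, fun y hy => ?_⟩
    have hyT : y ∈ simplex T := interior_subset (hb hy)
    have hyc : y ∈ closure Ω := by
      rw [← M.iUnion_eq]
      exact Set.mem_biUnion hT hyT
    rw [← hgh hyc, M.hat_eq hT hyT]
  have htr := isTrace_of_lipschitz hd hΩ hg hA m1.coeFn_toLp m3.coeFn_toLp m2.coeFn_toLp
  have hΓD : ΓD ⊆ frontier Ω := by
    obtain ⟨U, -, rfl⟩ := hD
    exact Set.inter_subset_right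
  refine ⟨⟨(m1.toLp _, m3.toLp _, m2.toLp _), htr.isWeakGradient, htr, ?_⟩, ?_⟩
  · have hmD : MeasurableSet ΓD := by
      obtain ⟨U, hU, rfl⟩ := hD
      exact hU.measurableSet.inter isClosed_frontier.measurableSet
    filter_upwards [ae_restrict_of_ae m2.coeFn_toLp, ae_restrict_mem hmD] with x hx hxD
    rw [hx, ← hgh (frontier_subset_closure (hΓD hxD)),
      M.hat_eq_zero_of_mem_closure hM hz (subset_closure hxD), Complex.ofReal_zero]
  · filter_upwards [m1.coeFn_toLp, hvc] with x hx hxc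
    change (m1.toLp _ : L2 Ω) x = _
    rw [hx, hgh hxc]

end LipschitzSobolev

/-! ### The quasi-interpolation operator -/

section Clement

variable {d : ℕ} {Ω ΓD : Set (Pt d)} (M : Mesh Ω)

/-- The function itself, as a continuous linear map. -/
noncomputable def V.valL (Ω ΓD : Set (Pt d)) : V Ω ΓD →L[ℂ] L2 Ω :=
  (ContinuousLinearMap.fst ℂ (L2 Ω) (L2vec Ω × L2bdry Ω)).comp (V Ω ΓD).subtypeL

@[simp] theorem V.valL_apply (v : V Ω ΓD) : V.valL Ω ΓD v = V.val v := rfl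

theorem Mesh.memLp_hat (hΩ : IsLipschitzDomain Ω) (z : Pt d) :
    MemLp (fun x => (M.hat z x : ℂ)) 2 (vol Ω) := by
  have := hΩ.isFiniteMeasure_vol
  obtain ⟨K, hK⟩ := M.lipschitzOnWith_hat z
  obtain ⟨g, hg, hgh⟩ := hK.extend_real
  have hvc : ∀ᵐ x ∂(vol Ω), x ∈ closure Ω := ae_restrict_of_ae_restrict_of_subset subset_closure
      (ae_restrict_mem isClosed_closure.measurableSet)
  refine (memLp_of_lipschitz hΩ.isBounded hvc hg.continuous).ae_eq ?_
  filter_upwards [hvc] with x hx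
  rw [hgh hx]

/-- The nodal basis function as an element of `L²(Ω)`. -/
noncomputable def Mesh.hatL2 (hΩ : IsLipschitzDomain Ω) (z : Pt d) : L2 Ω :=
  (M.memLp_hat hΩ z).toLp _

theorem Mesh.coeFn_hatL2 (hΩ : IsLipschitzDomain Ω) (z : Pt d) :
    M.hatL2 hΩ z =ᵐ[vol Ω] fun x => (M.hat z x : ℂ) := MemLp.coeFn_toLp _

theorem Mesh.integral_mul_hat (hΩ : IsLipschitzDomain Ω) (z : Pt d) (u : L2 Ω) :
    ∫ x in Ω, u x * (M.hat z x : ℂ) = inner ℂ (M.hatL2 hΩ z) u := by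
  rw [L2.inner_def]
  apply integral_congr_ae
  filter_upwards [M.coeFn_hatL2 hΩ z] with x hx
  rw [hx, RCLike.inner_apply, Complex.conj_ofReal]

/-- The quasi-interpolation operator as a continuous linear map into `L²(Ω)`. -/
noncomputable def Mesh.clementL (hΩ : IsLipschitzDomain Ω) (ΓD : Set (Pt d)) :
    V Ω ΓD →L[ℂ] L2 Ω :=
  ∑ z ∈ M.freeVertices ΓD, (((∫ x in Ω, M.hat z x : ℝ) : ℂ)⁻¹ •
    (innerSL ℂ (M.hatL2 hΩ z)).comp (V.valL Ω ΓD)).smulRight (M.hatL2 hΩ z)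

theorem Mesh.clementL_apply (hΩ : IsLipschitzDomain Ω) (v : V Ω ΓD) :
    M.clementL hΩ ΓD v = ∑ z ∈ M.freeVertices ΓD, M.nodal z v • M.hatL2 hΩ z := by
  unfold Mesh.clementL
  rw [_root_.sum_apply]
  refine Finset.sum_congr rfl fun z _ => ?_
  rw [ContinuousLinearMap.smulRight_apply, Mesh.nodal, M.integral_mul_hat hΩ]
  simp [div_eq_inv_mul]

theorem coeFn_sum {ι : Type*} (s : Finset ι) (f : ι → L2 Ω) :
    (∑ i ∈ s, f i : L2 Ω) =ᵐ[vol Ω] fun x => ∑ i ∈ s, f i x := by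
  classical
  induction s using Finset.induction_on with
  | empty =>
    filter_upwards [Lp.coeFn_zero ℂ 2 (vol Ω)] with x hx
    simpa using hx
  | insert i s hi ih =>
    rw [Finset.sum_insert hi]
    filter_upwards [Lp.coeFn_add (f i) (∑ i ∈ s, f i), ih] with x h1 h2
    rw [h1, Pi.add_apply, h2, Finset.sum_insert hi]

theorem Mesh.coeFn_clementL (hΩ : IsLipschitzDomain Ω) (v : V Ω ΓD) :
    M.clementL hΩ ΓD v =ᵐ[vol Ω] M.clement v := by
  rw [M.clementL_apply hΩ]
  have h : ∀ᵐ x ∂(vol Ω), ∀ z ∈ M.freeVertices ΓD,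
      (M.nodal z v • M.hatL2 hΩ z : L2 Ω) x = M.nodal z v * (M.hat z x : ℂ) := by
    rw [Finset.eventually_all]
    intro z _
    filter_upwards [Lp.coeFn_smul (M.nodal z v) (M.hatL2 hΩ z), M.coeFn_hatL2 hΩ z] with x h1 h2
    rw [h1, Pi.smul_apply, h2, smul_eq_mul]
  filter_upwards [coeFn_sum (M.freeVertices ΓD) fun z => M.nodal z v • M.hatL2 hΩ z, h]
    with x h1 h2
  rw [h1, Mesh.clement]
  exact Finset.sum_congr rfl h2

/-- The remainder space as a submodule. -/
noncomputable def Mesh.remainderSubmodule (hΩ : IsLipschitzDomain Ω) (ΓD : Set (Pt d)) :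
    Submodule ℂ (V Ω ΓD) := LinearMap.ker (M.clementL hΩ ΓD : V Ω ΓD →ₗ[ℂ] L2 Ω)

theorem Mesh.mem_remainderSubmodule (hΩ : IsLipschitzDomain Ω) {v : V Ω ΓD} :
    v ∈ M.remainderSubmodule hΩ ΓD ↔ v ∈ M.remainder ΓD := by
  have h := M.coeFn_clementL hΩ v
  change M.clementL hΩ ΓD v = 0 ↔ M.clement v =ᵐ[vol Ω] 0
  rw [Lp.eq_zero_iff_ae_eq_zero]
  exact ⟨fun h' => h.symm.trans h', fun h' => h.trans h'⟩

theorem Mesh.isClosed_remainderSubmodule (hΩ : IsLipschitzDomain Ω) :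
    IsClosed (M.remainderSubmodule hΩ ΓD : Set (V Ω ΓD)) :=
  (M.clementL hΩ ΓD).isClosed_ker

/-- The finite element space as a submodule. -/
def Mesh.femSubmodule (ΓD : Set (Pt d)) : Submodule ℂ (V Ω ΓD) where
  carrier := M.femSpace ΓD
  add_mem' := by
    intro u v hu hv T hT
    obtain ⟨A, hA⟩ := hu T hT
    obtain ⟨B, hB⟩ := hv T hT
    refine ⟨A + B, ?_⟩
    filter_upwards [hA, hB, ae_restrict_of_ae (Lp.coeFn_add (V.val u) (V.val v))] with x h1 h2 h3
    rw [V.val_add, h3, Pi.add_apply, h1, h2]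
    rfl
  zero_mem' := by
    intro T hT
    refine ⟨0, ?_⟩
    filter_upwards [ae_restrict_of_ae (Lp.coeFn_zero ℂ 2 (vol Ω))] with x hx
    exact hx
  smul_mem' := by
    intro c u hu T hT
    obtain ⟨A, hA⟩ := hu T hT
    refine ⟨c • A, ?_⟩
    filter_upwards [hA, ae_restrict_of_ae (Lp.coeFn_smul c (V.val u))] with x h1 h2
    rw [V.val_smul, h2, Pi.smul_apply, h1]
    rfl

theorem Mesh.exists_hat_mem_femSpace (hd : 1 ≤ d) (hΩ : IsLipschitzDomain Ω)
    (hD : IsRelOpen Ω ΓD) (hM : M.Resolves ΓD) {z : Pt d} (hz : z ∈ M.freeVertices ΓD) :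
    ∃ v : V Ω ΓD, V.val v = M.hatL2 hΩ z ∧ v ∈ M.femSubmodule ΓD := by
  obtain ⟨v, hv⟩ := M.exists_hat_mem hd hΩ hD hM hz
  refine ⟨v, Lp.ext (hv.trans (M.coeFn_hatL2 hΩ z).symm), fun T hT => ?_⟩
  refine ⟨(Complex.ofRealCLM : ℝ →ₗ[ℝ] ℂ).toAffineMap.comp (M.hatAffine z T hT), ?_⟩
  have hm : MeasurableSet (simplex T) :=
    (T.finite_toSet.isCompact_convexHull (𝕜 := ℝ)).isClosed.measurableSet
  filter_upwards [ae_restrict_of_ae hv, ae_restrict_mem hm] with x h1 h2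
  rw [h1, M.hat_eq hT h2]
  rfl

/-- Every function in `V` is the sum of a finite element function and a remainder. -/
theorem Mesh.exists_sub_mem_remainder (hd : 1 ≤ d) (hΩ : IsLipschitzDomain Ω)
    (hD : IsRelOpen Ω ΓD) (hM : M.Resolves ΓD) (u : V Ω ΓD) :
    ∃ v ∈ M.femSubmodule ΓD, u - v ∈ M.remainderSubmodule hΩ ΓD := by
  have key : ∀ z : M.freeVertices ΓD, ∃ v : V Ω ΓD, V.val v = M.hatL2 hΩ z ∧
      v ∈ M.femSubmodule ΓD := fun z => M.exists_hat_mem_femSpace hd hΩ hD hM z.2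
  choose φ hφ hφm using key
  let S : Submodule ℂ (L2 Ω) := Submodule.span ℂ (Set.range fun z : M.freeVertices ΓD =>
    M.hatL2 hΩ z)
  have : FiniteDimensional ℂ S := FiniteDimensional.span_of_finite ℂ (Set.finite_range _)
  -- The finite element part is the L² projection of u onto the hats, not I_H u: the residual of the
  -- projection is orthogonal to every hat, so all its nodal functionals vanish, whereas I_H is not
  -- claimed to be a projection.
  have hp : S.starProjection (V.val u) ∈ S := Submodule.starProjection_apply_mem S _
  obtain ⟨c, hc⟩ := (Submodule.mem_span_range_iff_exists_fun ℂ).1 hp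
  have hval : V.val (∑ z, c z • φ z) = S.starProjection (V.val u) := by
    rw [← V.valL_apply, map_sum, ← hc]
    simp [hφ]
  refine ⟨∑ z, c z • φ z, Submodule.sum_mem _ fun z _ => Submodule.smul_mem _ _ (hφm z), ?_⟩
  change M.clementL hΩ ΓD _ = 0
  rw [M.clementL_apply hΩ]
  refine Finset.sum_eq_zero fun z hz => ?_
  have h1 : (inner ℂ (M.hatL2 hΩ z) (V.val (u - ∑ z, c z • φ z)) : ℂ) = 0 := by
    have h2 : V.val (u - ∑ z, c z • φ z) = V.val u - S.starProjection (V.val u) := by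
      rw [← hval]; rfl
    rw [h2]
    exact Submodule.inner_right_of_mem_orthogonal 
      (Submodule.subset_span (Set.mem_range_self (⟨z, hz⟩ : M.freeVertices ΓD)))
      (Submodule.sub_starProjection_mem_orthogonal _)
  rw [Mesh.nodal, M.integral_mul_hat hΩ, h1, zero_div, zero_smul]

end Clement

/-! ### Elementwise estimates -/

section MeshEstimates

variable {d : ℕ} {Ω ΓD ΓR : Set (Pt d)} (M : Mesh Ω)

theorem measurableSet_simplex (T : Finset (Pt d)) : MeasurableSet (simplex T) :=
  (T.finite_toSet.isClosed_convexHull ℝ).measurableSet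

/-- Distinct elements have equally many vertices, so T has a vertex z outside T'. The barycentric
coordinate of z vanishes on the intersection but is positive in the interior of T. -/
theorem Mesh.inter_subset_frontier {T T' : Finset (Pt d)} (hT : T ∈ M.elements)
    (hT' : T' ∈ M.elements) (h : T ≠ T') :
    simplex T ∩ simplex T' ⊆ frontier (simplex T) := by
  intro x hx
  have hx1 := hx.1
  rw [M.inter_eq T hT T' hT'] at hx
  have hn : ¬ T ⊆ T' := fun h' => h (Finset.eq_of_subset_of_card_le h'
    (by rw [M.card_eq T hT, M.card_eq T' hT']))
  obtain ⟨z, hz, hz'⟩ := Finset.not_subset.1 hn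
  have h0 : M.hatAffine z T hT x = 0 := by
    refine affineMap_eqOn_convexHull (B := 0) (fun y hy => ?_) hx
    rw [M.hatAffine_vertex z hT hy.1, if_neg]
    · rfl
    · rintro rfl
      exact hz' hy.2
  rw [(T.finite_toSet.isClosed_convexHull ℝ).frontier_eq]
  refine ⟨hx1, fun hi => ?_⟩
  have hr : Set.range (M.basis T hT) = (T : Set (Pt d)) := Subtype.range_coe
  have hi' : x ∈ interior (convexHull ℝ (Set.range (M.basis T hT))) := by rwa [hr]
  rw [AffineBasis.interior_convexHull] at hi'
  have h1 := hi' ⟨z, hz⟩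
  rw [Mesh.hatAffine, dif_pos hz] at h0
  exact h1.ne' h0

theorem Mesh.pairwise_aedisjoint :
    (M.elements : Set (Finset (Pt d))).Pairwise (Function.onFun (AEDisjoint (vol Ω)) simplex) := by
  intro T hT T' hT' h
  refine measure_mono_null (M.inter_subset_frontier hT hT' h) ?_
  exact Measure.absolutelyContinuous_of_le Measure.restrict_le_self
    ((convex_convexHull ℝ (T : Set (Pt d))).addHaar_frontier volume)

theorem Mesh.widthFun_eq {T : Finset (Pt d)} (hT : T ∈ M.elements) {x : Pt d}
    (hx : x ∈ interior (simplex T)) : M.widthFun x = width T := by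
  unfold Mesh.widthFun
  rw [Finset.sum_eq_single T]
  · rw [Set.indicator_of_mem hx]
  · intro T' hT' hne
    refine Set.indicator_of_notMem (fun hx' => ?_) _
    have h := M.inter_subset_frontier hT hT' hne.symm
      ⟨interior_subset hx, interior_subset hx'⟩
    exact h.2 hx
  · exact fun h => absurd hT h

theorem Mesh.measurable_widthFun : Measurable M.widthFun :=
  Finset.measurable_fun_sum _ fun _ _ => measurable_const.indicator isOpen_interior.measurableSet

theorem Mesh.ae_widthFun_eq {T : Finset (Pt d)} (hT : T ∈ M.elements) :
    ∀ᵐ x ∂(vol Ω).restrict (simplex T), M.widthFun x = width T := by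
  have h : ∀ᵐ x ∂(vol Ω), x ∉ frontier (simplex T) := ae_restrict_of_ae
    (measure_eq_zero_iff_ae_notMem.1
      ((convex_convexHull ℝ (T : Set (Pt d))).addHaar_frontier volume))
  filter_upwards [ae_restrict_of_ae h, ae_restrict_mem (measurableSet_simplex T)] with x h1 h2
  refine M.widthFun_eq hT ?_
  by_contra h3
  exact h1 ⟨subset_closure h2, h3⟩

theorem width_pos (hd : 1 ≤ d) {T : Finset (Pt d)} (hT : T ∈ M.elements) : 0 < width T := by
  have h : 1 < T.card := by rw [M.card_eq T hT]; omega
  obtain ⟨x, hx, y, hy, hxy⟩ := Finset.one_lt_card.1 h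
  exact (dist_pos.2 hxy).trans_le (Metric.dist_le_diam_of_mem
    (T.finite_toSet.isCompact_convexHull ℝ).isBounded (subset_convexHull ℝ _ hx)
    (subset_convexHull ℝ _ hy))

theorem Mesh.width_le_maxWidth {T : Finset (Pt d)} (hT : T ∈ M.elements) :
    width T ≤ M.maxWidth :=
  le_ciSup (f := fun T : M.elements => width T.1) (Set.finite_range _).bddAbove ⟨T, hT⟩

theorem Mesh.elements_nonempty (hΩ : IsLipschitzDomain Ω) : M.elements.Nonempty := by
  obtain ⟨x, hx⟩ := hΩ.isConnected.nonempty
  obtain ⟨T, hT, -⟩ := M.exists_mem_simplex (subset_closure hx)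
  exact ⟨T, hT⟩

theorem Mesh.simplex_subset_patch {T K : Finset (Pt d)} (hT : T ∈ M.elements)
    (h : (simplex T ∩ simplex K).Nonempty) : simplex T ⊆ M.patch K :=
  Set.subset_biUnion_of_mem (u := simplex) (show T ∈ {T' ∈ (M.elements : Set (Finset (Pt d))) |
    (simplex T' ∩ simplex K).Nonempty} from ⟨hT, h⟩)

theorem setLIntegral_biUnion_le {α ι : Type*} [MeasurableSpace α] {μ : Measure α} (s : Finset ι)
    (t : ι → Set α) (F : α → ℝ≥0∞) :
    ∫⁻ x in ⋃ i ∈ s, t i, F x ∂μ ≤ ∑ i ∈ s, ∫⁻ x in t i, F x ∂μ := by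
  have h := lintegral_iUnion_le (μ := μ) (fun i : s => t i) F
  rw [tsum_fintype, Finset.sum_coe_sort s fun i => ∫⁻ x in t i, F x ∂μ] at h
  rwa [← Finset.set_biUnion_coe, Set.biUnion_eq_iUnion]

-- The elements that touch K are contained in the patch of K. Touching is symmetric, so this also
-- bounds the number of patches in whose union K occurs.
open Classical in
theorem Mesh.card_touching_le {K : Finset (Pt d)} (hK : K ∈ M.elements) :
    (M.elements.filter fun T => (simplex T ∩ simplex K).Nonempty).card ≤ M.overlap := by
  refine le_trans (Finset.card_le_card fun T hT => ?_)
    (Finset.le_sup (f := fun T => (M.elements.filter fun K => simplex K ⊆ M.patch T).card) hK)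
  rw [Finset.mem_filter] at hT ⊢
  exact ⟨hT.1, M.simplex_subset_patch hT.1 hT.2⟩

theorem Mesh.one_le_overlap (hΩ : IsLipschitzDomain Ω) : 1 ≤ M.overlap := by
  classical
  obtain ⟨T, hT⟩ := M.elements_nonempty hΩ
  refine le_trans (Finset.card_pos.2 ⟨T, ?_⟩) (M.card_touching_le hT)
  rw [Finset.mem_filter, Set.inter_self]
  refine ⟨hT, Set.Nonempty.mono (subset_convexHull ℝ _) ?_⟩
  have h : 0 < T.card := by rw [M.card_eq T hT]; omega
  exact_mod_cast Finset.card_pos.1 h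

theorem Mesh.sum_lintegral (F : Pt d → ℝ≥0∞) :
    ∑ T ∈ M.elements, ∫⁻ x in simplex T, F x ∂(vol Ω) = ∫⁻ x in Ω, F x := by
  rw [← lintegral_biUnion_finset₀ M.pairwise_aedisjoint
    fun T _ => (measurableSet_simplex T).nullMeasurableSet, M.iUnion_eq,
    Measure.restrict_restrict isClosed_closure.measurableSet,
    Set.inter_eq_self_of_subset_right subset_closure]

/-- After exchanging the sums, the integral over K is counted once for each element touching K,
hence at most `M.overlap` times. -/
theorem Mesh.sum_lintegral_patch_le (F : Pt d → ℝ≥0∞) :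
    ∑ T ∈ M.elements, ∫⁻ x in M.patch T, F x ∂(vol Ω) ≤ M.overlap * ∫⁻ x in Ω, F x := by
  classical
  calc ∑ T ∈ M.elements, ∫⁻ x in M.patch T, F x ∂(vol Ω)
      ≤ ∑ T ∈ M.elements, ∑ K ∈ M.elements,
          if (simplex K ∩ simplex T).Nonempty then ∫⁻ x in simplex K, F x ∂(vol Ω) else 0 := by
        refine Finset.sum_le_sum fun T _ => ?_
        rw [← Finset.sum_filter]
        have h : M.patch T = ⋃ K ∈ M.elements.filter fun K => (simplex K ∩ simplex T).Nonempty,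
            simplex K := by simp [Mesh.patch]
        rw [h]
        exact setLIntegral_biUnion_le _ _ _
    _ = ∑ K ∈ M.elements, ∑ T ∈ M.elements,
          if (simplex T ∩ simplex K).Nonempty then ∫⁻ x in simplex K, F x ∂(vol Ω) else 0 := by
        rw [Finset.sum_comm]
        simp only [Set.inter_comm]
    _ ≤ ∑ K ∈ M.elements, M.overlap * ∫⁻ x in simplex K, F x ∂(vol Ω) := by
        refine Finset.sum_le_sum fun K hK => ?_
        rw [← Finset.sum_filter, Finset.sum_const, nsmul_eq_mul]
        gcongr
        exact M.card_touching_le hK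
    _ = _ := by rw [← Finset.mul_sum, M.sum_lintegral]

theorem measurableSet_patch (T : Finset (Pt d)) : MeasurableSet (M.patch T) :=
  Set.Finite.measurableSet_biUnion (M.elements.finite_toSet.subset fun _ h => h.1)
    fun K _ => measurableSet_simplex K

/-- A finite infimum is attained: for fixed v and T the condition is a closed lower bound on C,
obtained by dividing by the gradient norm on the patch; if that norm is 0, all admissible C say the
same. -/
theorem Mesh.isClementBound_clementConst (h : M.clementConst ΓD ≠ ⊤) :
    M.IsClementBound ΓD (M.clementConst ΓD).toNNReal := by
  intro v T hT
  have hN : 0 ≤ Mesh.normOn Ω (M.patch T) (V.gradient v) := ENNReal.toReal_nonneg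
  rcases hN.eq_or_lt with h0 | h0
  · have hex : ∃ C, M.IsClementBound ΓD C := by
      by_contra! hne
      exact h (by simp [Mesh.clementConst, hne])
    obtain ⟨C, hC⟩ := hex
    have := hC v T hT
    rw [← h0, mul_zero] at this ⊢
    exact this
  · rw [← div_le_iff₀ h0]
    refine (ENNReal.ofReal_le_iff_le_toReal h).1 ?_
    refine le_iInf₂ fun C hC => ?_
    rw [← ENNReal.ofReal_coe_nnreal]
    exact ENNReal.ofReal_le_ofReal ((div_le_iff₀ h0).2 (hC v T hT))

/-- If C_I were ∞, the right-hand side of the resolution condition would be 0, while Hκ > 0. Overlap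
at least 1 excludes the product 0 · ∞ there. -/
theorem Mesh.clementConst_ne_top (hd : 1 ≤ d) (hΩ : IsLipschitzDomain Ω) {κ : ℝ} (hκ : 0 < κ)
    (hres : M.ResolutionCondition ΓD κ) : M.clementConst ΓD ≠ ⊤ := by
  intro h
  obtain ⟨T, hT⟩ := M.elements_nonempty hΩ
  have h1 : 0 < M.maxWidth * κ :=
    mul_pos ((width_pos M hd hT).trans_le (M.width_le_maxWidth hT)) hκ
  have h2 : (1 : ℝ) ≤ M.overlap := by exact_mod_cast M.one_le_overlap hΩ
  have h3 : ENNReal.ofReal √(2 * M.overlap) ≠ 0 :=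
    (ENNReal.ofReal_pos.2 (Real.sqrt_pos.2 (by positivity))).ne'
  unfold Mesh.ResolutionCondition at hres
  rw [h, ENNReal.mul_top h3, ENNReal.div_top] at hres
  exact absurd h1 (not_lt.2 (ENNReal.ofReal_eq_zero.1 (le_antisymm hres zero_le)))

theorem Mesh.resolution (hd : 1 ≤ d) (hΩ : IsLipschitzDomain Ω) {κ : ℝ} (hκ : 0 < κ)
    (hres : M.ResolutionCondition ΓD κ) :
    M.maxWidth ^ 2 * κ ^ 2 * (2 * M.overlap) * (M.clementConst ΓD).toReal ^ 2 ≤ 1 := by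
  have hC := M.clementConst_ne_top hd hΩ hκ hres
  have h1 := ENNReal.mul_le_of_le_div hres
  obtain ⟨T, hT⟩ := M.elements_nonempty hΩ
  have h0 : 0 ≤ M.maxWidth * κ :=
    (mul_pos ((width_pos M hd hT).trans_le (M.width_le_maxWidth hT)) hκ).le
  rw [← ENNReal.ofReal_toReal hC, ← ENNReal.ofReal_mul (Real.sqrt_nonneg _),
    ← ENNReal.ofReal_mul h0, ENNReal.ofReal_le_one] at h1
  have h2 := pow_le_one₀ (n := 2) (by positivity) h1
  calc _ = (M.maxWidth * κ * (√(2 * M.overlap) * (M.clementConst ΓD).toReal)) ^ 2 := by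
        rw [mul_pow, mul_pow, mul_pow, Real.sq_sqrt (by positivity)]
        ring
    _ ≤ 1 := h2

theorem normOn_eq {F : Type*} [NormedAddCommGroup F] {S : Set (Pt d)} (hS : MeasurableSet S)
    {g : Pt d → F} (hg : MemLp g 2 (vol Ω)) :
    ENNReal.ofReal (Mesh.normOn Ω S g) = eLpNorm g 2 ((vol Ω).restrict S) := by
  rw [Mesh.normOn, Measure.restrict_restrict hS, ENNReal.ofReal_toReal]
  rw [← Measure.restrict_restrict hS]
  exact (hg.restrict S).eLpNorm_ne_top

/-- The remainder is small on each element. -/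
theorem Mesh.eLpNorm_remainder_le (hd : 1 ≤ d) (hC : M.clementConst ΓD ≠ ⊤) {w : V Ω ΓD}
    (hw : w ∈ M.remainder ΓD) {T : Finset (Pt d)} (hT : T ∈ M.elements) :
    ENNReal.ofReal (width T)⁻¹ * eLpNorm (V.val w) 2 ((vol Ω).restrict (simplex T)) ≤
      M.clementConst ΓD * eLpNorm (V.gradient w) 2 ((vol Ω).restrict (M.patch T)) := by
  have h1 := M.isClementBound_clementConst hC w T hT
  have h2 : Mesh.normOn Ω (simplex T) (fun x => V.val w x - M.clement w x) =
      Mesh.normOn Ω (simplex T) (V.val w) := by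
    unfold Mesh.normOn
    rw [← Measure.restrict_restrict (measurableSet_simplex T)]
    congr 1
    apply eLpNorm_congr_ae
    filter_upwards [ae_restrict_of_ae hw] with x hx
    rw [hx, Pi.zero_apply, sub_zero]
  rw [h2] at h1
  have h3 := (le_add_of_nonneg_right ENNReal.toReal_nonneg).trans h1
  have h4 := ENNReal.ofReal_le_ofReal h3
  rwa [ENNReal.ofReal_mul (inv_nonneg.2 (width_pos M hd hT).le), ENNReal.ofReal_mul
    (NNReal.coe_nonneg _), ENNReal.ofReal_coe_nnreal, ENNReal.coe_toNNReal hC,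
    normOn_eq (measurableSet_simplex T) (Lp.memLp _),
    normOn_eq (measurableSet_patch M T) (Lp.memLp _)] at h4

/-- The remainder, divided by the mesh width, is bounded by its gradient. -/
theorem Mesh.eLpNorm_inv_widthFun_mul_le (hd : 1 ≤ d) (hC : M.clementConst ΓD ≠ ⊤)
    {w : V Ω ΓD} (hw : w ∈ M.remainder ΓD) :
    eLpNorm (fun x => ((M.widthFun x)⁻¹ : ℂ) * V.val w x) 2 (vol Ω) ≤
      ENNReal.ofReal √M.overlap * M.clementConst ΓD * eLpNorm (V.gradient w) 2 (vol Ω) := by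
  rw [← ENNReal.pow_le_pow_left_iff (n := 2) (by norm_num), mul_pow, mul_pow, eLpNorm_two_sq, eLpNorm_two_sq,
    ← M.sum_lintegral, ← ENNReal.ofReal_pow (Real.sqrt_nonneg _), Real.sq_sqrt (Nat.cast_nonneg _),
    ENNReal.ofReal_natCast]
  calc ∑ T ∈ M.elements, ∫⁻ x in simplex T, ‖((M.widthFun x)⁻¹ : ℂ) * V.val w x‖ₑ ^ 2 ∂(vol Ω)
      ≤ ∑ T ∈ M.elements, M.clementConst ΓD ^ 2 *
          ∫⁻ x in M.patch T, ‖V.gradient w x‖ₑ ^ 2 ∂(vol Ω) := by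
        refine Finset.sum_le_sum fun T hT => ?_
        have h := pow_le_pow_left' (M.eLpNorm_remainder_le hd hC hw hT) 2
        rw [mul_pow, mul_pow, eLpNorm_two_sq, eLpNorm_two_sq] at h
        refine le_trans (le_of_eq ?_) h
        rw [← lintegral_const_mul' _ _ (by finiteness)]
        apply lintegral_congr_ae
        filter_upwards [M.ae_widthFun_eq hT] with x hx
        rw [hx, enorm_mul, mul_pow, ← Complex.ofReal_inv, ← ofReal_norm (_ : ℂ),
          Complex.norm_real, Real.norm_of_nonneg (inv_nonneg.2 (width_pos M hd hT).le)]
    _ ≤ M.clementConst ΓD ^ 2 * (M.overlap * ∫⁻ x in Ω, ‖V.gradient w x‖ₑ ^ 2) := by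
        rw [← Finset.mul_sum]
        gcongr
        exact M.sum_lintegral_patch_le _
    _ = _ := by ring

theorem Mesh.ae_widthFun_mem : ∀ᵐ x ∂(vol Ω), ∃ T ∈ M.elements, M.widthFun x = width T := by
  filter_upwards [M.ae_exists_mem_interior] with x ⟨T, hT, hx⟩
  exact ⟨T, hT, M.widthFun_eq hT hx⟩

/-- Bound ‖w‖ by H_max ‖H⁻¹w‖ ≤ H_max √C_ol C_I ‖∇w‖, square, and use (H_max κ)² · 2 C_ol C_I² ≤ 1.
The factor 2 of the resolution condition is the origin of the ½. -/
theorem Mesh.remainder_coercive (hd : 1 ≤ d) (hΩ : IsLipschitzDomain Ω) {κ : ℝ} (hκ : 0 < κ)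
    (hres : M.ResolutionCondition ΓD κ) {w : V Ω ΓD} (hw : w ∈ M.remainder ΓD) :
    κ ^ 2 * ‖V.val w‖ ^ 2 ≤ 1 / 2 * ‖V.gradient w‖ ^ 2 := by
  have hC := M.clementConst_ne_top hd hΩ hκ hres
  have h1 := M.eLpNorm_inv_widthFun_mul_le hd hC hw
  have h2 : ‖V.val w‖ ≤ M.maxWidth *
      (√M.overlap * (M.clementConst ΓD).toReal * ‖V.gradient w‖) := by
    obtain ⟨T, hT⟩ := M.elements_nonempty hΩ
    have h0 : 0 ≤ M.maxWidth := (width_pos M hd hT).le.trans (M.width_le_maxWidth hT)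
    rw [← ENNReal.ofReal_le_ofReal_iff (by positivity), ENNReal.ofReal_mul h0,
      ENNReal.ofReal_mul (by positivity), ENNReal.ofReal_mul (by positivity),
      ENNReal.ofReal_toReal hC, ofReal_norm, ofReal_norm, Lp.enorm_def, Lp.enorm_def]
    refine le_trans ?_ (mul_le_mul_right h1 _)
    refine eLpNorm_le_mul_eLpNorm_of_ae_le_mul (c := M.maxWidth) ?_ 2
    filter_upwards [M.ae_widthFun_mem] with x ⟨T, hT, hx⟩
    have hT0 := width_pos M hd hT
    rw [hx, norm_mul, ← Complex.ofReal_inv, Complex.norm_real,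
      Real.norm_of_nonneg (inv_nonneg.2 hT0.le), ← mul_assoc]
    refine le_mul_of_one_le_left (norm_nonneg _) ?_
    rw [← div_eq_mul_inv, one_le_div hT0]
    exact M.width_le_maxWidth hT
  have h3 := M.resolution hd hΩ hκ hres
  have h4 := pow_le_pow_left₀ (norm_nonneg _) h2 2
  rw [mul_pow, mul_pow, mul_pow, Real.sq_sqrt (Nat.cast_nonneg _)] at h4
  have h5 := mul_le_mul_of_nonneg_left h4 (sq_nonneg κ)
  have h6 := mul_le_mul_of_nonneg_right h3 (sq_nonneg ‖V.gradient w‖)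
  nlinarith

/-- Cauchy–Schwarz after inserting the local mesh width, (f, w) = (H f, H⁻¹ w). -/
theorem Mesh.enorm_pairing_le (hd : 1 ≤ d) (hC : M.clementConst ΓD ≠ ⊤)
    {w : V Ω ΓD} (hw : w ∈ M.remainder ΓD) (f : L2 Ω) :
    ‖pairing f (V.val w)‖ₑ ≤ eLpNorm (fun x => (M.widthFun x : ℂ) * f x) 2 (vol Ω) *
      (ENNReal.ofReal √M.overlap * M.clementConst ΓD * eLpNorm (V.gradient w) 2 (vol Ω)) := by
  have hm : Measurable fun x => (M.widthFun x : ℂ) :=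
    Complex.measurable_ofReal.comp M.measurable_widthFun
  have h1 : pairing f (V.val w) = ∫ x in Ω, ((M.widthFun x : ℂ) * f x) *
      conj (((M.widthFun x)⁻¹ : ℂ) * V.val w x) := by
    rw [pairing, L2.inner_def]
    apply integral_congr_ae
    filter_upwards [M.ae_widthFun_mem] with x ⟨T, hT, hx⟩
    have h0 : ((width T : ℝ) : ℂ) ≠ 0 := by exact_mod_cast (width_pos M hd hT).ne'
    rw [hx, RCLike.inner_apply, map_mul, map_inv₀, Complex.conj_ofReal]
    field_simp
  rw [h1]
  refine (enorm_integral_mul_le ?_ ?_).trans ?_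
  · exact hm.aestronglyMeasurable.mul (Lp.aestronglyMeasurable f)
  · exact Complex.continuous_conj.comp_aestronglyMeasurable
      (hm.inv.aestronglyMeasurable.mul (Lp.aestronglyMeasurable _))
  · gcongr
    refine le_trans (le_of_eq (eLpNorm_congr_norm_ae (Eventually.of_forall fun x => ?_)))
      (M.eLpNorm_inv_widthFun_mul_le hd hC hw)
    exact RCLike.norm_conj _

/-- Coercivity gives ‖w‖_V² ≤ 3 |(f, w)|; the pairing is bounded by ‖Hf‖ √C_ol C_I ‖∇w‖ with ‖∇w‖ ≤
‖w‖_V, and one factor ‖w‖_V cancels. -/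
theorem Mesh.normV_le (hd : 1 ≤ d) (hΩ : IsLipschitzDomain Ω) {κ : ℝ} (hκ : 0 < κ)
    (hres : M.ResolutionCondition ΓD κ) {w : V Ω ΓD} (hw : w ∈ M.remainder ΓD) (f : L2 Ω)
    (h : form ΓR κ w w = pairing f (V.val w)) :
    ENNReal.ofReal (normV κ w) ≤ 3 * ENNReal.ofReal √M.overlap * M.clementConst ΓD *
      eLpNorm (fun x => (M.widthFun x : ℂ) * f x) 2 (vol Ω) := by
  have hC := M.clementConst_ne_top hd hΩ hκ hres
  have h1 := form_coercive (ΓR := ΓR) (M.remainder_coercive hd hΩ hκ hres hw)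
  have hN : normV κ w ^ 2 = κ ^ 2 * ‖V.val w‖ ^ 2 + ‖V.gradient w‖ ^ 2 :=
    Real.sq_sqrt (by positivity)
  have hN0 : 0 ≤ normV κ w := Real.sqrt_nonneg _
  rcases hN0.eq_or_lt with h0 | h0
  · rw [← h0]; simp
  have h2 : normV κ w ^ 2 ≤ 3 * ‖pairing f (V.val w)‖ := by
    have := Complex.re_le_norm (form ΓR κ w w)
    rw [← h, hN]
    linarith
  have h3 : ‖V.gradient w‖ ≤ normV κ w := by
    refine Real.le_sqrt_of_sq_le ?_
    have : 0 ≤ κ ^ 2 * ‖V.val w‖ ^ 2 := by positivity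
    linarith
  have h4 : eLpNorm (V.gradient w) 2 (vol Ω) ≤ ENNReal.ofReal (normV κ w) := by
    rw [← Lp.enorm_def, ← ofReal_norm]
    exact ENNReal.ofReal_le_ofReal h3
  have h5 : ENNReal.ofReal (normV κ w) ≠ 0 := (ENNReal.ofReal_pos.2 h0).ne'
  rw [← ENNReal.mul_le_mul_iff_left h5 (by finiteness), ← sq, ← ENNReal.ofReal_pow hN0]
  refine (ENNReal.ofReal_le_ofReal h2).trans ?_
  rw [ENNReal.ofReal_mul (by norm_num), ofReal_norm]
  calc ENNReal.ofReal 3 * ‖pairing f (V.val w)‖ₑ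
      ≤ 3 * (eLpNorm (fun x => (M.widthFun x : ℂ) * f x) 2 (vol Ω) *
      (ENNReal.ofReal √M.overlap * M.clementConst ΓD * ENNReal.ofReal (normV κ w))) := by
        rw [ENNReal.ofReal_ofNat]
        gcongr
        refine (M.enorm_pairing_le hd hC hw f).trans ?_
        gcongr
    _ = _ := by ring

end MeshEstimates

/-! ### Unique continuation for the Helmholtz equation -/

section UniqueContinuation

variable {d : ℕ}

/-- The derivative in the direction `e`. -/
noncomputable def dirDeriv (e : Pt d) (f : Pt d → ℝ) (x : Pt d) : ℝ := fderiv ℝ f x e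

/-- The Laplacian. -/
noncomputable def laplace (f : Pt d → ℝ) (x : Pt d) : ℝ :=
  ∑ j, dirDeriv (EuclideanSpace.single j 1) (dirDeriv (EuclideanSpace.single j 1) f) x

/-- Smooth functions with compact support. -/
def IsTest (f : Pt d → ℝ) : Prop := ContDiff ℝ ∞ f ∧ HasCompactSupport f

/-- `u` solves the Helmholtz equation on `B` in the sense of distributions. -/
def SolvesHelmholtz (κ : ℝ) (u : Pt d → ℝ) (B : Set (Pt d)) : Prop :=
  ∀ φ : Pt d → ℝ, IsTest φ → tsupport φ ⊆ B → ∫ x, u x * (laplace φ x + κ ^ 2 * φ x) = 0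

theorem SolvesHelmholtz.mono {κ : ℝ} {u : Pt d → ℝ} {A B : Set (Pt d)}
    (h : SolvesHelmholtz κ u B) (hAB : A ⊆ B) : SolvesHelmholtz κ u A :=
  fun φ hφ hs => h φ hφ (hs.trans hAB)

theorem contDiff_dirDeriv {f : Pt d → ℝ} (hf : ContDiff ℝ ∞ f) (e : Pt d) :
    ContDiff ℝ ∞ (dirDeriv e f) :=
  (hf.fderiv_right (m := ∞) (by simp)).clm_apply contDiff_const

theorem IsTest.dirDeriv {f : Pt d → ℝ} (hf : IsTest f) (e : Pt d) : IsTest (dirDeriv e f) :=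
  ⟨contDiff_dirDeriv hf.1 e, hf.2.fderiv_apply ℝ e⟩

theorem tsupport_dirDeriv_subset (f : Pt d → ℝ) (e : Pt d) :
    tsupport (dirDeriv e f) ⊆ tsupport f := tsupport_fderiv_apply_subset ℝ e

theorem IsTest.iterate {f : Pt d → ℝ} (hf : IsTest f) (e : Pt d) (k : ℕ) :
    IsTest ((Helmholtz.dirDeriv e)^[k] f) ∧ tsupport ((Helmholtz.dirDeriv e)^[k] f) ⊆ tsupport f := by
  induction k with
  | zero => exact ⟨hf, subset_rfl⟩
  | succ k ih =>
    rw [Function.iterate_succ_apply']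
    exact ⟨ih.1.dirDeriv e, (tsupport_dirDeriv_subset _ e).trans ih.2⟩

/-- Convolution of real functions. -/
noncomputable def conv (f g : Pt d → ℝ) : Pt d → ℝ :=
  convolution f g (ContinuousLinearMap.lsmul ℝ ℝ) volume

theorem conv_apply (f g : Pt d → ℝ) (x : Pt d) : conv f g x = ∫ t, f t * g (x - t) := rfl

theorem conv_apply' (f g : Pt d → ℝ) (x : Pt d) : conv f g x = ∫ t, f (x - t) * g t :=
  convolution_lsmul_swap

theorem conv_comm (f g : Pt d → ℝ) : conv f g = conv g f := by
  ext x
  rw [conv_apply, conv_apply']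
  simp only [mul_comm]

theorem dirDeriv_conv {f g : Pt d → ℝ} (hf : LocallyIntegrable f) (hg : IsTest g) (e : Pt d) :
    dirDeriv e (conv f g) = conv f (dirDeriv e g) := by
  ext x
  have h := hg.2.hasFDerivAt_convolution_right (ContinuousLinearMap.lsmul ℝ ℝ) hf
    (hg.1.of_le (by norm_num)) x
  rw [dirDeriv, conv, h.fderiv, convolution_precompR_apply _ hf (hg.2.fderiv ℝ)
    (hg.1.continuous_fderiv (by simp))]
  rfl

theorem contDiff_conv {f g : Pt d → ℝ} (hf : LocallyIntegrable f) (hg : IsTest g) :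
    ContDiff ℝ ∞ (conv f g) :=
  hg.2.contDiff_convolution_right (n := ⊤) _ hf hg.1

theorem IsTest.conv {f g : Pt d → ℝ} (hf : LocallyIntegrable f) (hfc : HasCompactSupport f)
    (hg : IsTest g) : IsTest (conv f g) :=
  ⟨contDiff_conv hf hg, hfc.convolution _ hg.2⟩

theorem iterate_dirDeriv_conv {f g : Pt d → ℝ} (hf : LocallyIntegrable f) (hg : IsTest g)
    (e : Pt d) (k : ℕ) : (dirDeriv e)^[k] (conv f g) = Helmholtz.conv f ((dirDeriv e)^[k] g) := by
  induction k with
  | zero => rfl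
  | succ k ih =>
    rw [Function.iterate_succ_apply', ih, dirDeriv_conv hf (hg.iterate e k).1,
      Function.iterate_succ_apply']

theorem IsTest.integrable_mul {f g : Pt d → ℝ} (hf : LocallyIntegrable f) (hg : IsTest g)
    (x : Pt d) : Integrable fun t => f t * g (x - t) :=
  hg.2.convolutionExists_right (ContinuousLinearMap.lsmul ℝ ℝ) hf hg.1.continuous x

theorem IsTest.integrable {f : Pt d → ℝ} (hf : IsTest f) : Integrable f :=
  hf.1.continuous.integrable_of_hasCompactSupport hf.2

theorem dirDeriv_comp_sub {f : Pt d → ℝ} (hf : ContDiff ℝ ∞ f) (x e y : Pt d) :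
    dirDeriv e (fun y => f (x - y)) y = -dirDeriv e f (x - y) := by
  have h1 : HasFDerivAt (fun y => x - y) (-ContinuousLinearMap.id ℝ (Pt d)) y :=
    (hasFDerivAt_id y).const_sub x
  have h2 := (hf.differentiable (by simp) (x - y)).hasFDerivAt.comp y h1
  rw [dirDeriv, show (fun y => f (x - y)) = f ∘ fun y => x - y from rfl, h2.fderiv]
  simp [dirDeriv]

theorem laplace_comp_sub {f : Pt d → ℝ} (hf : ContDiff ℝ ∞ f) (x y : Pt d) :
    laplace (fun y => f (x - y)) y = laplace f (x - y) := by
  refine Finset.sum_congr rfl fun j _ => ?_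
  set e : Pt d := EuclideanSpace.single j 1
  have h : dirDeriv e (fun y => f (x - y)) = fun y => (fun z => -dirDeriv e f z) (x - y) :=
    funext fun y => dirDeriv_comp_sub hf x e y
  rw [h, dirDeriv_comp_sub (contDiff_dirDeriv hf e).neg]
  rw [dirDeriv, fderiv_fun_neg, neg_apply, neg_neg]
  rfl

/-- Mollifications of distributional solutions are classical solutions. -/
theorem SolvesHelmholtz.laplace_conv {κ : ℝ} {u : Pt d → ℝ} {B : Set (Pt d)}
    (h : SolvesHelmholtz κ u B) (hu : LocallyIntegrable u) {ρ : Pt d → ℝ} (hρ : IsTest ρ)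
    {x : Pt d} (hx : ∀ y, x - y ∈ tsupport ρ → y ∈ B) :
    laplace (conv u ρ) x = -(κ ^ 2 * conv u ρ x) := by
  -- The weak equation is tested with the reflected kernel centred at x, which `hx` places inside B.
  have ht : IsTest fun y => ρ (x - y) :=
    ⟨hρ.1.comp (contDiff_const.sub contDiff_id), hρ.2.comp_homeomorph (Homeomorph.subLeft x)⟩
  have hs : tsupport (fun y => ρ (x - y)) ⊆ B := fun y hy =>
    hx y (tsupport_comp_subset_preimage ρ (f := fun y => x - y) (by fun_prop) hy)
  have h0 := h _ ht hs
  simp only [laplace_comp_sub hρ.1] at h0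
  have h1 : laplace (conv u ρ) x = ∑ j, ∫ t, u t * dirDeriv (EuclideanSpace.single j 1)
      (dirDeriv (EuclideanSpace.single j 1) ρ) (x - t) := by
    refine Finset.sum_congr rfl fun j _ => ?_
    rw [dirDeriv_conv hu hρ, dirDeriv_conv hu (hρ.dirDeriv _)]
    rfl
  rw [h1, conv_apply, ← integral_finsetSum _ fun j _ =>
    ((hρ.dirDeriv _).dirDeriv _).integrable_mul hu x, ← integral_const_mul, eq_neg_iff_add_eq_zero,
    ← integral_add (integrable_finsetSum _ fun j _ =>
    ((hρ.dirDeriv _).dirDeriv _).integrable_mul hu x) ((hρ.integrable_mul hu x).const_mul _), ← h0]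
  congr 1
  ext t
  rw [← Finset.mul_sum, laplace]
  ring

theorem integral_dirDeriv {f : Pt d → ℝ} (hf : IsTest f) (e : Pt d) :
    ∫ x, dirDeriv e f x = 0 := by
  have h := integral_mul_fderiv_eq_neg_fderiv_mul_of_integrable (μ := volume)
    (f := fun _ : Pt d => (1 : ℝ)) (g := f) (v := e) (by simp)
    (by simp only [one_mul]; exact (hf.dirDeriv e).integrable) (by simpa using hf.integrable)
    (fun _ _ => differentiableAt_const _) (fun x _ => hf.1.differentiable (by simp) x)
  have h' : ∫ x, fderiv ℝ f x e = 0 := by simpa using h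
  exact h'

theorem dirDeriv_mul {f g : Pt d → ℝ} (hf : ContDiff ℝ ∞ f) (hg : ContDiff ℝ ∞ g) (e x : Pt d) :
    dirDeriv e (fun x => f x * g x) x = dirDeriv e f x * g x + f x * dirDeriv e g x := by
  rw [dirDeriv, fderiv_fun_mul (hf.differentiable (by simp) x) (hg.differentiable (by simp) x)]
  simp only [add_apply, smul_apply, smul_eq_mul, dirDeriv]
  ring

theorem IsTest.mul {f g : Pt d → ℝ} (hf : IsTest f) (hg : ContDiff ℝ ∞ g) :
    IsTest fun x => f x * g x := ⟨hf.1.mul hg, hf.2.mul_right⟩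

/-- Caccioppoli's inequality. -/
theorem caccioppoli {κ : ℝ} {v ζ : Pt d → ℝ} (hv : ContDiff ℝ ∞ v) (hζ : IsTest ζ)
    (h : ∀ x, ζ x ≠ 0 → laplace v x = -(κ ^ 2 * v x)) :
    ∑ j : Fin d, ∫ x, ζ x ^ 2 * dirDeriv (EuclideanSpace.single j 1) v x ^ 2 ≤
      2 * κ ^ 2 * (∫ x, ζ x ^ 2 * v x ^ 2) +
        4 * ∑ j : Fin d, ∫ x, dirDeriv (EuclideanSpace.single j 1) ζ x ^ 2 * v x ^ 2 := by
  let e : Fin d → Pt d := fun j => EuclideanSpace.single j 1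
  have hF : ∀ j, IsTest fun x => (ζ x * (ζ x * (v x * dirDeriv (e j) v x))) := fun j =>
    hζ.mul (hζ.1.mul (hv.mul (contDiff_dirDeriv hv _)))
  have i1 : ∀ j, Integrable fun x => ζ x ^ 2 * dirDeriv (e j) v x ^ 2 := fun j => by
    simp only [sq (ζ _), mul_assoc]
    exact (hζ.mul (hζ.1.mul ((contDiff_dirDeriv hv _).pow 2))).integrable
  have i2 : Integrable fun x => ζ x ^ 2 * v x ^ 2 := by
    simp only [sq (ζ _), mul_assoc]
    exact (hζ.mul (hζ.1.mul (hv.pow 2))).integrable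
  have i3 : ∀ j, Integrable fun x => dirDeriv (e j) ζ x ^ 2 * v x ^ 2 := fun j => by
    simp only [sq (dirDeriv _ ζ _), mul_assoc]
    exact ((hζ.dirDeriv _).mul ((contDiff_dirDeriv hζ.1 _).mul (hv.pow 2))).integrable
  -- The divergence of the compactly supported field ζ² v ∇v has integral zero.
  have hint : (0 : ℝ) = ∫ x, ∑ j, dirDeriv (e j) (fun x => ζ x * (ζ x * (v x * dirDeriv (e j) v x))) x := by
    rw [integral_finsetSum _ fun j _ => ((hF j).dirDeriv _).integrable]
    simp [integral_dirDeriv (hF _)]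
  have key : ∀ x, ∑ j, ζ x ^ 2 * dirDeriv (e j) v x ^ 2 ≤
      2 * κ ^ 2 * (ζ x ^ 2 * v x ^ 2) + 4 * (∑ j, dirDeriv (e j) ζ x ^ 2 * v x ^ 2) +
      2 * ∑ j, dirDeriv (e j) (fun x => ζ x * (ζ x * (v x * dirDeriv (e j) v x))) x := by
    intro x
    have e1 : ∀ j, dirDeriv (e j) (fun x => ζ x * (ζ x * (v x * dirDeriv (e j) v x))) x =
        2 * ζ x * dirDeriv (e j) ζ x * v x * dirDeriv (e j) v x + ζ x ^ 2 * dirDeriv (e j) v x ^ 2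
          + ζ x ^ 2 * v x * dirDeriv (e j) (dirDeriv (e j) v) x := fun j => by
      have c1 := contDiff_dirDeriv hv (e j)
      rw [dirDeriv_mul hζ.1 (hζ.1.mul (hv.mul c1)), dirDeriv_mul hζ.1 (hv.mul c1),
        dirDeriv_mul hv c1]
      ring
    have e2 : ∑ j, ζ x ^ 2 * v x * dirDeriv (e j) (dirDeriv (e j) v) x =
        -(κ ^ 2 * (ζ x ^ 2 * v x ^ 2)) := by
      rw [← Finset.mul_sum]
      change ζ x ^ 2 * v x * laplace v x = _
      by_cases hz : ζ x = 0
      · simp [hz]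
      · rw [h x hz]; ring
    simp only [e1]
    rw [Finset.sum_add_distrib, e2, Finset.sum_add_distrib, mul_add, mul_add]
    -- The sum consists of the squares (ζ ∂_j v + 2 v ∂_j ζ)², which is where the constant 4 comes
    -- from.
    have e3 : 0 ≤ 2 * (∑ j, 2 * ζ x * dirDeriv (e j) ζ x * v x * dirDeriv (e j) v x)
        + (∑ j, ζ x ^ 2 * dirDeriv (e j) v x ^ 2)
        + 4 * ∑ j, dirDeriv (e j) ζ x ^ 2 * v x ^ 2 := by
      rw [Finset.mul_sum, Finset.mul_sum, ← Finset.sum_add_distrib, ← Finset.sum_add_distrib]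
      refine Finset.sum_nonneg fun j _ => ?_
      nlinarith [sq_nonneg (ζ x * dirDeriv (e j) v x + 2 * (dirDeriv (e j) ζ x * v x))]
    linarith
  have j1 := integrable_finsetSum Finset.univ fun j _ => i1 j
  have j3 := (integrable_finsetSum Finset.univ fun j _ => i3 j).const_mul 4
  have j4 := (integrable_finsetSum Finset.univ
    fun j _ => ((hF j).dirDeriv (e j)).integrable).const_mul 2
  have h2 := integral_mono j1 (((i2.const_mul (2 * κ ^ 2)).add j3).add j4) key
  rw [integral_add' ((i2.const_mul (2 * κ ^ 2)).add j3) j4,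
    integral_add' (i2.const_mul (2 * κ ^ 2)) j3, integral_const_mul, integral_const_mul,
    integral_const_mul, ← hint, mul_zero, add_zero, integral_finsetSum _ fun j _ => i1 j,
    integral_finsetSum _ fun j _ => i3 j] at h2
  exact h2

theorem dirDeriv_eq_sum (v : Pt d → ℝ) (e x : Pt d) :
    dirDeriv e v x = ∑ j, e j * dirDeriv (EuclideanSpace.single j 1) v x := by
  have h : e = ∑ j, e j • (EuclideanSpace.single j (1 : ℝ) : Pt d) := by
    ext i; simp [Finset.sum_apply, Pi.single_apply]
  conv_lhs => rw [dirDeriv, h]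
  simp [dirDeriv]

theorem sq_dirDeriv_le {e : Pt d} (he : ‖e‖ = 1) (v : Pt d → ℝ) (x : Pt d) :
    dirDeriv e v x ^ 2 ≤ ∑ j, dirDeriv (EuclideanSpace.single j 1) v x ^ 2 := by
  rw [dirDeriv_eq_sum]
  refine (Finset.sum_mul_sq_le_sq_mul_sq _ _ _).trans_eq ?_
  have h : ∑ j, e j ^ 2 = 1 := by
    rw [← EuclideanSpace.real_norm_sq_eq, he, one_pow]
  rw [h, one_mul]

/-- Weighted bounds for all directional derivatives of a solution. -/
theorem integral_iterate_le {κ L : ℝ} {η : Pt d → ℝ} (hη : IsTest η) (hη1 : ∀ x, |η x| ≤ 1)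
    (hL : ∀ x j, dirDeriv (EuclideanSpace.single j 1) η x ^ 2 ≤ L) {e : Pt d} (he : ‖e‖ = 1)
    {v : Pt d → ℝ} (hv : ∀ k, ContDiff ℝ ∞ ((dirDeriv e)^[k] v))
    (h : ∀ k x, η x ≠ 0 → laplace ((dirDeriv e)^[k] v) x = -(κ ^ 2 * (dirDeriv e)^[k] v x))
    (k : ℕ) : ∫ x, (η x ^ (k + 1) * (dirDeriv e)^[k] v x) ^ 2 ≤
      (2 * κ ^ 2 + 4 * d * L) ^ k * ((k + 1).factorial : ℝ) ^ 2 * ∫ x, (η x * v x) ^ 2 := by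
  have hpow : ∀ m : ℕ, IsTest fun x => η x ^ (m + 1) := fun m => by
    simp only [pow_succ']
    exact hη.mul (hη.1.pow m)
  have hint : ∀ k, Integrable fun x => (η x ^ (k + 1) * (dirDeriv e)^[k] v x) ^ 2 := fun k => by
    simp only [sq]
    exact (((hpow k).mul (hv k)).mul ((hpow k).mul (hv k)).1).integrable
  induction k with
  | zero => simp
  | succ k ih =>
    set w := (dirDeriv e)^[k] v with hw
    have hwc : ContDiff ℝ ∞ w := hv k
    -- Each differentiation spends one power of the fixed cut-off: Caccioppoli with ζ = η^(k+2)
    -- bounds the next derivative by integrals with weight η^(k+1), so no nested balls are needed.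
    have hc := caccioppoli (κ := κ) hwc (hpow (k + 1)) fun x hx =>
      h k x fun h0 => hx (by simp [h0])
    have h1 : ∫ x, (η x ^ (k + 1 + 1) * (dirDeriv e)^[k + 1] v x) ^ 2 ≤
        ∑ j : Fin d, ∫ x, (η x ^ (k + 1 + 1)) ^ 2 * dirDeriv (EuclideanSpace.single j 1) w x ^ 2 := by
      have i1 : ∀ j : Fin d, Integrable fun x => (η x ^ (k + 1 + 1)) ^ 2 *
          dirDeriv (EuclideanSpace.single j 1) w x ^ 2 := fun j => by
        simp only [sq (η _ ^ _), mul_assoc]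
        exact ((hpow _).mul ((hpow _).1.mul ((contDiff_dirDeriv hwc _).pow 2))).integrable
      rw [← integral_finsetSum _ fun j _ => i1 j]
      refine integral_mono (hint _) (integrable_finsetSum _ fun j _ => i1 j) fun x => ?_
      simp only [mul_pow, Function.iterate_succ_apply', ← Finset.mul_sum]
      exact mul_le_mul_of_nonneg_left (sq_dirDeriv_le he _ _) (sq_nonneg _)
    have hη2 : ∀ x, η x ^ 2 ≤ 1 := fun x => (sq_le_one_iff_abs_le_one _).2 (hη1 x)
    have h2 : ∫ x, (η x ^ (k + 1 + 1)) ^ 2 * w x ^ 2 ≤ ∫ x, (η x ^ (k + 1) * w x) ^ 2 := by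
      refine integral_mono ?_ (hint k) fun x => ?_
      · simp only [sq (η _ ^ _), mul_assoc]
        exact ((hpow _).mul ((hpow _).1.mul (hwc.pow 2))).integrable
      · change _ ≤ (η x ^ (k + 1) * w x) ^ 2
        calc (η x ^ (k + 1 + 1)) ^ 2 * w x ^ 2 = η x ^ 2 * (η x ^ (k + 1) * w x) ^ 2 := by ring
          _ ≤ 1 * (η x ^ (k + 1) * w x) ^ 2 :=
            mul_le_mul_of_nonneg_right (hη2 x) (sq_nonneg _)
          _ = _ := one_mul _
    -- Differentiating η^(k+2) produces the factor k + 2; these factors accumulate to the factorial.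
    have h3 : ∀ j : Fin d, ∫ x, dirDeriv (EuclideanSpace.single j 1) (fun x => η x ^ (k + 1 + 1)) x ^ 2
        * w x ^ 2 ≤ (k + 2) ^ 2 * L * ∫ x, (η x ^ (k + 1) * w x) ^ 2 := fun j => by
      rw [← integral_const_mul]
      refine integral_mono ?_ ((hint k).const_mul _) fun x => ?_
      · simp only [sq (dirDeriv _ _ _), mul_assoc]
        exact (((hpow _).dirDeriv _).mul (((hpow _).dirDeriv _).1.mul (hwc.pow 2))).integrable
      · change _ ≤ (k + 2) ^ 2 * L * (η x ^ (k + 1) * w x) ^ 2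
        have e1 : dirDeriv (EuclideanSpace.single j 1) (fun x => η x ^ (k + 1 + 1)) x =
            (k + 2) * η x ^ (k + 1) * dirDeriv (EuclideanSpace.single j 1) η x := by
          rw [dirDeriv, fderiv_fun_pow (k + 1 + 1) (hη.1.differentiable (by simp) x)]
          simp only [smul_apply, smul_eq_mul, dirDeriv, Nat.add_sub_cancel, nsmul_eq_mul]
          push_cast
          ring
        simp only [e1]
        calc _ = (k + 2) ^ 2 * (dirDeriv (EuclideanSpace.single j 1) η x ^ 2 *
              (η x ^ (k + 1) * w x) ^ 2) := by ring
          _ ≤ (k + 2) ^ 2 * (L * (η x ^ (k + 1) * w x) ^ 2) := by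
            gcongr
            exact hL x j
          _ = _ := by ring
    have h4 := Finset.sum_le_sum fun j (_ : j ∈ Finset.univ) => h3 j
    rw [Finset.sum_const, Finset.card_univ, Fintype.card_fin, nsmul_eq_mul] at h4
    have hI : 0 ≤ ∫ x, (η x ^ (k + 1) * w x) ^ 2 := integral_nonneg fun x => sq_nonneg _
    -- Nonnegativity of L can be read off from `hL` only if there is an index j.
    by_cases hd0 : d = 0
    · subst hd0
      have : e = 0 := Subsingleton.elim _ _
      rw [this, norm_zero] at he
      exact absurd he (by norm_num)
    have hL0 : 0 ≤ L := (sq_nonneg _).trans (hL 0 ⟨0, Nat.pos_of_ne_zero hd0⟩)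
    calc _ ≤ 2 * κ ^ 2 * (∫ x, (η x ^ (k + 1) * w x) ^ 2) +
          4 * (d * ((k + 2) ^ 2 * L * ∫ x, (η x ^ (k + 1) * w x) ^ 2)) :=
          h1.trans (hc.trans (add_le_add (mul_le_mul_of_nonneg_left h2 (by positivity))
            (mul_le_mul_of_nonneg_left h4 (by norm_num))))
      _ ≤ (2 * κ ^ 2 + 4 * d * L) * (k + 2) ^ 2 * ∫ x, (η x ^ (k + 1) * w x) ^ 2 := by
          have h5 : (1 : ℝ) ≤ (k + 2) ^ 2 := by
            have : (0 : ℝ) ≤ k := Nat.cast_nonneg k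
            nlinarith
          have h6 := mul_le_mul_of_nonneg_left h5
            (show 0 ≤ 2 * κ ^ 2 * (∫ x, (η x ^ (k + 1) * w x) ^ 2) by positivity)
          linarith
      _ ≤ (2 * κ ^ 2 + 4 * d * L) * (k + 2) ^ 2 * ((2 * κ ^ 2 + 4 * d * L) ^ k *
            ((k + 1).factorial : ℝ) ^ 2 * ∫ x, (η x * v x) ^ 2) := by gcongr
      _ = _ := by
          rw [Nat.factorial_succ (k + 1)]
          push_cast
          ring

/-- A function all of whose derivatives vanish at `0` is bounded by its Taylor remainder. -/
theorem abs_le_taylor {g : ℕ → ℝ → ℝ} (hg : ∀ k t, HasDerivAt (g k) (g (k + 1) t) t)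
    (h0 : ∀ k, g k 0 = 0) {δ M : ℝ} (n : ℕ) :
    ∀ k, (∀ t ∈ Set.Icc 0 δ, |g (k + n) t| ≤ M) →
      ∀ t ∈ Set.Icc 0 δ, |g k t| ≤ M * t ^ n / n.factorial := by
  induction n with
  | zero => intro k h t ht; simpa using h t ht
  | succ n ih =>
    intro k h t ht
    have h1 := ih (k + 1) (by rwa [add_assoc, add_comm 1 n])
    refine image_norm_le_of_norm_deriv_right_le_deriv_boundary (f := g k) (f' := g (k + 1))
      (B := fun t => M * t ^ (n + 1) / (n + 1).factorial) (B' := fun t => M * t ^ n / n.factorial)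
      (fun t _ => (hg k t).continuousAt.continuousWithinAt)
      (fun t _ => (hg k t).hasDerivWithinAt) (by simp [h0]) (fun t => ?_)
      (fun t ht => h1 t ⟨ht.1, ht.2.le⟩) ht
    have h2 := ((hasDerivAt_pow (n + 1) t).const_mul M).div_const ((n + 1).factorial : ℝ)
    refine h2.congr_deriv ?_
    have : (n.factorial : ℝ) ≠ 0 := by positivity
    rw [Nat.factorial_succ, Nat.add_sub_cancel]
    push_cast
    field_simp

end UniqueContinuation

/-! ### Unique continuation on balls and on connected open sets -/

section UniqueContinuationBalls

variable {d : ℕ}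

theorem isTest_normed (φ : ContDiffBump (0 : Pt d)) : IsTest (φ.normed volume) :=
  ⟨φ.contDiff_normed, φ.hasCompactSupport_normed⟩

theorem norm_le_of_mem_tsupport_normed {φ : ContDiffBump (0 : Pt d)} {x : Pt d}
    (hx : x ∈ tsupport (φ.normed volume)) : ‖x‖ ≤ φ.rOut := by
  rw [φ.tsupport_normed_eq] at hx
  simpa using hx

theorem tendsto_factorial_ratio : Tendsto (fun n : ℕ => ((n : ℝ) + 1) * (1 / 2) ^ n) atTop (𝓝 0) := by
  have h1 := tendsto_self_mul_const_pow_of_lt_one (r := (1 / 2 : ℝ)) (by norm_num) (by norm_num)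
  have h2 := tendsto_pow_atTop_nhds_zero_of_lt_one (r := (1 / 2 : ℝ)) (by norm_num) (by norm_num)
  simpa [add_mul] using h1.add h2

/-- Twice mollified solutions that vanish near `x₀` vanish along rays of a definite length. -/
theorem conv_conv_eq_zero {κ L q δ ε : ℝ} {η u ρ χ : Pt d → ℝ} {x₀ e : Pt d} {B : Set (Pt d)}
    (hu : LocallyIntegrable u) (huc : HasCompactSupport u) (hsol : SolvesHelmholtz κ u B)
    (hη : IsTest η) (hη1 : ∀ x, |η x| ≤ 1)
    (hL : ∀ x j, dirDeriv (EuclideanSpace.single j 1) η x ^ 2 ≤ L) (hq : 0 < q)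
    (hqL : 2 * κ ^ 2 + 4 * d * L ≤ q ^ 2) (hδ : q * δ ≤ 1 / 2)
    (hρ : IsTest ρ) (hρε : ∀ x ∈ tsupport ρ, ‖x‖ < ε)
    (hχ : IsTest χ) (hχε : ∀ x ∈ tsupport χ, ‖x‖ < ε)
    (hηB : ∀ x y, η x ≠ 0 → ‖x - y‖ < ε → y ∈ B)
    (hηx : ∀ y, ‖y - x₀‖ < δ + ε → η y = 1)
    (h0 : ∀ᵐ x, ‖x - x₀‖ < 2 * ε → u x = 0) (he : ‖e‖ = 1) {t : ℝ} (ht : t ∈ Set.Icc 0 δ) :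
    conv χ (conv u ρ) (x₀ + t • e) = 0 := by
  -- The first mollification makes u smooth, so all derivatives along e solve the equation
  -- classically; the second, by χ, will turn their L² bounds into pointwise ones.
  set v : ℕ → Pt d → ℝ := fun k => (dirDeriv e)^[k] (conv u ρ) with hv
  have hvk : ∀ k, v k = conv u ((dirDeriv e)^[k] ρ) := fun k => iterate_dirDeriv_conv hu hρ e k
  have hvt : ∀ k, IsTest (v k) := fun k => by
    rw [hvk]; exact IsTest.conv hu huc (hρ.iterate e k).1
  have hχl : LocallyIntegrable χ := hχ.integrable.locallyIntegrable
  have hv0 : ∀ k x, ‖x - x₀‖ < ε → v k x = 0 := fun k x hx => by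
    rw [hvk, conv_apply]
    refine integral_eq_zero_of_ae ?_
    filter_upwards [h0] with y hy
    by_cases hz : (dirDeriv e)^[k] ρ (x - y) = 0
    · rw [hz, mul_zero]; rfl
    · have h1 := hρε _ ((hρ.iterate e k).2 (subset_tsupport _ hz))
      rw [hy, zero_mul]
      · rfl
      · have : y - x₀ = (x - x₀) - (x - y) := by abel
        rw [this]
        refine (norm_sub_le _ _).trans_lt ?_
        linarith
  set g : ℕ → ℝ → ℝ := fun k t => conv χ (v k) (x₀ + t • e) with hgdef
  have hg : ∀ k t, HasDerivAt (g k) (g (k + 1) t) t := fun k t => by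
    have h1 : HasDerivAt (fun t : ℝ => x₀ + t • e) e t := by
      simpa using ((hasDerivAt_id t).smul_const e).const_add x₀
    have h2 := ((contDiff_conv hχl (hvt k)).differentiable (by simp)
      (x₀ + t • e)).hasFDerivAt.comp_hasDerivAt t h1
    have h3 : g (k + 1) t = fderiv ℝ (conv χ (v k)) (x₀ + t • e) e := by
      change conv χ (v (k + 1)) (x₀ + t • e) = dirDeriv e (conv χ (v k)) (x₀ + t • e)
      rw [dirDeriv_conv hχl (hvt k)]
      simp only [hv, Function.iterate_succ_apply']
    rw [h3]
    exact h2
  have hg0 : ∀ k, g k 0 = 0 := fun k => by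
    simp only [hgdef, zero_smul, add_zero, conv_apply]
    refine integral_eq_zero_of_ae (Eventually.of_forall fun y => ?_)
    by_cases hz : χ y = 0
    · simp [hz]
    · have h1 := hχε _ (subset_tsupport _ hz)
      simp [hv0 k (x₀ - y) (by simpa using h1)]
  set A : ℝ := ∫ x, (η x * v 0 x) ^ 2
  set X : ℝ := ∫ x, χ x ^ 2
  have hA : 0 ≤ A := integral_nonneg fun x => sq_nonneg _
  have hX : 0 ≤ X := integral_nonneg fun x => sq_nonneg _
  have hpow : ∀ k : ℕ, IsTest fun x => η x ^ (k + 1) := fun k => by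
    simp only [pow_succ']
    exact hη.mul (hη.1.pow k)
  have hest : ∀ k, ∫ x, (η x ^ (k + 1) * v k x) ^ 2 ≤
      (q ^ k * ((k + 1).factorial : ℝ)) ^ 2 * A := fun k => by
    refine (integral_iterate_le (κ := κ) hη hη1 hL he (fun k => (hvt k).1) (fun k x hx => ?_) k).trans ?_
    · rw [show (dirDeriv e)^[k] (conv u ρ) = conv u ((dirDeriv e)^[k] ρ) from hvk k]
      exact hsol.laplace_conv hu (hρ.iterate e k).1 fun y hy =>
        hηB x y hx (hρε _ ((hρ.iterate e k).2 hy))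
    · rw [mul_pow, ← pow_mul, mul_comm k 2, pow_mul]
      have hL0 : 0 ≤ 2 * κ ^ 2 + 4 * d * L := by
        rcases Nat.eq_zero_or_pos d with h | h
        · have : (d : ℝ) = 0 := by exact_mod_cast h
          rw [this]; nlinarith [sq_nonneg κ]
        · have : 0 ≤ L := (sq_nonneg _).trans (hL 0 ⟨0, h⟩)
          positivity
      gcongr
      exact le_rfl
  -- On the support of y ↦ χ(x₀ + t e − y) the cut-off η equals 1, so its power may be inserted for
  -- free. Young's inequality weighted by b, the growth factor in `hest`, then bounds the
  -- convolution linearly in b.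
  have hbound : ∀ k, ∀ t ∈ Set.Icc 0 δ, |g k t| ≤
      (q ^ k * ((k + 1).factorial : ℝ)) * ((X + A) / 2) := fun k t ht => by
    set b : ℝ := q ^ k * ((k + 1).factorial : ℝ)
    have hb : 0 < b := by positivity
    have i1 : Integrable fun y => χ (x₀ + t • e - y) ^ 2 := by
      have : Integrable fun y => χ y ^ 2 := by
        simp only [sq]; exact (hχ.mul hχ.1).integrable
      exact this.comp_sub_left (x₀ + t • e)
    have i2 : Integrable fun x => (η x ^ (k + 1) * v k x) ^ 2 := by
      simp only [sq]
      exact (((hpow k).mul (hvt k).1).mul ((hpow k).mul (hvt k).1).1).integrable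
    have h1 : ‖conv χ (v k) (x₀ + t • e)‖ ≤ ∫ y, (b / 2 * χ (x₀ + t • e - y) ^ 2 +
        b⁻¹ / 2 * (η y ^ (k + 1) * v k y) ^ 2) := by
      rw [conv_apply']
      refine norm_integral_le_of_norm_le ((i1.const_mul _).add (i2.const_mul _))
        (Eventually.of_forall fun y => ?_)
      by_cases hz : χ (x₀ + t • e - y) = 0
      · rw [hz, zero_mul, norm_zero]; positivity
      · have h2 := hχε _ (subset_tsupport _ hz)
        have h3 : η y = 1 := hηx y (by
          have : y - x₀ = t • e - (x₀ + t • e - y) := by abel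
          rw [this]
          refine (norm_sub_le _ _).trans_lt ?_
          rw [norm_smul, he, mul_one, Real.norm_of_nonneg ht.1]
          linarith [ht.2])
        rw [h3, one_pow, one_mul, Real.norm_eq_abs, abs_mul]
        have h4 : b⁻¹ / 2 * v k y ^ 2 = (b⁻¹ * |v k y|) ^ 2 * b / 2 := by
          rw [mul_pow, sq_abs]; field_simp
        have h5 : |v k y| = b * (b⁻¹ * |v k y|) := by field_simp
        rw [h4, h5, ← sq_abs (χ _)]
        set a := b⁻¹ * |v k y|
        have h6 : b⁻¹ * (b * a) = a := by field_simp
        simp only [h6]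
        nlinarith [mul_nonneg hb.le (sq_nonneg (|χ (x₀ + t • e - y)| - a))]
    refine h1.trans ?_
    rw [integral_add (i1.const_mul _) (i2.const_mul _), integral_const_mul, integral_const_mul,
      integral_sub_left_eq_self (fun y => χ y ^ 2) volume (x₀ + t • e)]
    have h2 := mul_le_mul_of_nonneg_left (hest k) (show 0 ≤ b⁻¹ / 2 by positivity)
    have h3 : b⁻¹ / 2 * (b ^ 2 * A) = b / 2 * A := by field_simp
    rw [h3] at h2
    calc _ ≤ b / 2 * X + b / 2 * A := by gcongr
      _ = _ := by ring
  -- All derivatives vanish at t = 0. The factor q^n (n+1)! t^n / n! in the Taylor remainder equals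
  -- (n+1)(qt)^n ≤ (n+1)/2^n, which tends to 0.
  have hfin : ∀ n : ℕ, |g 0 t| ≤ ((n : ℝ) + 1) * (1 / 2) ^ n * ((X + A) / 2) := fun n => by
    refine (abs_le_taylor hg hg0 n 0 (by simpa using hbound n) t ht).trans ?_
    have h1 : (q * t) ^ n ≤ (1 / 2) ^ n := pow_le_pow_left₀ (mul_nonneg hq.le ht.1)
      ((mul_le_mul_of_nonneg_left ht.2 hq.le).trans hδ) n
    have h2 : q ^ n * ((n + 1).factorial : ℝ) * ((X + A) / 2) * t ^ n / n.factorial =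
        (n + 1) * (q * t) ^ n * ((X + A) / 2) := by
      rw [Nat.factorial_succ, mul_pow]
      have : (n.factorial : ℝ) ≠ 0 := by positivity
      push_cast
      field_simp
    rw [h2]
    gcongr
  have hlim := tendsto_factorial_ratio.mul_const ((X + A) / 2)
  rw [zero_mul] at hlim
  exact abs_nonpos_iff.1 (ge_of_tendsto' hlim hfin)

/-- Unique continuation from the centre of a ball to a smaller ball of definite size. -/
theorem exists_uniqueContinuation_radius (d : ℕ) (κ : ℝ) {R : ℝ} (hR : 0 < R) :
    ∃ δ > 0, ∀ (u : Pt d → ℝ) (x₀ : Pt d), LocallyIntegrable u → HasCompactSupport u →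
      SolvesHelmholtz κ u (Metric.ball x₀ R) →
      (∃ r > 0, ∀ᵐ x, x ∈ Metric.ball x₀ r → u x = 0) →
      ∀ᵐ x, x ∈ Metric.ball x₀ δ → u x = 0 := by
  let η₀ : ContDiffBump (0 : Pt d) := ⟨R / 2, 3 * R / 4, by positivity, by linarith⟩
  have hη₀ : IsTest (η₀ : Pt d → ℝ) := ⟨η₀.contDiff, η₀.hasCompactSupport⟩
  obtain ⟨C, hC⟩ := (hη₀.2.fderiv ℝ).exists_bound_of_continuous
    (hη₀.1.continuous_fderiv (by simp))
  set q : ℝ := √(2 * κ ^ 2 + 4 * d * C ^ 2) + 1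
  have hq : 0 < q := by positivity
  have hqL : 2 * κ ^ 2 + 4 * d * C ^ 2 ≤ q ^ 2 := by
    have h := Real.sq_sqrt (show 0 ≤ 2 * κ ^ 2 + 4 * d * C ^ 2 by positivity)
    nlinarith [Real.sqrt_nonneg (2 * κ ^ 2 + 4 * d * C ^ 2)]
  -- This radius depends on d, κ and R only, not on u or on the size r of the initial ball. That
  -- uniformity makes the continuation argument work.
  set δ := min (R / 4) (1 / (2 * q))
  have hδ0 : 0 < δ := by positivity
  have hδ : q * δ ≤ 1 / 2 := (mul_le_mul_of_nonneg_left (min_le_right _ _) hq.le).trans_eq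
    (by field_simp)
  have hδR : δ ≤ R / 4 := min_le_left _ _
  refine ⟨δ, hδ0, fun u x₀ hu huc hsol ⟨r, hr, h0⟩ => ?_⟩
  -- Mollification radius. From ε ≤ R/8 come 3R/4 + ε < R, which keeps the kernels inside the ball,
  -- and δ + ε ≤ R/2, where η = 1. From 2ε ≤ r the two mollifications together see only zeros of u
  -- near x₀.
  set ε := min (R / 8) (r / 2)
  have hε : 0 < ε := by positivity
  have hεR : ε ≤ R / 8 := min_le_left _ _
  have hεr : ε ≤ r / 2 := min_le_right _ _
  set η : Pt d → ℝ := fun x => η₀ (x - x₀)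
  have hη : IsTest η := ⟨hη₀.1.comp (contDiff_id.sub contDiff_const),
    hη₀.2.comp_homeomorph (Homeomorph.subRight x₀)⟩
  have hL : ∀ x j, dirDeriv (EuclideanSpace.single j 1) η x ^ 2 ≤ C ^ 2 := fun x j => by
    have h1 : dirDeriv (EuclideanSpace.single j 1) η x =
        fderiv ℝ η₀ (x - x₀) (EuclideanSpace.single j 1) := by
      rw [dirDeriv, fderiv_comp_sub]
    rw [h1, ← sq_abs, ← Real.norm_eq_abs]
    refine pow_le_pow_left₀ (norm_nonneg _) ?_ 2
    refine ((fderiv ℝ η₀ (x - x₀)).le_opNorm _).trans ?_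
    simpa using hC (x - x₀)
  have hev : ∀ᶠ n in atTop, (shrinkingBump d n).rOut < ε :=
    (tendsto_shrinkingBump (d := d)).eventually_lt_const hε
  have h0' : ∀ᵐ x, ‖x - x₀‖ < 2 * ε → u x = 0 := by
    filter_upwards [h0] with x hx hx'
    exact hx (by rw [Metric.mem_ball, dist_eq_norm]; linarith)
  have key : ∀ n, (shrinkingBump d n).rOut < ε → ∀ x ∈ Metric.ball x₀ δ,
      conv u ((shrinkingBump d n).normed volume) x = 0 := by
    intro n hn x hx
    have hρ := isTest_normed (shrinkingBump d n)
    have hcont := (contDiff_conv hu hρ).continuous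
    -- Only the twice mollified function is known to vanish; the outer mollification is removed
    -- first, by continuity of the inner one.
    refine tendsto_nhds_unique (ContDiffBump.convolution_tendsto_right_of_continuous
      (μ := volume) (tendsto_shrinkingBump (d := d)) hcont x) ?_
    refine tendsto_const_nhds.congr' ?_
    filter_upwards [hev] with m hm
    symm
    rw [Metric.mem_ball, dist_eq_norm] at hx
    have hray : ∀ e : Pt d, ‖e‖ = 1 → ∀ t ∈ Set.Icc 0 δ,
        conv ((shrinkingBump d m).normed volume) (conv u ((shrinkingBump d n).normed volume))
          (x₀ + t • e) = 0 := fun e he t ht =>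
      conv_conv_eq_zero (ε := ε) hu huc hsol hη
        (fun x => by rw [abs_of_nonneg η₀.nonneg]; exact η₀.le_one) hL hq hqL hδ hρ
        (fun x hx => (norm_le_of_mem_tsupport_normed hx).trans_lt hn) (isTest_normed _)
        (fun x hx => (norm_le_of_mem_tsupport_normed hx).trans_lt hm)
        (fun x y hx hy => by
          have h1 : x - x₀ ∈ Function.support η₀ := hx
          rw [η₀.support_eq, Metric.mem_ball, dist_zero_right] at h1
          have h2 : ‖x - x₀‖ < 3 * R / 4 := h1
          rw [Metric.mem_ball, dist_eq_norm]
          have : y - x₀ = (x - x₀) - (x - y) := by abel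
          rw [this]
          refine (norm_sub_le _ _).trans_lt ?_
          linarith)
        (fun y hy => η₀.one_of_mem_closedBall (by
          rw [Metric.mem_closedBall, dist_zero_right]
          change ‖y - x₀‖ ≤ R / 2
          linarith)) h0' he ht
    -- The centre determines no direction: any unit vector with t = 0 will do. In dimension 0 there
    -- is none, but there the assumed ball is the whole space.
    by_cases hxx : x = x₀
    · rcases Nat.eq_zero_or_pos d with hd | hd
      · subst hd
        refine integral_eq_zero_of_ae (Eventually.of_forall fun y => ?_)
        have h2 : conv u ((shrinkingBump 0 n).normed volume) (x - y) = 0 := by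
          refine integral_eq_zero_of_ae ?_
          filter_upwards [h0] with z hz
          rw [hz (by rw [Subsingleton.elim z x₀]; exact Metric.mem_ball_self hr)]
          simp
        simp [h2]
      · have := hray (EuclideanSpace.single ⟨0, hd⟩ 1) (by simp) 0 ⟨le_rfl, hδ0.le⟩
        rw [zero_smul, add_zero] at this
        rw [hxx]
        exact this
    · have hne : ‖x - x₀‖ ≠ 0 := norm_ne_zero_iff.2 (sub_ne_zero.2 hxx)
      have := hray (‖x - x₀‖⁻¹ • (x - x₀)) (by rw [norm_smul, norm_inv, norm_norm,
        inv_mul_cancel₀ hne]) ‖x - x₀‖ ⟨norm_nonneg _, hx.le⟩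
      rwa [smul_smul, mul_inv_cancel₀ hne, one_smul, add_sub_cancel] at this
  -- The inner mollification is removed almost everywhere by Lebesgue differentiation; K = 2 is the
  -- ratio of outer to inner radius of the bumps.
  have hlim := ContDiffBump.ae_convolution_tendsto_right_of_locallyIntegrable (μ := volume)
    (φ := shrinkingBump d) (K := 2) (tendsto_shrinkingBump (d := d))
    (Eventually.of_forall fun n => by
      change 1 / ((n : ℝ) + 1) ≤ 2 * (1 / (2 * (n + 1)))
      exact le_of_eq (by field_simp)) hu
  filter_upwards [hlim] with x hx hxb
  refine tendsto_nhds_unique hx (tendsto_const_nhds.congr' ?_)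
  filter_upwards [hev] with n hn
  have := key n hn x hxb
  rw [conv_comm] at this
  exact this.symm

/-- Unique continuation on connected sets. -/
theorem ae_eq_zero_of_isPreconnected {κ : ℝ} {u : Pt d → ℝ} {U : Set (Pt d)}
    (hu : LocallyIntegrable u) (huc : HasCompactSupport u) (hU : IsOpen U) (hUc : IsPreconnected U)
    (hsol : SolvesHelmholtz κ u U) {x₀ : Pt d} (hx₀ : x₀ ∈ U) {r : ℝ} (hr : 0 < r)
    (h0 : ∀ᵐ x, x ∈ Metric.ball x₀ r → u x = 0) : ∀ᵐ x, x ∈ U → u x = 0 := by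
  set Z : Set (Pt d) := {x | ∃ r > 0, ∀ᵐ y, y ∈ Metric.ball x r → u y = 0}
  have hZo : IsOpen Z := by
    rw [Metric.isOpen_iff]
    rintro x ⟨s, hs, h⟩
    refine ⟨s, hs, fun y hy => ⟨s - dist y x, sub_pos.2 hy, ?_⟩⟩
    filter_upwards [h] with z hz hz'
    exact hz (Metric.ball_subset_ball' (by linarith) hz')
  have hsub : U ⊆ Z := by
    refine hUc.subset_of_closure_inter_subset hZo ⟨x₀, hx₀, r, hr, h0⟩ ?_
    rintro x ⟨hxZ, hxU⟩
    obtain ⟨R, hR, hRU⟩ := Metric.isOpen_iff.1 hU x hxU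
    -- One δ serves every centre within R/2 of x, so a point of Z closer than δ transmits the
    -- vanishing to a neighbourhood of x; thus Z is relatively closed in U.
    obtain ⟨δ, hδ, hδu⟩ := exists_uniqueContinuation_radius d κ (half_pos hR)
    obtain ⟨z, hz, hxz⟩ := Metric.mem_closure_iff.1 hxZ (min δ (R / 2)) (by positivity)
    have h1 : dist x z < δ := hxz.trans_le (min_le_left _ _)
    have h2 : dist x z < R / 2 := hxz.trans_le (min_le_right _ _)
    have h3 := hδu u z hu huc (hsol.mono (subset_trans
      (Metric.ball_subset_ball' (by rw [dist_comm]; linarith)) hRU)) hz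
    refine ⟨δ - dist x z, sub_pos.2 h1, ?_⟩
    filter_upwards [h3] with y hy hy'
    exact hy (Metric.ball_subset_ball' (by linarith) hy')
  have hnull : volume {x | x ∈ U ∧ u x ≠ 0} = 0 := by
    refine measure_null_of_locally_null _ fun x hx => ?_
    obtain ⟨s, hs, h⟩ := hsub hx.1
    refine ⟨Metric.ball x s ∩ {x | x ∈ U ∧ u x ≠ 0}, inter_mem (mem_nhdsWithin_of_mem_nhds
      (Metric.ball_mem_nhds x hs)) self_mem_nhdsWithin, ?_⟩
    refine measure_mono_null ?_ h
    exact fun y hy hy' => hy.2.2 (hy' hy.1)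
  rw [ae_iff]
  refine measure_mono_null (fun x hx => ?_) hnull
  simpa using hx

end UniqueContinuationBalls

/-! ### Functions with vanishing trace on a part of the boundary -/

section GraphGreen

variable {d : ℕ} {e : Pt d} {ψ : Pt d → ℝ} {K : ℝ≥0}

/-- The points above the graph, at height less than `δ`. -/
def stripSet (e : Pt d) (ψ : Pt d → ℝ) (δ : ℝ) : Set (Pt d) :=
  {x | ψ x < inner ℝ e x ∧ inner ℝ e x < ψ x + δ}

theorem isOpen_stripSet (hψ : LipschitzWith K ψ) (δ : ℝ) : IsOpen (stripSet e ψ δ) :=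
  (isOpen_lt hψ.continuous (by fun_prop)).inter
    (isOpen_lt (by fun_prop) (hψ.continuous.add continuous_const))

theorem lintegral_ray_stripSet (he : ‖e‖ = 1)
    (hinv : ∀ (x : Pt d) (t : ℝ), ψ (x + t • e) = ψ x) (F : Pt d → ℝ≥0∞) (δ : ℝ) {x : Pt d}
    (hx : x ∈ graphSet e ψ) :
    ∫⁻ t in Set.Ioi (0 : ℝ), (stripSet e ψ δ).indicator F (x + t • e) =
      ∫⁻ t in Set.Ioo (0 : ℝ) δ, F (x + t • e) := by
  rw [← lintegral_indicator measurableSet_Ioi, ← lintegral_indicator measurableSet_Ioo]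
  congr 1
  ext t
  have hx' : ψ x = inner ℝ e x := hx
  have h : x + t • e ∈ stripSet e ψ δ ↔ t ∈ Set.Ioo 0 δ := by
    simp [stripSet, hinv, inner_unit_add_smul he, hx']
  by_cases ht : t ∈ Set.Ioo 0 δ
  · rw [Set.indicator_of_mem (show t ∈ Set.Ioi 0 from ht.1), Set.indicator_of_mem (h.2 ht),
      Set.indicator_of_mem ht]
  · rw [Set.indicator_of_notMem (s := Set.Ioo 0 δ) ht]
    by_cases h0 : t ∈ Set.Ioi (0 : ℝ)
    · rw [Set.indicator_of_mem h0, Set.indicator_of_notMem (fun h' => ht (h.1 h'))]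
    · rw [Set.indicator_of_notMem h0]

theorem lintegral_epiSet_indicator_stripSet (hψ : LipschitzWith K ψ) (F : Pt d → ℝ≥0∞) (δ : ℝ) :
    ∫⁻ x in epiSet e ψ, (stripSet e ψ δ).indicator F x = ∫⁻ x in stripSet e ψ δ, F x := by
  rw [lintegral_indicator (isOpen_stripSet hψ δ).measurableSet,
    Measure.restrict_restrict (isOpen_stripSet hψ δ).measurableSet,
    Set.inter_eq_self_of_subset_left fun x hx => hx.1]

theorem enorm_le_add_lintegral_deriv {g g' : ℝ → ℝ} (hg : ∀ t, HasDerivAt g (g' t) t)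
    (hg' : Continuous g') {δ t : ℝ} (ht : t ∈ Set.Ioo 0 δ) :
    ‖g t‖ₑ ≤ ‖g 0‖ₑ + ∫⁻ s in Set.Ioo 0 δ, ‖g' s‖ₑ := by
  have h1 : g t = g 0 + ∫ s in Set.Ioc 0 t, g' s := by
    rw [← intervalIntegral.integral_of_le ht.1.le, intervalIntegral.integral_eq_sub_of_hasDerivAt
      (fun s _ => hg s) (hg'.intervalIntegrable _ _)]
    ring
  rw [h1]
  refine (enorm_add_le _ _).trans ?_
  gcongr
  refine (enorm_integral_le_lintegral_enorm _).trans (lintegral_mono_set fun s hs => ?_)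
  exact ⟨hs.1, hs.2.trans_lt ht.2⟩

/-- The integral over a thin strip above a graph is controlled by the values on the graph. -/
theorem lintegral_stripSet_le (hd : 1 ≤ d) (he : ‖e‖ = 1) (hψ : LipschitzWith K ψ)
    (hinv : ∀ (x : Pt d) (t : ℝ), ψ (x + t • e) = ψ x) {F : Pt d → ℝ} (hF : ContDiff ℝ ∞ F)
    (δ : ℝ) :
    ∫⁻ x in stripSet e ψ δ, ‖F x‖ₑ ≤ ENNReal.ofReal δ *
      ((∫⁻ x in graphSet e ψ, ‖F x‖ₑ ∂(Measure.euclideanHausdorffMeasure (d - 1))) +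
        ((1 + K : ℝ≥0) : ℝ≥0∞) ^ (d - 1) * ∫⁻ x in stripSet e ψ δ, ‖dirDeriv e F x‖ₑ) := by
  have hS := (isOpen_stripSet (e := e) hψ δ).measurableSet
  have hG := (isClosed_graphSet (e := e) hψ).measurableSet
  have m1 : Measurable fun x => ‖F x‖ₑ := hF.continuous.enorm.measurable
  have m2 : Measurable fun x => ‖dirDeriv e F x‖ₑ :=
    (contDiff_dirDeriv hF e).continuous.enorm.measurable
  rw [← lintegral_epiSet_indicator_stripSet hψ, ← lintegral_epiSet_indicator_stripSet hψ]
  refine (lintegral_epiSet_le hd he hψ hinv (m1.indicator hS)).trans ?_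
  have h1 : ∀ x ∈ graphSet e ψ, ∫⁻ t in Set.Ioi (0 : ℝ),
      (stripSet e ψ δ).indicator (fun x => ‖F x‖ₑ) (x + t • e) ≤
      ENNReal.ofReal δ * (‖F x‖ₑ + ∫⁻ t in Set.Ioi (0 : ℝ),
        (stripSet e ψ δ).indicator (fun x => ‖dirDeriv e F x‖ₑ) (x + t • e)) := by
    intro x hx
    rw [lintegral_ray_stripSet he hinv _ _ hx, lintegral_ray_stripSet he hinv _ _ hx]
    have h2 : ∀ t : ℝ, HasDerivAt (fun t : ℝ => F (x + t • e)) (dirDeriv e F (x + t • e)) t :=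
      fun t => by
        have h1 : HasDerivAt (fun t : ℝ => x + t • e) e t := by
          simpa using ((hasDerivAt_id t).smul_const e).const_add x
        exact (hF.differentiable (by simp) _).hasFDerivAt.comp_hasDerivAt t h1
    have h3 : Continuous fun t : ℝ => dirDeriv e F (x + t • e) :=
      (contDiff_dirDeriv hF e).continuous.comp (by fun_prop)
    calc _ ≤ ∫⁻ t in Set.Ioo (0 : ℝ) δ, (‖F x‖ₑ +
          ∫⁻ s in Set.Ioo (0 : ℝ) δ, ‖dirDeriv e F (x + s • e)‖ₑ) := by
          refine setLIntegral_mono' measurableSet_Ioo fun t ht => ?_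
          simpa using enorm_le_add_lintegral_deriv h2 h3 ht
      _ = _ := by simp [mul_comm]
  refine (setLIntegral_mono' hG h1).trans ?_
  rw [lintegral_const_mul' _ _ ENNReal.ofReal_ne_top, lintegral_add_left m1]
  gcongr
  exact lintegral_graphSet_le hd he hψ hinv (m2.indicator hS)

/-- A cut-off function: `0` below the graph, `1` from height `1 / (n + 1)` on. -/
noncomputable def graphCutoff (e : Pt d) (ψ : Pt d → ℝ) (n : ℕ) (x : Pt d) : ℝ :=
  max 0 (min 1 ((n + 1) * (inner ℝ e x - ψ x)))

theorem lipschitzWith_graphCutoff (he : ‖e‖ = 1) (hψ : LipschitzWith K ψ) (n : ℕ) :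
    LipschitzWith ((n + 1) * (1 + K)) (graphCutoff e ψ n) := by
  refine LipschitzWith.const_max (LipschitzWith.const_min ?_ 1) 0
  refine LipschitzWith.of_dist_le_mul fun x y => ?_
  rw [Real.dist_eq, ← mul_sub, abs_mul, abs_of_nonneg (by positivity)]
  push_cast
  rw [mul_assoc]
  refine mul_le_mul_of_nonneg_left ?_ (by positivity)
  have h1 : |inner ℝ e x - inner ℝ e y| ≤ dist x y := by
    rw [← inner_sub_right, dist_eq_norm]
    simpa [he] using abs_real_inner_le_norm e (x - y)
  have h2 := hψ.dist_le_mul x y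
  rw [Real.dist_eq] at h2
  calc |inner ℝ e x - ψ x - (inner ℝ e y - ψ y)|
      = |(inner ℝ e x - inner ℝ e y) - (ψ x - ψ y)| := by congr 1; ring
    _ ≤ |inner ℝ e x - inner ℝ e y| + |ψ x - ψ y| := abs_sub _ _
    _ ≤ _ := by linarith

/-- Off the strip the cut-off attains its global minimum 0 or maximum 1. At an extremum the
derivative along a line is 0 even without differentiability, by its default value. -/
theorem lineDeriv_graphCutoff_eq_zero {n : ℕ} {x : Pt d} (v : Pt d)
    (hx : x ∉ stripSet e ψ (1 / (n + 1))) : lineDeriv ℝ (graphCutoff e ψ n) x v = 0 := by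
  have hn : (0 : ℝ) < n + 1 := by positivity
  have h : graphCutoff e ψ n x = 0 ∨ graphCutoff e ψ n x = 1 := by
    simp only [stripSet, Set.mem_ofPred_eq, not_and_or, not_lt] at hx
    unfold graphCutoff
    rcases hx with hx | hx
    · left
      rw [max_eq_left]
      exact (min_le_right _ _).trans (mul_nonpos_of_nonneg_of_nonpos hn.le (by linarith))
    · right
      have : 1 ≤ ((n : ℝ) + 1) * (inner ℝ e x - ψ x) := by
        rw [← div_le_iff₀' hn]; linarith
      rw [min_eq_left this]
      simp
  rcases h with h | h
  · refine IsLocalMin.deriv_eq_zero (Eventually.of_forall fun t => ?_)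
    simp only [zero_smul, add_zero, h]
    exact le_max_left _ _
  · refine IsLocalMax.deriv_eq_zero (Eventually.of_forall fun t => ?_)
    simp only [zero_smul, add_zero, h]
    exact max_le zero_le_one (min_le_left _ _)

theorem graphCutoff_mem (n : ℕ) (x : Pt d) : graphCutoff e ψ n x ∈ Set.Icc (0 : ℝ) 1 :=
  ⟨le_max_left _ _, max_le zero_le_one (min_le_left _ _)⟩

theorem tendsto_graphCutoff (x : Pt d) :
    Tendsto (fun n => graphCutoff e ψ n x) atTop (𝓝 ((epiSet e ψ).indicator 1 x)) := by
  by_cases hx : x ∈ epiSet e ψ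
  · rw [Set.indicator_of_mem hx]
    have hx' : 0 < inner ℝ e x - ψ x := sub_pos.2 hx
    have h1 : Tendsto (fun n : ℕ => ((n : ℝ) + 1) * (inner ℝ e x - ψ x)) atTop atTop :=
      (tendsto_natCast_atTop_atTop.atTop_add tendsto_const_nhds).atTop_mul_const hx'
    refine tendsto_const_nhds.congr' ?_
    filter_upwards [h1.eventually_ge_atTop 1] with n hn
    rw [graphCutoff, min_eq_left hn]
    simp
  · rw [Set.indicator_of_notMem hx]
    refine tendsto_const_nhds.congr fun n => ?_
    have hx' : inner ℝ e x - ψ x ≤ 0 := sub_nonpos.2 (not_lt.1 hx)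
    rw [graphCutoff, max_eq_left]
    exact (min_le_right _ _).trans (mul_nonpos_of_nonneg_of_nonpos (by positivity) hx')

/-- Integrate by parts: the cut-off has slope at most (n+1)(1+K), supported on a strip of thickness
1/(n+1), and `lintegral_stripSet_le` supplies the compensating factor 1/(n+1). -/
theorem enorm_integral_graphCutoff_le (hd : 1 ≤ d) (he : ‖e‖ = 1) (hψ : LipschitzWith K ψ)
    (hinv : ∀ (x : Pt d) (t : ℝ), ψ (x + t • e) = ψ x) {F : Pt d → ℝ} (hF : IsTest F) (v : Pt d)
    (n : ℕ) :
    ‖∫ x, graphCutoff e ψ n x * dirDeriv v F x‖ₑ ≤ ((1 + K : ℝ≥0) : ℝ≥0∞) * ‖v‖ₑ *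
      ((∫⁻ x in graphSet e ψ, ‖F x‖ₑ ∂(Measure.euclideanHausdorffMeasure (d - 1))) +
        ((1 + K : ℝ≥0) : ℝ≥0∞) ^ (d - 1) *
          ∫⁻ x in stripSet e ψ (1 / (n + 1)), ‖dirDeriv e F x‖ₑ) := by
  obtain ⟨D, hD⟩ := (hF.1.of_le (m := 1) (by norm_num)).lipschitzWith_of_hasCompactSupport hF.2
    (by norm_num)
  have hL := lipschitzWith_graphCutoff he hψ n
  have h1 := hL.integral_lineDeriv_mul_eq (μ := volume) hD hF.2 v
  have h2 : ∫ x, lineDeriv ℝ F x (-v) * graphCutoff e ψ n x =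
      -∫ x, graphCutoff e ψ n x * dirDeriv v F x := by
    rw [← integral_neg]
    congr 1
    ext x
    rw [(hF.1.differentiable (by simp) x).lineDeriv_eq_fderiv, map_neg, dirDeriv]
    ring
  rw [h2] at h1
  have hS := (isOpen_stripSet (e := e) hψ (1 / (n + 1))).measurableSet
  rw [← enorm_neg, ← h1]
  calc ‖∫ x, lineDeriv ℝ (graphCutoff e ψ n) x v * F x‖ₑ
      ≤ ∫⁻ x, ‖lineDeriv ℝ (graphCutoff e ψ n) x v * F x‖ₑ := enorm_integral_le_lintegral_enorm _
    _ ≤ ∫⁻ x, (stripSet e ψ (1 / (n + 1))).indicator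
          (fun x => (((n + 1) * (1 + K) : ℝ≥0) : ℝ≥0∞) * ‖v‖ₑ * ‖F x‖ₑ) x := by
        refine lintegral_mono fun x => ?_
        by_cases hx : x ∈ stripSet e ψ (1 / (n + 1))
        · rw [Set.indicator_of_mem hx, enorm_mul]
          gcongr
          have h3 := norm_lineDeriv_le_of_lipschitz ℝ (x₀ := x) (v := v) hL
          have h4 := ENNReal.ofReal_le_ofReal h3
          rwa [ofReal_norm, ENNReal.ofReal_mul (NNReal.coe_nonneg _), ofReal_norm,
            ENNReal.ofReal_coe_nnreal] at h4
        · rw [lineDeriv_graphCutoff_eq_zero v hx]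
          simp
    _ = (((n + 1) * (1 + K) : ℝ≥0) : ℝ≥0∞) * ‖v‖ₑ *
          ∫⁻ x in stripSet e ψ (1 / (n + 1)), ‖F x‖ₑ := by
        rw [lintegral_indicator hS, lintegral_const_mul _ hF.1.continuous.enorm.measurable]
    _ ≤ _ := by
        refine (mul_le_mul_right (lintegral_stripSet_le hd he hψ hinv hF.1 _) _).trans_eq ?_
        rw [← mul_assoc]
        congr 1
        have h5 : ENNReal.ofReal (1 / ((n : ℝ) + 1)) = ((n + 1 : ℝ≥0) : ℝ≥0∞)⁻¹ := by
          rw [one_div, ENNReal.ofReal_inv_of_pos (by positivity)]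
          congr 1
          rw [← ENNReal.ofReal_coe_nnreal]
          push_cast
          rfl
        have h6 : ((n + 1 : ℝ≥0) : ℝ≥0∞) * ((n + 1 : ℝ≥0) : ℝ≥0∞)⁻¹ = 1 :=
          ENNReal.mul_inv_cancel (by positivity) ENNReal.coe_ne_top
        rw [h5, ENNReal.coe_mul]
        calc _ = ((1 + K : ℝ≥0) : ℝ≥0∞) * ‖v‖ₑ *
              (((n + 1 : ℝ≥0) : ℝ≥0∞) * ((n + 1 : ℝ≥0) : ℝ≥0∞)⁻¹) := by ring
          _ = _ := by rw [h6, mul_one]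

/-- The integral of a derivative over the region above a graph is controlled by the values on the
graph. -/
theorem enorm_integral_epiSet_dirDeriv_le (hd : 1 ≤ d) (he : ‖e‖ = 1) (hψ : LipschitzWith K ψ)
    (hinv : ∀ (x : Pt d) (t : ℝ), ψ (x + t • e) = ψ x) {F : Pt d → ℝ} (hF : IsTest F)
    (v : Pt d) :
    ‖∫ x in epiSet e ψ, dirDeriv v F x‖ₑ ≤ ((1 + K : ℝ≥0) : ℝ≥0∞) * ‖v‖ₑ *
      ∫⁻ x in graphSet e ψ, ‖F x‖ₑ ∂(Measure.euclideanHausdorffMeasure (d - 1)) := by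
  have hE := (isOpen_epiSet (e := e) hψ).measurableSet
  have t1 : Tendsto (fun n => ∫ x, graphCutoff e ψ n x * dirDeriv v F x) atTop
      (𝓝 (∫ x in epiSet e ψ, dirDeriv v F x)) := by
    rw [← integral_indicator hE]
    refine tendsto_integral_of_dominated_convergence (fun x => ‖dirDeriv v F x‖) (fun n => ?_)
      (hF.dirDeriv v).integrable.norm (fun n => Eventually.of_forall fun x => ?_)
      (Eventually.of_forall fun x => ?_)
    · exact ((lipschitzWith_graphCutoff he hψ n).continuous.mul
        (contDiff_dirDeriv hF.1 v).continuous).aestronglyMeasurable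
    · rw [norm_mul, Real.norm_of_nonneg (graphCutoff_mem n x).1]
      exact mul_le_of_le_one_left (norm_nonneg _) (graphCutoff_mem n x).2
    · have h := (tendsto_graphCutoff (e := e) (ψ := ψ) x).mul_const (dirDeriv v F x)
      by_cases hx : x ∈ epiSet e ψ <;> simpa [hx] using h
  -- The strips shrink to the empty set, so only the integral over the graph survives in the limit.
  have t2 : Tendsto (fun n : ℕ => ∫⁻ x in stripSet e ψ (1 / (n + 1)), ‖dirDeriv e F x‖ₑ) atTop
      (𝓝 0) := by
    have hi := (hF.dirDeriv e).integrable
    have h0 : (0 : ℝ≥0∞) = ∫⁻ _x : Pt d, 0 := by simp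
    refine Tendsto.congr (fun n => lintegral_indicator (isOpen_stripSet hψ _).measurableSet _) ?_
    rw [h0]
    refine tendsto_lintegral_of_dominated_convergence (fun x => ‖dirDeriv e F x‖ₑ) (fun n => ?_)
      (fun n => Eventually.of_forall fun x => ?_) hi.2.ne (Eventually.of_forall fun x => ?_)
    · exact (contDiff_dirDeriv hF.1 e).continuous.enorm.measurable.indicator
        (isOpen_stripSet hψ _).measurableSet
    · exact Set.indicator_le_self _ _ _
    · have h1 : Tendsto (fun n : ℕ => 1 / ((n : ℝ) + 1)) atTop (𝓝 0) :=
        tendsto_one_div_add_atTop_nhds_zero_nat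
      refine tendsto_const_nhds.congr' ?_
      by_cases hx : ψ x < inner ℝ e x
      · filter_upwards [h1.eventually_lt_const (sub_pos.2 hx)] with n hn
        rw [Set.indicator_of_notMem]
        rintro ⟨-, h⟩
        linarith
      · exact Eventually.of_forall fun n => (Set.indicator_of_notMem (fun h => hx h.1) _).symm
  have t3 := ENNReal.Tendsto.const_mul (a := ((1 + K : ℝ≥0) : ℝ≥0∞) * ‖v‖ₑ)
    ((tendsto_const_nhds (x := ∫⁻ x in graphSet e ψ, ‖F x‖ₑ
      ∂(Measure.euclideanHausdorffMeasure (d - 1)))).add (ENNReal.Tendsto.const_mul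
      (a := ((1 + K : ℝ≥0) : ℝ≥0∞) ^ (d - 1)) t2 (Or.inr (by finiteness)))) (Or.inr (by finiteness))
  rw [mul_zero, add_zero] at t3
  exact le_of_tendsto_of_tendsto' t1.enorm t3
    fun n => enorm_integral_graphCutoff_le hd he hψ hinv hF v n

end GraphGreen

/-! ### Extension by zero and uniqueness for the Helmholtz problem -/

section ZeroTrace

variable {d : ℕ} {Ω ΓD ΓN ΓR : Set (Pt d)} {κ : ℝ}

theorem pderiv_clm_comp (L : ℂ →L[ℝ] ℝ) {F : Pt d → ℂ} (hF : ContDiff ℝ ∞ F) (j : Fin d)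
    (x : Pt d) :
    dirDeriv (EuclideanSpace.single j 1) (fun x => L (F x)) x = L (pderiv F j x) := by
  have h := L.hasFDerivAt.comp x (hF.differentiable (by simp) x).hasFDerivAt
  rw [dirDeriv, show (fun x => L (F x)) = L ∘ F from rfl, h.fderiv]
  rfl

theorem enorm_le_re_add_im (z : ℂ) : ‖z‖ₑ ≤ ‖z.re‖ₑ + ‖z.im‖ₑ := by
  rw [← ofReal_norm, ← ofReal_norm, ← ofReal_norm, ← ENNReal.ofReal_add (norm_nonneg _)
    (norm_nonneg _)]
  exact ENNReal.ofReal_le_ofReal (Complex.norm_le_abs_re_add_abs_im z)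

/-- Real and imaginary parts are estimated separately, hence the factor 2. -/
theorem enorm_integral_epiSet_pderiv_le (hd : 1 ≤ d) {e : Pt d} {ψ : Pt d → ℝ} {K : ℝ≥0}
    (he : ‖e‖ = 1) (hψ : LipschitzWith K ψ) (hinv : ∀ (x : Pt d) (t : ℝ), ψ (x + t • e) = ψ x)
    {F : Pt d → ℂ} (hF : ContDiff ℝ ∞ F) (hc : HasCompactSupport F) (j : Fin d) :
    ‖∫ x in epiSet e ψ, pderiv F j x‖ₑ ≤ 2 * (((1 + K : ℝ≥0) : ℝ≥0∞) *
      ∫⁻ x in graphSet e ψ, ‖F x‖ₑ ∂(Measure.euclideanHausdorffMeasure (d - 1))) := by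
  have hi : Integrable (pderiv F j) (volume.restrict (epiSet e ψ)) :=
    ((contDiff_pderiv hF j).integrable_of_hasCompactSupport
      (hasCompactSupport_pderiv hc j)).integrableOn
  have key : ∀ L : ℂ →L[ℝ] ℝ, (∀ z, ‖L z‖ₑ ≤ ‖z‖ₑ) → ‖L (∫ x in epiSet e ψ, pderiv F j x)‖ₑ ≤
      ((1 + K : ℝ≥0) : ℝ≥0∞) *
        ∫⁻ x in graphSet e ψ, ‖F x‖ₑ ∂(Measure.euclideanHausdorffMeasure (d - 1)) := by
    intro L hL
    have h1 := enorm_integral_epiSet_dirDeriv_le hd he hψ hinv (F := fun x => L (F x))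
      ⟨L.contDiff.comp hF, hc.comp_left (map_zero L)⟩ (EuclideanSpace.single j 1)
    simp only [pderiv_clm_comp L hF j] at h1
    rw [L.integral_comp_comm hi] at h1
    refine h1.trans ?_
    have h2 : ‖(EuclideanSpace.single j (1 : ℝ) : Pt d)‖ = 1 := by simp
    rw [← ofReal_norm (EuclideanSpace.single j (1 : ℝ)), h2, ENNReal.ofReal_one, mul_one]
    gcongr with x
    exact hL _
  rw [two_mul]
  refine (enorm_le_re_add_im _).trans (add_le_add (key Complex.reCLM fun z => ?_)
    (key Complex.imCLM fun z => ?_))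
  · rw [← ofReal_norm, ← ofReal_norm]
    exact ENNReal.ofReal_le_ofReal (Complex.abs_re_le_norm z)
  · rw [← ofReal_norm, ← ofReal_norm]
    exact ENNReal.ofReal_le_ofReal (Complex.abs_im_le_norm z)

theorem pderiv_mul {φ ψ : Pt d → ℂ} (hφ : ContDiff ℝ ∞ φ) (hψ : ContDiff ℝ ∞ ψ) (j : Fin d)
    (x : Pt d) : pderiv (fun x => φ x * ψ x) j x = pderiv φ j x * ψ x + φ x * pderiv ψ j x := by
  rw [pderiv, fderiv_fun_mul (hφ.differentiable (by simp) x) (hψ.differentiable (by simp) x)]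
  simp only [add_apply, smul_apply, smul_eq_mul, pderiv]
  ring

/-- A Sobolev function can be extended by zero across a piece of the boundary on which its trace
vanishes. -/
theorem integral_mul_pderiv_of_trace_eq_zero (hd : 1 ≤ d) {e x₀ : Pt d} {ψ : Pt d → ℝ} {K : ℝ≥0}
    {r : ℝ} (he : ‖e‖ = 1) (hψ : LipschitzWith K ψ)
    (hinv : ∀ (x : Pt d) (t : ℝ), ψ (x + t • e) = ψ x) (hΩ : MeasurableSet Ω)
    (hgr : ∀ x ∈ Metric.ball x₀ r, x ∈ Ω ↔ ψ x < inner ℝ e x) {Γ : Set (Pt d)}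
    (hΓ : MeasurableSet Γ) (hΓs : Γ ⊆ frontier Ω)
    (hΓg : ∀ x ∈ Metric.ball x₀ r, x ∈ graphSet e ψ → x ∈ Γ) {u : L2 Ω} {G : L2vec Ω}
    {g : L2bdry Ω} (htr : IsTrace Ω u G g) (hg : ∀ᵐ x ∂(surf Ω).restrict Γ, g x = 0)
    {χ : Pt d → ℂ} (hχ : ContDiff ℝ ∞ χ) (hχc : HasCompactSupport χ)
    (hχs : tsupport χ ⊆ Metric.ball x₀ r) (hχ2 : MemLp χ 2 (surf Ω)) (j : Fin d) :
    ∫ x in Ω, u x * pderiv χ j x = -∫ x in Ω, G x j * χ x := by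
  obtain ⟨φ, h0, h1, h2, h3⟩ := htr
  have m1 : MemLp χ 2 (vol Ω) := memLp_of_contDiff hχ.continuous hχc
  have m2 : MemLp (pderiv χ j) 2 (vol Ω) :=
    memLp_of_contDiff (contDiff_pderiv hχ j) (hasCompactSupport_pderiv hχc j)
  have mφ : ∀ n, MemLp (φ n) 2 (vol Ω) := fun n => memLp_of_contDiff (h0 n).1.continuous (h0 n).2
  have mφ' : ∀ n, MemLp (pderiv (φ n) j) 2 (vol Ω) := fun n =>
    memLp_of_contDiff (contDiff_pderiv (h0 n).1 j) (hasCompactSupport_pderiv (h0 n).2 j)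
  have t1 := tendsto_integral_mul (Lp.memLp u) mφ m2 h1
  have t2 : Tendsto (fun n => ∫ x in Ω, pderiv (φ n) j x * χ x) atTop
      (𝓝 (∫ x in Ω, G x j * χ x)) :=
    tendsto_integral_mul (memLp_coord (Lp.memLp G) j) mφ' m1
      (tendsto_of_tendsto_of_tendsto_of_le_of_le tendsto_const_nhds h2 (fun _ => zero_le)
        fun n => eLpNorm_coord_le (G := fun x => grad (φ n) x - G x) j _)
  -- The defect of the integration by parts for the n-th smooth approximant is controlled by its
  -- values on Γ, which tend to the vanishing trace g.
  have hbd : ∀ n, ‖(∫ x in Ω, pderiv (φ n) j x * χ x) + ∫ x in Ω, φ n x * pderiv χ j x‖ₑ ≤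
      2 * (((1 + K : ℝ≥0) : ℝ≥0∞) * (eLpNorm (fun x => φ n x - g x) 2 (surf Ω) *
        eLpNorm χ 2 (surf Ω))) := by
    intro n
    have hF : ContDiff ℝ ∞ fun x => φ n x * χ x := (h0 n).1.mul hχ
    have hFc : HasCompactSupport fun x => φ n x * χ x := hχc.mul_left
    -- On the support of χ the domain is the region above the graph, so the sum is an integral of
    -- one derivative over that region.
    have e1 : (∫ x in Ω, pderiv (φ n) j x * χ x) + ∫ x in Ω, φ n x * pderiv χ j x =
        ∫ x in epiSet e ψ, pderiv (fun x => φ n x * χ x) j x := by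
      have ia : Integrable (fun x => pderiv (φ n) j x * χ x) (vol Ω) := (mφ' n).integrable_mul m1
      have ib : Integrable (fun x => φ n x * pderiv χ j x) (vol Ω) := (mφ n).integrable_mul m2
      rw [← integral_add ia ib,
        ← integral_indicator hΩ, ← integral_indicator (isOpen_epiSet hψ).measurableSet]
      congr 1
      ext x
      by_cases hx : x ∈ Metric.ball x₀ r
      · have hiff : x ∈ Ω ↔ x ∈ epiSet e ψ := hgr x hx
        by_cases hxΩ : x ∈ Ω
        · rw [Set.indicator_of_mem hxΩ, Set.indicator_of_mem (hiff.1 hxΩ),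
            pderiv_mul (h0 n).1 hχ]
        · rw [Set.indicator_of_notMem hxΩ, Set.indicator_of_notMem (fun h => hxΩ (hiff.2 h))]
      · have hz : χ x = 0 := image_eq_zero_of_notMem_tsupport fun h => hx (hχs h)
        have hz' : pderiv χ j x = 0 := image_eq_zero_of_notMem_tsupport fun h =>
          hx (hχs (tsupport_pderiv_subset χ j h))
        rw [Set.indicator_apply_eq_zero.2 fun _ => by simp [hz, hz'],
          Set.indicator_apply_eq_zero.2 fun _ => by simp [pderiv_mul (h0 n).1 hχ, hz, hz']]
    rw [e1]
    refine (enorm_integral_epiSet_pderiv_le hd he hψ hinv hF hFc j).trans ?_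
    gcongr
    have e2 : ∫⁻ x in graphSet e ψ, ‖φ n x * χ x‖ₑ ∂(Measure.euclideanHausdorffMeasure (d - 1)) ≤
        ∫⁻ x in Γ, ‖φ n x * χ x‖ₑ ∂(surf Ω) := by
      rw [Measure.restrict_restrict hΓ, Set.inter_eq_self_of_subset_left hΓs,
        ← lintegral_indicator (isClosed_graphSet hψ).measurableSet, ← lintegral_indicator hΓ]
      refine lintegral_mono fun x => ?_
      by_cases hx : x ∈ Metric.ball x₀ r
      · by_cases hxg : x ∈ graphSet e ψ
        · rw [Set.indicator_of_mem hxg, Set.indicator_of_mem (hΓg x hx hxg)]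
        · rw [Set.indicator_of_notMem hxg]
          exact zero_le
      · have hz : χ x = 0 := image_eq_zero_of_notMem_tsupport fun h => hx (hχs h)
        rw [Set.indicator_apply_eq_zero.2 fun _ => by simp [hz]]
        exact zero_le
    refine e2.trans ?_
    -- Since g = 0 on Γ, it may be subtracted from φ n there before Cauchy–Schwarz.
    calc ∫⁻ x in Γ, ‖φ n x * χ x‖ₑ ∂(surf Ω)
        = ∫⁻ x in Γ, ‖(φ n x - g x) * χ x‖ₑ ∂(surf Ω) := by
          apply lintegral_congr_ae
          filter_upwards [hg] with x hx
          rw [hx, sub_zero]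
      _ ≤ ∫⁻ x, ‖(φ n x - g x) * χ x‖ₑ ∂(surf Ω) := setLIntegral_le_lintegral _ _
      _ ≤ _ := lintegral_enorm_mul_le
          ((h0 n).1.continuous.aestronglyMeasurable.sub (Lp.aestronglyMeasurable g)) hχ2.1
  have t3 : Tendsto (fun n => 2 * (((1 + K : ℝ≥0) : ℝ≥0∞) *
      (eLpNorm (fun x => φ n x - g x) 2 (surf Ω) * eLpNorm χ 2 (surf Ω)))) atTop (𝓝 0) := by
    have := ENNReal.Tendsto.const_mul (a := 2) (ENNReal.Tendsto.const_mul
      (a := ((1 + K : ℝ≥0) : ℝ≥0∞)) (ENNReal.Tendsto.mul_const h3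
        (Or.inr hχ2.eLpNorm_ne_top)) (Or.inr (by finiteness))) (Or.inr (by finiteness))
    simpa using this
  have h4 := le_of_tendsto_of_tendsto' (t2.add t1).enorm t3 hbd
  rw [nonpos_iff_eq_zero, enorm_eq_zero] at h4
  exact eq_neg_of_add_eq_zero_right h4

/-- Smooth functions that vanish on `ΓD` belong to `V`. -/
theorem exists_V_of_contDiff (hd : 1 ≤ d) (hΩ : IsLipschitzDomain Ω) (hD : MeasurableSet ΓD)
    {φ : Pt d → ℂ} (hφ : ContDiff ℝ ∞ φ) (hc : HasCompactSupport φ) (h0 : ∀ x ∈ ΓD, φ x = 0) :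
    ∃ v : V Ω ΓD, V.val v =ᵐ[vol Ω] φ ∧ V.gradient v =ᵐ[vol Ω] grad φ ∧
      V.trace v =ᵐ[surf Ω] φ := by
  have := hΩ.isFiniteMeasure_surf hd
  have m1 : MemLp φ 2 (vol Ω) := memLp_of_contDiff hφ.continuous hc
  have m2 : MemLp (grad φ) 2 (vol Ω) :=
    memLp_of_contDiff (continuous_grad hφ) (hasCompactSupport_grad hc)
  have m3 : MemLp φ 2 (surf Ω) := hφ.continuous.memLp_of_hasCompactSupport hc
  have key : ∀ {F : Type} [NormedAddCommGroup F] {μ : Measure (Pt d)} {f : Pt d → F}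
      (hf : MemLp f 2 μ), eLpNorm (fun x => f x - hf.toLp f x) 2 μ = 0 := fun {F} _ μ f hf => by
    rw [← eLpNorm_zero (α := Pt d) (ε := F) (p := 2) (μ := μ)]
    apply eLpNorm_congr_ae
    filter_upwards [hf.coeFn_toLp] with x hx
    rw [hx, sub_self, Pi.zero_apply]
  have htr : IsTrace Ω (m1.toLp φ) (m2.toLp _) (m3.toLp φ) := by
    refine ⟨fun _ => φ, fun _ => ⟨hφ, hc⟩, ?_, ?_, ?_⟩
    · simp only [key m1]; exact tendsto_const_nhds
    · simp only [key m2]; exact tendsto_const_nhds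
    · simp only [key m3]; exact tendsto_const_nhds
  refine ⟨⟨(m1.toLp φ, m2.toLp _, m3.toLp φ), htr.isWeakGradient, htr, ?_⟩, m1.coeFn_toLp,
    m2.coeFn_toLp, m3.coeFn_toLp⟩
  filter_upwards [ae_restrict_of_ae m3.coeFn_toLp, ae_restrict_mem hD] with x hx hxD
  rw [hx, h0 x hxD]

/-- The volume terms of a(E, E) are real, so its imaginary part is −κ times the squared trace norm
on `ΓR`. -/
theorem trace_eq_zero_of_form_self (hκ : 0 < κ) {E : V Ω ΓD} (h : form ΓR κ E E = 0) :
    ∀ᵐ x ∂(surf Ω).restrict ΓR, V.trace E x = 0 := by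
  have h1 := form_self_im (ΓR := ΓR) (κ := κ) E
  rw [h, Complex.zero_im, zero_eq_neg, mul_eq_zero, or_iff_right hκ.ne'] at h1
  have hi : Integrable (fun x => ‖V.trace E x‖ ^ 2) ((surf Ω).restrict ΓR) :=
    ((Lp.memLp (V.trace E)).restrict ΓR).norm.integrable_sq
  rw [integral_eq_zero_iff_of_nonneg (fun x => sq_nonneg _) hi] at h1
  filter_upwards [h1] with x hx
  simpa using hx

theorem pderiv_ofReal {φ : Pt d → ℝ} (hφ : ContDiff ℝ ∞ φ) (j : Fin d) (x : Pt d) :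
    pderiv (fun x => (φ x : ℂ)) j x = (dirDeriv (EuclideanSpace.single j 1) φ x : ℂ) := by
  have h := Complex.ofRealCLM.hasFDerivAt.comp x (hφ.differentiable (by simp) x).hasFDerivAt
  rw [pderiv, show (fun x => (φ x : ℂ)) = Complex.ofRealCLM ∘ φ from rfl, h.fderiv]
  rfl

/-- If the form vanishes at `E`, then the real and imaginary part of `E` solve the Helmholtz
equation on every set on which `E` may be integrated by parts. -/
theorem solvesHelmholtz_of_form_eq_zero (hd : 1 ≤ d) (hΩ : IsLipschitzDomain Ω)
    (hD : MeasurableSet ΓD) {E : V Ω ΓD} (h : ∀ v, form ΓR κ E v = 0)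
    (ht : ∀ᵐ x ∂(surf Ω).restrict ΓR, V.trace E x = 0) {B : Set (Pt d)} (hBD : Disjoint B ΓD)
    (hB : ∀ χ : Pt d → ℂ, ContDiff ℝ ∞ χ → HasCompactSupport χ → tsupport χ ⊆ B → ∀ j : Fin d,
      ∫ x in Ω, V.val E x * pderiv χ j x = -∫ x in Ω, V.gradient E x j * χ x) (L : ℂ →L[ℝ] ℝ) :
    SolvesHelmholtz κ (Ω.indicator fun x => L (V.val E x)) B := by
  intro φ hφ hs
  have hφc : ContDiff ℝ ∞ fun x => (φ x : ℂ) := Complex.ofRealCLM.contDiff.comp hφ.1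
  have hcc : HasCompactSupport fun x => (φ x : ℂ) :=
    hφ.2.comp_left (g := Complex.ofReal) Complex.ofReal_zero
  -- The test function has only to vanish on `ΓD`; its support may cross the rest of the boundary.
  -- This encodes the natural boundary condition that accompanies the zero trace.
  obtain ⟨v, hv1, hv2, hv3⟩ := exists_V_of_contDiff hd hΩ hD hφc hcc fun x hx => by
    rw [image_eq_zero_of_notMem_tsupport fun h' => Set.disjoint_left.1 hBD (hs h') hx,
      Complex.ofReal_zero]
  let e : Fin d → Pt d := fun j => EuclideanSpace.single j 1
  have i1 : ∀ {η : Pt d → ℝ}, IsTest η → Integrable (fun x => V.val E x * (η x : ℂ)) (vol Ω) :=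
    fun hη => integrable_mul_test _ (Complex.continuous_ofReal.comp hη.1.continuous)
      (hη.2.comp_left (g := Complex.ofReal) Complex.ofReal_zero)
  have i2 : ∀ (j : Fin d) {η : Pt d → ℝ}, IsTest η →
      Integrable (fun x => V.gradient E x j * (η x : ℂ)) (vol Ω) :=
    fun j η hη => integrable_coord_mul_test _ j (Complex.continuous_ofReal.comp hη.1.continuous)
      (hη.2.comp_left (g := Complex.ofReal) Complex.ofReal_zero)
  have p1 : pairing (V.gradient E) (V.gradient v) =
      ∑ j, ∫ x in Ω, V.gradient E x j * (dirDeriv (e j) φ x : ℂ) := by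
    rw [pairing, L2.inner_def, ← integral_finsetSum _ fun j _ => i2 j (hφ.dirDeriv (e j))]
    apply integral_congr_ae
    filter_upwards [hv2] with x hx
    rw [hx, PiLp.inner_apply]
    refine Finset.sum_congr rfl fun j _ => ?_
    rw [RCLike.inner_apply]
    change _ * conj (pderiv (fun x => (φ x : ℂ)) j x) = _
    rw [pderiv_ofReal hφ.1, Complex.conj_ofReal]
  have p2 : pairing (V.val E) (V.val v) = ∫ x in Ω, V.val E x * (φ x : ℂ) := by
    rw [pairing, L2.inner_def]
    apply integral_congr_ae
    filter_upwards [hv1] with x hx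
    rw [hx, RCLike.inner_apply, Complex.conj_ofReal]
  have p3 : ∫ x in ΓR, V.trace E x * conj (V.trace v x) ∂(surf Ω) = 0 := by
    refine integral_eq_zero_of_ae ?_
    filter_upwards [ht] with x hx
    rw [hx, zero_mul]; rfl
  have h1 := h v
  rw [form, p1, p2, p3, mul_zero, sub_zero] at h1
  -- A second integration by parts, now moving the derivative off E, is what hypothesis `hB`
  -- permits.
  have p4 : ∀ j, ∫ x in Ω, V.gradient E x j * (dirDeriv (e j) φ x : ℂ) =
      -∫ x in Ω, V.val E x * (dirDeriv (e j) (dirDeriv (e j) φ) x : ℂ) := fun j => by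
    have hj := hφ.dirDeriv (e j)
    have := hB (fun x => (dirDeriv (e j) φ x : ℂ)) (Complex.ofRealCLM.contDiff.comp hj.1)
      (hj.2.comp_left (g := Complex.ofReal) Complex.ofReal_zero)
      ((closure_mono fun x hx => by simpa using hx).trans
        ((tsupport_dirDeriv_subset φ (e j)).trans hs)) j
    simp only [pderiv_ofReal hj.1] at this
    rw [this, neg_neg]
  simp only [p4, Finset.sum_neg_distrib] at h1
  have h2 : ∫ x in Ω, V.val E x * ((laplace φ x + κ ^ 2 * φ x : ℝ) : ℂ) = 0 := by
    have e1 : ∀ x, V.val E x * ((laplace φ x + κ ^ 2 * φ x : ℝ) : ℂ) =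
        (∑ j, V.val E x * (dirDeriv (e j) (dirDeriv (e j) φ) x : ℂ)) +
          (κ : ℂ) ^ 2 * (V.val E x * (φ x : ℂ)) := fun x => by
      rw [← Finset.mul_sum, laplace]
      push_cast
      ring
    simp only [e1]
    rw [integral_add (integrable_finsetSum _ fun j _ => i1 ((hφ.dirDeriv _).dirDeriv _))
      ((i1 hφ).const_mul _), integral_finsetSum _ fun j _ => i1 ((hφ.dirDeriv _).dirDeriv _),
      integral_const_mul]
    linear_combination -h1
  have ht : IsTest fun x => laplace φ x + κ ^ 2 * φ x := by
    refine ⟨(ContDiff.sum fun j _ => ((hφ.dirDeriv _).dirDeriv _).1).add (contDiff_const.mul hφ.1),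
      HasCompactSupport.intro hφ.2 fun x hx => ?_⟩
    have h3 : ∀ j, dirDeriv (e j) (dirDeriv (e j) φ) x = 0 := fun j =>
      image_eq_zero_of_notMem_tsupport fun h' => hx (tsupport_dirDeriv_subset _ _
        (tsupport_dirDeriv_subset _ _ h'))
    have h4 : laplace φ x = 0 := Finset.sum_eq_zero fun j _ => h3 j
    rw [h4, image_eq_zero_of_notMem_tsupport hx, mul_zero, add_zero]
  have h3 := congrArg L h2
  rw [← L.integral_comp_comm (i1 ht), map_zero] at h3
  rw [← h3, ← integral_indicator hΩ.isOpen.measurableSet]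
  congr 1
  ext x
  by_cases hx : x ∈ Ω
  · rw [Set.indicator_of_mem hx, Set.indicator_of_mem hx, mul_comm (V.val E x),
      ← Complex.real_smul, map_smul, smul_eq_mul, mul_comm]
  · rw [Set.indicator_of_notMem hx, Set.indicator_of_notMem hx, zero_mul]

theorem IsRelOpen.measurableSet {Γ : Set (Pt d)} (h : IsRelOpen Ω Γ) : MeasurableSet Γ := by
  obtain ⟨U, hU, rfl⟩ := h
  exact hU.measurableSet.inter isClosed_frontier.measurableSet

theorem IsRelOpen.subset_frontier {Γ : Set (Pt d)} (h : IsRelOpen Ω Γ) : Γ ⊆ frontier Ω := by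
  obtain ⟨U, -, rfl⟩ := h
  exact Set.inter_subset_right

/-- The Helmholtz problem with impedance boundary conditions is uniquely solvable. -/
theorem eq_zero_of_form_eq_zero (hd : 1 ≤ d) (hΩ : IsLipschitzDomain Ω)
    (hΓ : IsBoundaryPartition Ω ΓD ΓN ΓR) (hκ : 0 < κ) {E : V Ω ΓD}
    (h : ∀ v, form ΓR κ E v = 0) : E = 0 := by
  have hvol := hΩ.isFiniteMeasure_vol
  have hsurf := hΩ.isFiniteMeasure_surf hd
  have hD := hΓ.relOpen_D.measurableSet
  have ht := trace_eq_zero_of_form_self hκ (h E)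
  obtain ⟨x₀, hx₀⟩ : ΓR.Nonempty := by
    rw [Set.nonempty_iff_ne_empty]
    intro h0
    have := hΓ.robin_pos
    rw [h0, measure_empty] at this
    exact lt_irrefl _ this
  obtain ⟨U, hU, hUR⟩ := hΓ.relOpen_R
  have hx₀f : x₀ ∈ frontier Ω := hΓ.relOpen_R.subset_frontier hx₀
  obtain ⟨e, ψ, K, r₁, he, hr₁, hψ, hinv, hgr₁⟩ := hΩ.locally_graph x₀ hx₀f
  obtain ⟨r₂, hr₂, hU₂⟩ := Metric.isOpen_iff.1 hU x₀ (hUR ▸ hx₀).1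
  -- In this ball Ω is the region above a graph and all boundary points belong to `ΓR`.
  set r := min r₁ r₂
  have hr : 0 < r := lt_min hr₁ hr₂
  set B := Metric.ball x₀ r
  have hgr : ∀ x ∈ B, x ∈ Ω ↔ ψ x < inner ℝ e x := fun x hx =>
    hgr₁ x (Metric.ball_subset_ball (min_le_left _ _) hx)
  have hBU : B ⊆ U := (Metric.ball_subset_ball (min_le_right _ _)).trans hU₂
  have hx₀g : ψ x₀ = inner ℝ e x₀ := frontier_inter_ball_subset_graphSet hΩ.isOpen hψ hgr
    ⟨hx₀f, Metric.mem_ball_self hr⟩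
  have hBg : ∀ x ∈ B, x ∈ graphSet e ψ → x ∈ ΓR := by
    intro x hx hxg
    have hxg' : ψ x = inner ℝ e x := hxg
    rw [hUR]
    refine ⟨hBU hx, ?_⟩
    rw [hΩ.isOpen.frontier_eq]
    refine ⟨?_, fun h' => ((hgr x hx).1 h').ne hxg'⟩
    have hc : Tendsto (fun t : ℝ => x + t • e) (𝓝[>] 0) (𝓝 x) := by
      have : Continuous fun t : ℝ => x + t • e := by fun_prop
      have := (this.tendsto 0).mono_left (nhdsWithin_le_nhds (s := Set.Ioi 0))
      simpa using this
    refine mem_closure_of_tendsto hc ?_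
    filter_upwards [hc.eventually (Metric.isOpen_ball.mem_nhds hx), self_mem_nhdsWithin]
      with t h1 h2
    rw [hgr _ h1, hinv, inner_unit_add_smul he, hxg']
    exact lt_add_of_pos_right _ h2
  have hBD : Disjoint B ΓD := Set.disjoint_left.2 fun x hx hxD =>
    Set.disjoint_left.1 hΓ.disjoint_DR hxD (hUR ▸ ⟨hBU hx, hΓ.relOpen_D.subset_frontier hxD⟩)
  have hΩD : Disjoint Ω ΓD := Set.disjoint_left.2 fun x hx hxD => by
    have := hΓ.relOpen_D.subset_frontier hxD
    rw [hΩ.isOpen.frontier_eq] at this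
    exact this.2 hx
  have key : ∀ L : ℂ →L[ℝ] ℝ, ∀ᵐ x ∂(vol Ω), L (V.val E x) = 0 := by
    intro L
    set u : Pt d → ℝ := Ω.indicator fun x => L (V.val E x)
    have hui : Integrable u := by
      rw [integrable_indicator_iff hΩ.isOpen.measurableSet]
      exact L.integrable_comp ((Lp.memLp (V.val E)).integrable (by norm_num))
    have huc : HasCompactSupport u := HasCompactSupport.intro
      (hΩ.isBounded.isCompact_closure) fun x hx =>
        Set.indicator_of_notMem (fun h' => hx (subset_closure h')) _
    -- The zero extension solves the equation in the full ball, across the Robin boundary, because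
    -- its trace vanishes there.
    have s1 : SolvesHelmholtz κ u B := solvesHelmholtz_of_form_eq_zero hd hΩ hD h ht hBD
      (fun χ h1 h2 h3 j => integral_mul_pderiv_of_trace_eq_zero hd he hψ hinv
        hΩ.isOpen.measurableSet hgr hΓ.relOpen_R.measurableSet hΓ.relOpen_R.subset_frontier hBg
        E.2.2.1 ht h1 h2 h3 (h1.continuous.memLp_of_hasCompactSupport h2) j) L
    have s2 : SolvesHelmholtz κ u Ω := solvesHelmholtz_of_form_eq_zero hd hΩ hD h ht hΩD
      (fun χ h1 h2 h3 j => E.2.1 χ h1 h2 h3 j) L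
    have hray : ∀ t : ℝ, |t| < r → x₀ + t • e ∈ B := fun t ht' => by
      rw [Metric.mem_ball, dist_eq_norm, add_sub_cancel_left, norm_smul, he, mul_one]
      exact ht'
    -- Below the graph the ball lies outside Ω, where u is zero by construction; this starts the
    -- continuation in the ball, which in turn starts it in Ω.
    have u1 : ∀ᵐ x, x ∈ B → u x = 0 := by
      have hx₁ := hray (-(r / 2)) (by rw [abs_neg, abs_of_pos (half_pos hr)]; linarith)
      have hlt : inner ℝ e (x₀ + (-(r / 2)) • e) < ψ (x₀ + (-(r / 2)) • e) := by
        rw [hinv, inner_unit_add_smul he, hx₀g]; linarith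
      have ho : IsOpen (B ∩ {x | inner ℝ e x < ψ x}) :=
        Metric.isOpen_ball.inter (isOpen_lt (by fun_prop) hψ.continuous)
      obtain ⟨s, hs, hsub⟩ := Metric.isOpen_iff.1 ho _ ⟨hx₁, hlt⟩
      refine ae_eq_zero_of_isPreconnected hui.locallyIntegrable huc Metric.isOpen_ball
        (convex_ball x₀ r).isPreconnected s1 hx₁ hs (Eventually.of_forall fun x hx => ?_)
      refine Set.indicator_of_notMem (fun h' => ?_) _
      exact lt_asymm (hsub hx).2 ((hgr x (hsub hx).1).1 h')
    have hx₂ := hray (r / 2) (by rw [abs_of_pos (half_pos hr)]; linarith)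
    have hx₂Ω : x₀ + (r / 2) • e ∈ Ω := by
      rw [hgr _ hx₂, hinv, inner_unit_add_smul he, hx₀g]; linarith
    obtain ⟨s, hs, hsub⟩ := Metric.isOpen_iff.1 Metric.isOpen_ball _ hx₂
    have u2 := ae_eq_zero_of_isPreconnected hui.locallyIntegrable huc hΩ.isOpen
      hΩ.isConnected.isPreconnected s2 hx₂Ω hs (by
        filter_upwards [u1] with x hx hx'
        exact hx (hsub hx'))
    rw [ae_restrict_iff' hΩ.isOpen.measurableSet]
    filter_upwards [u2] with x hx hxΩ
    exact (Set.indicator_of_mem hxΩ fun x => L (V.val E x)).symm.trans (hx hxΩ)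
  have hval : V.val E = 0 := by
    rw [Lp.eq_zero_iff_ae_eq_zero]
    filter_upwards [key Complex.reCLM, key Complex.imCLM] with x h1 h2
    exact Complex.ext h1 h2
  have hv : ‖V.val E‖ = 0 := by rw [hval, norm_zero]
  refine V.eq_zero_of_norm hd hΩ hv ?_
  have h1 := form_self_re (ΓR := ΓR) (κ := κ) E
  rw [h E, hv, Complex.zero_re] at h1
  have h2 : ‖V.gradient E‖ ^ 2 = 0 := by linarith
  simpa using h2

end ZeroTrace

/-! ### The ideal method -/

section IdealMethod

variable {d : ℕ} {Ω ΓD ΓN ΓR : Set (Pt d)} {M : Mesh Ω} {κ : ℝ}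

theorem form_sub_left (u v w : V Ω ΓD) :
    form ΓR κ (u - v) w = form ΓR κ u w - form ΓR κ v w := by
  simp only [← formL_apply, map_sub, LinearMap.sub_apply]

theorem form_sub_right (u v w : V Ω ΓD) :
    form ΓR κ u (v - w) = form ΓR κ u v - form ΓR κ u w := by
  simp only [← formL_apply, map_sub]

theorem form_add_right (u v w : V Ω ΓD) :
    form ΓR κ u (v + w) = form ΓR κ u v + form ΓR κ u w := by
  simp only [← formL_apply, map_add]

/-- Existence is Lax–Milgram on the closed subspace W. Two solutions differ by an element of W on
which the form vanishes diagonally, so coercivity gives uniqueness. -/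
theorem Mesh.existsUnique_correction (hd : 1 ≤ d) (hΩ : IsLipschitzDomain Ω) (hκ : 0 < κ)
    (hres : M.ResolutionCondition ΓD κ) (v : V Ω ΓD) :
    (∃! c, M.IsCorrection ΓR κ v c) ∧ ∃! c, M.IsDualCorrection ΓR κ v c := by
  have hW := fun {w : V Ω ΓD} => M.mem_remainderSubmodule hΩ (v := w)
  have hco : ∀ w ∈ M.remainderSubmodule hΩ ΓD,
      κ ^ 2 * ‖V.val w‖ ^ 2 ≤ 1 / 2 * ‖V.gradient w‖ ^ 2 := fun w hw =>
    M.remainder_coercive hd hΩ hκ hres (hW.1 hw)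
  obtain ⟨⟨c, hc, hcw⟩, ⟨c', hc', hcw'⟩⟩ := exists_corrections (ΓR := ΓR) hd hΩ hκ
    (M.remainderSubmodule hΩ ΓD) (M.isClosed_remainderSubmodule hΩ) hco v
  refine ⟨⟨c, ⟨hW.1 hc, fun w hw => hcw w (hW.2 hw)⟩, fun b hb => ?_⟩,
    ⟨c', ⟨hW.1 hc', fun w hw => hcw' w (hW.2 hw)⟩, fun b hb => ?_⟩⟩
  · have hm := Submodule.sub_mem _ (hW.2 hb.1) hc
    refine sub_eq_zero.1 (eq_zero_of_form_self (ΓR := ΓR) hd hΩ hκ (hco _ hm) ?_)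
    rw [form_sub_left, hb.2 _ (hW.1 hm), hcw _ hm, sub_self]
  · have hm := Submodule.sub_mem _ (hW.2 hb.1) hc'
    refine sub_eq_zero.1 (eq_zero_of_form_self (ΓR := ΓR) hd hΩ hκ (hco _ hm) ?_)
    rw [form_sub_right, hb.2 _ (hW.1 hm), hcw' _ hm, sub_self]

theorem Mesh.isCorrection_corrector (hd : 1 ≤ d) (hΩ : IsLipschitzDomain Ω) (hκ : 0 < κ)
    (hres : M.ResolutionCondition ΓD κ) (v : V Ω ΓD) :
    M.IsCorrection ΓR κ v (M.corrector ΓR κ v) :=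
  Classical.epsilon_spec (M.existsUnique_correction hd hΩ hκ hres v).1.exists

theorem Mesh.isDualCorrection_dualCorrector (hd : 1 ≤ d) (hΩ : IsLipschitzDomain Ω)
    (hκ : 0 < κ) (hres : M.ResolutionCondition ΓD κ) (v : V Ω ΓD) :
    M.IsDualCorrection ΓR κ v (M.dualCorrector ΓR κ v) :=
  Classical.epsilon_spec (M.existsUnique_correction hd hΩ hκ hres v).2.exists

theorem Mesh.form_sub_corrector (hd : 1 ≤ d) (hΩ : IsLipschitzDomain Ω) (hκ : 0 < κ)
    (hres : M.ResolutionCondition ΓD κ) (v : V Ω ΓD) {w : V Ω ΓD} (hw : w ∈ M.remainder ΓD) :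
    form ΓR κ (v - M.corrector ΓR κ v) w = 0 := by
  rw [form_sub_left, (M.isCorrection_corrector hd hΩ hκ hres v).2 w hw, sub_self]

theorem Mesh.form_sub_dualCorrector (hd : 1 ≤ d) (hΩ : IsLipschitzDomain Ω) (hκ : 0 < κ)
    (hres : M.ResolutionCondition ΓD κ) (v : V Ω ΓD) {w : V Ω ΓD} (hw : w ∈ M.remainder ΓD) :
    form ΓR κ w (v - M.dualCorrector ΓR κ v) = 0 := by
  rw [form_sub_right, (M.isDualCorrection_dualCorrector hd hΩ hκ hres v).2 w hw, sub_self]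

/-- `(1 - C_∞) v` belongs to the ideal trial space. -/
theorem Mesh.sub_corrector_mem_trialSpace (hd : 1 ≤ d) (hΩ : IsLipschitzDomain Ω)
    (hD : IsRelOpen Ω ΓD) (hM : M.Resolves ΓD) (hκ : 0 < κ)
    (hres : M.ResolutionCondition ΓD κ) (u : V Ω ΓD) :
    u - M.corrector ΓR κ u ∈ M.trialSpace ΓD ΓR κ := by
  have hW := fun {w : V Ω ΓD} => M.mem_remainderSubmodule hΩ (v := w)
  obtain ⟨v, hv, hw⟩ := M.exists_sub_mem_remainder hd hΩ hD hM u
  refine ⟨v, hv, ?_⟩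
  have hc := M.isCorrection_corrector (ΓR := ΓR) hd hΩ hκ hres v
  -- With u − v in W, the remainder is its own correction, so C_∞ u = C_∞ v + (u − v) and (1 − C_∞)u
  -- = (1 − C_∞)v.
  have h1 : M.IsCorrection ΓR κ u (M.corrector ΓR κ v + (u - v)) := by
    refine ⟨hW.1 (Submodule.add_mem _ (hW.2 hc.1) hw), fun w hw' => ?_⟩
    have := hc.2 w hw'
    simp only [← formL_apply, map_add, map_sub, LinearMap.add_apply, LinearMap.sub_apply] at this ⊢
    rw [this]
    ring
  have h2 := (M.existsUnique_correction (ΓR := ΓR) hd hΩ hκ hres u).1.unique h1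
    (M.isCorrection_corrector hd hΩ hκ hres u)
  change v - M.corrector ΓR κ v = u - M.corrector ΓR κ u
  rw [← h2]
  abel

/-- The subtracted corrector lies in W, which the form pairs to zero with test functions; hence the
Galerkin function may be replaced by u. -/
theorem Mesh.isPetrovGalerkin (hd : 1 ≤ d) (hΩ : IsLipschitzDomain Ω)
    (hD : IsRelOpen Ω ΓD) (hM : M.Resolves ΓD) (hκ : 0 < κ)
    (hres : M.ResolutionCondition ΓD κ) {f : L2 Ω} {u : V Ω ΓD}
    (hu : IsWeakSolution ΓR κ f u) : M.IsPetrovGalerkin ΓR κ f (u - M.corrector ΓR κ u) := by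
  refine ⟨M.sub_corrector_mem_trialSpace hd hΩ hD hM hκ hres u, ?_⟩
  rintro _ ⟨v, -, rfl⟩
  rw [form_sub_left, M.form_sub_dualCorrector hd hΩ hκ hres v
    (M.isCorrection_corrector hd hΩ hκ hres u).1, sub_zero]
  exact hu _

/-- Every v in V is a test function plus an element of W, and trial functions are a-orthogonal to W.
So a(U, v) is determined by f for all v in V, and uniqueness of the continuous problem applies to
the difference. -/
theorem Mesh.eq_of_isPetrovGalerkin (hd : 1 ≤ d) (hΩ : IsLipschitzDomain Ω)
    (hΓ : IsBoundaryPartition Ω ΓD ΓN ΓR) (hM : M.Resolves ΓD) (hκ : 0 < κ)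
    (hres : M.ResolutionCondition ΓD κ) {f : L2 Ω} {U U' : V Ω ΓD}
    (hU : M.IsPetrovGalerkin ΓR κ f U) (hU' : M.IsPetrovGalerkin ΓR κ f U') : U = U' := by
  have hW := fun {w : V Ω ΓD} => M.mem_remainderSubmodule hΩ (v := w)
  refine sub_eq_zero.1 (eq_zero_of_form_eq_zero hd hΩ hΓ hκ (ΓR := ΓR) fun v => ?_)
  obtain ⟨vH, hvH, hw⟩ := M.exists_sub_mem_remainder hd hΩ hΓ.relOpen_D hM v
  have hdc := M.isDualCorrection_dualCorrector (ΓR := ΓR) hd hΩ hκ hres vH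
  have hr : M.dualCorrector ΓR κ vH + (v - vH) ∈ M.remainder ΓD :=
    hW.1 (Submodule.add_mem _ (hW.2 hdc.1) hw)
  have hv : v = (vH - M.dualCorrector ΓR κ vH) + (M.dualCorrector ΓR κ vH + (v - vH)) := by abel
  have ht : vH - M.dualCorrector ΓR κ vH ∈ M.testSpace ΓD ΓR κ := ⟨vH, hvH, rfl⟩
  have h0 : ∀ X ∈ M.trialSpace ΓD ΓR κ,
      form ΓR κ X (M.dualCorrector ΓR κ vH + (v - vH)) = 0 := by
    rintro _ ⟨x, -, rfl⟩
    exact M.form_sub_corrector hd hΩ hκ hres x hr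
  have key : ∀ X, M.IsPetrovGalerkin ΓR κ f X →
      form ΓR κ X v = pairing f (V.val (vH - M.dualCorrector ΓR κ vH)) := fun X hX => by
    rw [hv, form_add_right, hX.2 _ ht, h0 X hX.1, add_zero]
  rw [form_sub_left, key U hU, key U' hU', sub_self]

/-- The corrector c = C_∞ u satisfies a(c, c) = a(u, c) = (f, c), the hypothesis of `Mesh.normV_le`.
-/
theorem Mesh.normV_corrector_le (hd : 1 ≤ d) (hΩ : IsLipschitzDomain Ω) (hκ : 0 < κ)
    (hres : M.ResolutionCondition ΓD κ) {f : L2 Ω} {u : V Ω ΓD}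
    (hu : IsWeakSolution ΓR κ f u) :
    ENNReal.ofReal (normV κ (M.corrector ΓR κ u)) ≤
      3 * ENNReal.ofReal √M.overlap * M.clementConst ΓD *
        eLpNorm (fun x => (M.widthFun x : ℂ) * f x) 2 (vol Ω) := by
  have hc := M.isCorrection_corrector (ΓR := ΓR) hd hΩ hκ hres u
  exact M.normV_le (ΓR := ΓR) hd hΩ hκ hres hc.1 f ((hc.2 _ hc.1).trans (hu _))

end IdealMethod

end Helmholtz

theorem mainTheorem5 (d : ℕ) (hd : 1 ≤ d ∧ d ≤ 3)
    (Ω ΓD ΓN ΓR : Set (Helmholtz.Pt d))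
    (hΩ : Helmholtz.IsLipschitzDomain Ω)
    (hΓ : Helmholtz.IsBoundaryPartition Ω ΓD ΓN ΓR)
    (M : Helmholtz.Mesh Ω) (hM : M.Resolves ΓD)
    (κ : ℝ) (hκ : 0 < κ) (hres : M.ResolutionCondition ΓD κ)
    (f : Helmholtz.L2 Ω) (u : Helmholtz.V Ω ΓD)
    (hu : Helmholtz.IsWeakSolution ΓR κ f u) :
    (∀ v : Helmholtz.V Ω ΓD,
      (∃! c, M.IsCorrection ΓR κ v c) ∧ (∃! c, M.IsDualCorrection ΓR κ v c)) ∧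
    M.IsPetrovGalerkin ΓR κ f (u - M.corrector ΓR κ u) ∧
    (∀ U : Helmholtz.V Ω ΓD, M.IsPetrovGalerkin ΓR κ f U → U = u - M.corrector ΓR κ u) ∧
    ENNReal.ofReal (Helmholtz.normV κ (u - (u - M.corrector ΓR κ u))) ≤
      3 * ENNReal.ofReal √(M.overlap) * M.clementConst ΓD *
        MeasureTheory.eLpNorm (fun x => (M.widthFun x : ℂ) * f x) 2 (Helmholtz.vol Ω) := by
  refine ⟨Helmholtz.Mesh.existsUnique_correction hd.1 hΩ hκ hres, ?_, fun U hU => ?_, ?_⟩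
  · exact Helmholtz.Mesh.isPetrovGalerkin hd.1 hΩ hΓ.relOpen_D hM hκ hres hu
  · exact Helmholtz.Mesh.eq_of_isPetrovGalerkin hd.1 hΩ hΓ hM hκ hres hU
      (Helmholtz.Mesh.isPetrovGalerkin hd.1 hΩ hΓ.relOpen_D hM hκ hres hu)
  · rw [sub_sub_cancel]
    exact Helmholtz.Mesh.normV_corrector_le hd.1 hΩ hκ hres hu
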